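/- Circuits are Boolean circuits over $\{0,1,\neg,\wedge,\vee\}$ of fan-in at most two; the size of a circuit is the number of its nodes (input nodes included). Hypothesis (H): there is a constant $d\ge 1$ such that every language in P is decided by circuits of size $O(n^d)$. Let $L_{PV}$ be the first-order language with a function symbol for every deterministic polynomial-time clocked Turing machine, interpreted over $\mathbf N$ (with numbers in binary) by the function that the machine computes; a p-time relation is represented by its characteristic function. Let $T_{PV}$ be the set of all universal $L_{PV}$-sentences that are true in $\mathbf N$. Binary strings $w$ of length $l$ are represented by the numbers $\sum_{i<l} w_i2^i<2^l$. For $0<\epsilon<1$ and $k\ge 0$ put $s=s(k):=\lfloor 2^{\epsilon k}\rfloor$ and $n=n(k):=10\cdot s\cdot\lceil\log_2 s\rceil$. A string $x\in\{0,1\}^n$ is read as $s$ blocks of $10\lceil\log_2 s\rceil$ bits, each coding one node of a circuit with $k$ inputs and $s$ nodes (circuits with fewer nodes are padded by idle nodes); the truth-table function $tt_{s,k}:\{0,1\}^n\to\{0,1\}^{2^k}$ maps $x$ to the truth table of this circuit. Theorem. Assume (H). Let $0<\epsilon<1$ and let $k_0\ge 1$ be an integer. Then $T_{PV}$ does not prove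 the sentence $$\forall 1^m\ (m=2^k,\ k\ge k_0)\ \ \exists y\in\{0,1\}^m\ \ \forall x\in\{0,1\}^{n(k)}\quad tt_{s(k),k}(x)\neq y ,$$ whichever symbols of $L_{PV}$ are used to name the relations and functions occurring in it (the number $1$, the relation $\le$, the set of all $1^m$ with $m=2^k$, $k\ge k_0$, the map $1^m\mapsto 1^n$, and the map $(1^m,x)\mapsto tt_{s,k}(x)$). Moreover such symbols exist whenever $\epsilon$ is rational. For $k_0=1$ the sentence is the dual weak pigeonhole principle for $tt_{s,k}$, for all $m=2^k>1$. -/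

import Mathlib

namespace SmallCircuits

/-! ### Boolean circuits -/

/-- A node of a Boolean circuit with `k` inputs that comes after `i` earlier nodes: a constant, an
input variable, or a De Morgan connective applied to earlier nodes. -/
inductive Gate (k i : ℕ) : Type
  | const (b : Bool) : Gate k i
  | input (j : Fin k) : Gate k i
  | not (a : Fin i) : Gate k i
  | and (a b : Fin i) : Gate k i
  | or (a b : Fin i) : Gate k i

/-- The value of a node, given the input `x` and the values `v` of the earlier nodes. -/
def Gate.eval {k i : ℕ} (x : Fin k → Bool) (v : Fin i → Bool) : Gate k i → Bool
  | .const b => b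
  | .input j => x j
  | .not a => !(v a)
  | .and a b => v a && v b
  | .or a b => v a || v b

/-- Boolean circuits (of fan-in at most two) with `k` inputs and of size `s`: straight-line
programs with `s` nodes. -/
inductive Circuit (k : ℕ) : ℕ → Type
  | nil : Circuit k 0
  | snoc {s : ℕ} (C : Circuit k s) (g : Gate k s) : Circuit k (s + 1)

/-- The values of all the nodes of a circuit. -/
def Circuit.vals {k : ℕ} (x : Fin k → Bool) : {s : ℕ} → Circuit k s → Fin s → Bool
  | _, .nil => Fin.elim0
  | _, .snoc C g => Fin.snoc (α := fun _ => Bool) (C.vals x) (g.eval x (C.vals x))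

/-- The output of a circuit is the value of its last node (the circuit without nodes outputs `0`
by convention). -/
def Circuit.eval {k : ℕ} (x : Fin k → Bool) : {s : ℕ} → Circuit k s → Bool
  | _, .nil => false
  | _, .snoc C g => g.eval x (C.vals x)

/-! ### Polynomial time and the hypothesis -/

/-- The language `S` of binary words is decided by a deterministic polynomial-time Turing
machine. -/
def InP (S : Set (List Bool)) : Prop :=
  open Classical in
  Nonempty (Turing.TM2ComputableInPolyTime (id : List Bool → List Bool) Computability.encodeBool
    (fun w => decide (w ∈ S)))

/-- The language `S` has circuits of size `O(n ^ d)`. (The finitely many small `n` are absorbed by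
the constant; `n = 0` has to be left out because `0 ^ d = 0`.) -/
def HasCircuitsOfSize (d : ℕ) (S : Set (List Bool)) : Prop :=
  ∃ c : ℕ, ∀ n : ℕ, 1 ≤ n → ∃ s : ℕ, s ≤ c * n ^ d ∧ ∃ C : Circuit n s,
    ∀ w : Fin n → Bool, C.eval w = true ↔ List.ofFn w ∈ S

/-- Hypothesis (H): for some fixed `d ≥ 1`, every language in P has circuits of size `O(n ^ d)`. -/
def HypothesisH : Prop :=
  ∃ d : ℕ, 1 ≤ d ∧ ∀ S : Set (List Bool), InP S → HasCircuitsOfSize d S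

/-! ### The language of p-time functions and its true universal theory -/

/-- A tuple of numbers as a word: the binary expansions, each followed by the end marker `none`. -/
def encodeTuple {n : ℕ} (v : Fin n → ℕ) : List (Option Bool) :=
  (List.ofFn v).flatMap fun a => (Computability.encodeNat a).map some ++ [none]

/-- An `n`-ary function symbol: a deterministic Turing machine with a polynomial clock, within
which it computes (in binary) the function `toFun`. -/
structure PVSymbol (n : ℕ) : Type 1 where
  /-- the function computed by the machine -/
  toFun : (Fin n → ℕ) → ℕ
  /-- the machine and its polynomial time bound -/
  machine : Turing.TM2ComputableInPolyTime (encodeTuple (n := n)) Computability.encodeNat toFun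

/-- The first-order language with a function symbol for every p-time clocked Turing machine. -/
def LPV : FirstOrder.Language.{1, 0} where
  Functions := PVSymbol
  Relations := fun _ => Empty

/-- The standard interpretation: a symbol stands for the function its machine computes. -/
instance : LPV.Structure ℕ where
  funMap := fun f v => PVSymbol.toFun f v
  RelMap := fun r => nomatch r

/-- The set of all universal sentences of `LPV` that are true in `ℕ`. -/
def TPV : LPV.Theory :=
  {φ | FirstOrder.Language.BoundedFormula.IsUniversal φ ∧ FirstOrder.Language.Sentence.Realize ℕ φ}

/-! ### The truth-table function

A binary string `w` of length `l` is identified with the number `∑ w_i 2 ^ i < 2 ^ l`; so the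
string `1 ^ m` is the number `2 ^ m - 1`, and the strings of length `m` are the numbers below or
equal to it. -/

/-- The substring of length `len` of `x` that begins at position `pos`. -/
def bitField (x pos len : ℕ) : ℕ := x / 2 ^ pos % 2 ^ len

/-- An idle node: it repeats the previous node (and is the constant `0` if there is none). -/
def idleGate (k : ℕ) : (i : ℕ) → Gate k i
  | 0 => .const false
  | i + 1 => .and (Fin.last i) (Fin.last i)

/-- The node after `i` earlier nodes with operation code `op` and operands `a`, `b`. An unused
operation code and an operand out of range give the idle node. -/
def decodeGate (k i op a b : ℕ) : Gate k i :=
  if op = 1 then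
    if h : a < k then .input ⟨a, h⟩ else idleGate k i
  else if op = 2 then
    if h : a < i then .not ⟨a, h⟩ else idleGate k i
  else if op = 3 then
    if h : a < i ∧ b < i then .and ⟨a, h.1⟩ ⟨b, h.2⟩ else idleGate k i
  else if op = 4 then
    if h : a < i ∧ b < i then .or ⟨a, h.1⟩ ⟨b, h.2⟩ else idleGate k i
  else if op = 5 then .const true
  else idleGate k i

/-- The circuit with `s` nodes coded by the string `x` of `s` blocks of `10 * L` bits each. A block
describes one node: `2 * L` bits for the operation and `4 * L` bits for each of two operands.
Circuits with fewer nodes are coded by means of idle nodes. -/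
def decodeCircuit (k L x : ℕ) : (s : ℕ) → Circuit k s
  | 0 => .nil
  | s + 1 => .snoc (decodeCircuit k L x s)
      (decodeGate k s (bitField x (10 * L * s) (2 * L))
        (bitField x (10 * L * s + 2 * L) (4 * L)) (bitField x (10 * L * s + 6 * L) (4 * L)))

/-- The truth table of a circuit with `k` inputs, a string of `2 ^ k` bits: its `j`-th bit is the
output on the binary digits of `j`. -/
def truthTable {k s : ℕ} (C : Circuit k s) : ℕ :=
  ∑ j ∈ Finset.range (2 ^ k), if C.eval (fun i : Fin k => j.testBit i) = true then 2 ^ j else 0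

/-- The size bound `s(k) = 2 ^ (ε k)`; as sizes are integers, its integer part. -/
noncomputable def sizeBound (ε : ℝ) (k : ℕ) : ℕ := ⌊(2 : ℝ) ^ (ε * (k : ℝ))⌋₊

/-- The code length `n = 10 s log s` (with the binary logarithm rounded up). -/
noncomputable def codeLength (ε : ℝ) (k : ℕ) : ℕ :=
  10 * sizeBound ε k * Nat.clog 2 (sizeBound ε k)

/-- The truth-table function `tt_{s,k}` for `s = s(k)`, on strings `x` of length
`codeLength ε k`. -/
noncomputable def ttFun (ε : ℝ) (k x : ℕ) : ℕ :=
  truthTable (decodeCircuit k (Nat.clog 2 (sizeBound ε k)) x (sizeBound ε k))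

/-! ### The sentence -/

/-- The string `1 ^ m` for `m = 2 ^ k`, as a number. -/
def ones (k : ℕ) : ℕ := 2 ^ 2 ^ k - 1

/-- A choice of symbols of `LPV` that name the functions and relations that the sentence speaks
about: the number `1` (the truth value of characteristic functions), the relation `≤`, the set of
the strings `1 ^ m` with `m = 2 ^ k` and `k ≥ k₀`, the map `1 ^ m ↦ 1 ^ n` where `n = 10 s log s`,
and the map `(1 ^ m, x) ↦ tt_{s,k}(x)`. -/
structure Vocabulary (ε : ℝ) (k₀ : ℕ) where
  one : PVSymbol 0
  one_spec : ∀ v, one.toFun v = 1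
  le : PVSymbol 2
  le_spec : ∀ a b : ℕ, le.toFun ![a, b] = if a ≤ b then 1 else 0
  dom : PVSymbol 1
  dom_spec : ∀ z : ℕ, open Classical in
    dom.toFun ![z] = if ∃ k : ℕ, k₀ ≤ k ∧ z = ones k then 1 else 0
  len : PVSymbol 1
  len_spec : ∀ k : ℕ, len.toFun ![ones k] = 2 ^ codeLength ε k - 1
  tt : PVSymbol 2
  tt_spec : ∀ k x : ℕ, x < 2 ^ codeLength ε k → tt.toFun ![ones k, x] = ttFun ε k x

open FirstOrder Language in
/-- The sentence `∀ 1 ^ m (m = 2 ^ k, k ≥ k₀) ∃ y ∈ {0,1} ^ m ∀ x ∈ {0,1} ^ n, tt_{s,k}(x) ≠ y`. -/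
def Vocabulary.dWPHP {ε : ℝ} {k₀ : ℕ} (V : Vocabulary ε k₀) : LPV.Sentence :=
  let one {l : ℕ} : LPV.Term (Empty ⊕ Fin l) := Term.func (L := LPV) V.one ![]
  let le {l : ℕ} (t u : LPV.Term (Empty ⊕ Fin l)) : LPV.Term (Empty ⊕ Fin l) :=
    Term.func (L := LPV) V.le ![t, u]
  let dom {l : ℕ} (t : LPV.Term (Empty ⊕ Fin l)) : LPV.Term (Empty ⊕ Fin l) :=
    Term.func (L := LPV) V.dom ![t]
  let len {l : ℕ} (t : LPV.Term (Empty ⊕ Fin l)) : LPV.Term (Empty ⊕ Fin l) :=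
    Term.func (L := LPV) V.len ![t]
  let tt {l : ℕ} (t u : LPV.Term (Empty ⊕ Fin l)) : LPV.Term (Empty ⊕ Fin l) :=
    Term.func (L := LPV) V.tt ![t, u]
  -- the variables `&0`, `&1`, `&2` are the string `1 ^ m`, `y` and `x`
  BoundedFormula.all (Term.bdEqual (dom (&0)) one ⟹
    BoundedFormula.ex (Term.bdEqual (le (&1) (&0)) one ⊓
      BoundedFormula.all (Term.bdEqual (le (&2) (len (&0))) one ⟹
        BoundedFormula.not (Term.bdEqual (tt (&0) (&2)) (&1)))))

end SmallCircuits

/-! Since `TPV` is a universal theory, it holds in every substructure of an ultrapower of ℕ. It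
therefore suffices to find one such substructure in which the sentence fails. Index a nonprincipal
ultrapower by k, and keep the classes of the feasible functions f(k) = F(2^k, a_k), where F is
polynomial-time with 2^k given in unary, and the advice word a_k has length below 2^(δk) for every δ
> 0 and large k. Finitely many advice words merge into one, and polynomial-time functions compose,
so these classes are closed under all symbols (`Feasible.symbol`).

The sentence fails at the class of 1^m with m = 2^k. Let y of length m be represented by a feasible
f. Fix q and pad the pair (i, a_k) to a word of length N, about 2^(k/q). Since N^q ≥ 2^k, bit i of
f(k) is found in time polynomial in N, so this is a language in P. By (H) it has circuits of size
O(N^d), and d does not depend on q. Hardwiring the advice and the padding leaves a circuit with the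
k bits of i as inputs, of size about 2^(dk/q), whose truth table is f(k)
(`exists_circuit_of_feasible`). As q is arbitrary, the least size of such a circuit is
subexponential (`exists_subExp_circuit`). Here it is essential that a single exponent d serves all
of P.

Hence the code x(k) of this circuit is a word of subexponential length. It can serve as its own
advice, so x is feasible too, and for every ε > 0 it eventually fits into the s(k) nodes
(`exists_feasible_code`). So the model contains a preimage of every y under the truth-table function
(`not_realize_dWPHP`).

The argument is about actual Turing machines, so polynomial time needs its closure properties:
composition, pairs, iteration with bounded results, and finite transducers. Arithmetic, lists and
circuit evaluation are built from these. The same toolkit yields the vocabulary, where rationality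
of ε turns the floor of 2^(εk) into an integer root. -/

namespace SmallCircuits

open Turing Function

/-! ### Programs for stack machines -/

/-! ### Composable stack-machine programs with running times, and the simulation of one machine
inside another. -/

section Programs

variable {K K' Λ Λ' σ σ' : Type} {Γ : K → Type} {Γ' : K' → Type}

/-- The machine `M` gets from `c` to `c'` in at most `t` steps. -/
def StepsTo [DecidableEq K] (M : Λ → TM2.Stmt Γ Λ σ) (c c' : TM2.Cfg Γ Λ σ) (t : ℕ) : Prop :=
  ∃ n ≤ t, (flip bind (TM2.step M))^[n] (some c) = some c'

theorem StepsTo.refl [DecidableEq K] (M : Λ → TM2.Stmt Γ Λ σ) (c : TM2.Cfg Γ Λ σ) (t : ℕ) :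
    StepsTo M c c t := ⟨0, Nat.zero_le _, rfl⟩

theorem StepsTo.trans [DecidableEq K] {M : Λ → TM2.Stmt Γ Λ σ} {c₁ c₂ c₃ : TM2.Cfg Γ Λ σ}
    {t₁ t₂ : ℕ} (h₁ : StepsTo M c₁ c₂ t₁) (h₂ : StepsTo M c₂ c₃ t₂) :
    StepsTo M c₁ c₃ (t₁ + t₂) := by
  obtain ⟨n₁, hn₁, h₁⟩ := h₁
  obtain ⟨n₂, hn₂, h₂⟩ := h₂
  exact ⟨n₂ + n₁, by omega, by rw [Function.iterate_add_apply, h₁, h₂]⟩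

theorem StepsTo.mono [DecidableEq K] {M : Λ → TM2.Stmt Γ Λ σ} {c₁ c₂ : TM2.Cfg Γ Λ σ}
    {t₁ t₂ : ℕ} (h₁ : StepsTo M c₁ c₂ t₁) (h : t₁ ≤ t₂) : StepsTo M c₁ c₂ t₂ := by
  obtain ⟨n₁, hn₁, h₁⟩ := h₁
  exact ⟨n₁, hn₁.trans h, h₁⟩

theorem StepsTo.single [DecidableEq K] {M : Λ → TM2.Stmt Γ Λ σ} {l : Λ} {v : σ}
    {S : ∀ k, List (Γ k)} {c : TM2.Cfg Γ Λ σ} (h : TM2.stepAux (M l) v S = c) :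
    StepsTo M ⟨some l, v, S⟩ c 1 :=
  ⟨1, le_rfl, by simp [flip, h]⟩

/-- The contents of the register and of the stacks. -/
abbrev Store (Γ : K → Type) (σ : Type) : Type := σ × ∀ k, List (Γ k)

/-- A program for stack machines: finitely many labels with their statements, which can be placed
into any larger machine and which leave by way of an exit label. -/
structure Prog (Γ : K → Type) (σ : Type) where
  /-- the labels of the program -/
  Lab : Type
  [fin : Fintype Lab]
  /-- the label where the program starts -/
  entry : Lab
  /-- the statements, when the labels are placed by the first and the exit is the second argument -/
  code : ∀ {Λ : Type}, (Lab → Λ) → Λ → Lab → TM2.Stmt Γ Λ σ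

attribute [instance] Prog.fin

namespace Prog

/-- The program leads from one store to another in at most `t` steps. -/
def Runs [DecidableEq K] (P : Prog Γ σ) (s s' : Store Γ σ) (t : ℕ) : Prop :=
  ∀ (Λ : Type) (M : Λ → TM2.Stmt Γ Λ σ) (emb : P.Lab → Λ) (exit : Λ),
    (∀ l, M (emb l) = P.code emb exit l) →
      StepsTo M ⟨some (emb P.entry), s.1, s.2⟩ ⟨some exit, s'.1, s'.2⟩ t

theorem Runs.mono [DecidableEq K] {P : Prog Γ σ} {s s' : Store Γ σ} {t t' : ℕ}
    (h : P.Runs s s' t) (ht : t ≤ t') : P.Runs s s' t' :=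
  fun Λ M emb exit hM => (h Λ M emb exit hM).mono ht

/-- Apply a function to the register. -/
def load (f : σ → σ) : Prog Γ σ where
  Lab := Unit
  entry := ()
  code := fun _ exit _ => .load f (.goto fun _ => exit)

theorem runs_load [DecidableEq K] (f : σ → σ) (s : Store Γ σ) :
    (load f).Runs s (f s.1, s.2) 1 :=
  fun Λ M emb exit hM => StepsTo.single (by rw [hM]; rfl)

/-- Pop a letter into the register. -/
def pop (k : K) (f : σ → Option (Γ k) → σ) : Prog Γ σ where
  Lab := Unit
  entry := ()
  code := fun _ exit _ => .pop k f (.goto fun _ => exit)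

theorem runs_pop [DecidableEq K] (k : K) (f : σ → Option (Γ k) → σ) (s : Store Γ σ) :
    (pop k f).Runs s (f s.1 (s.2 k).head?, update s.2 k (s.2 k).tail) 1 :=
  fun Λ M emb exit hM => StepsTo.single (by rw [hM]; rfl)

open Classical in
/-- Push the letter given by the register, if there is one. -/
noncomputable def push (k : K) (f : σ → Option (Γ k)) : Prog Γ σ where
  Lab := Unit
  entry := ()
  code := fun _ exit _ =>
    if h : Nonempty (Γ k) then
      .branch (fun v => (f v).isSome) (.push k (fun v => (f v).getD h.some) (.goto fun _ => exit))
        (.goto fun _ => exit)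
    else .goto fun _ => exit

theorem runs_push [DecidableEq K] (k : K) (f : σ → Option (Γ k)) (s : Store Γ σ) :
    (push k f).Runs s (s.1, update s.2 k ((f s.1).toList ++ s.2 k)) 1 := by
  refine fun Λ M emb exit hM => StepsTo.single ?_
  rw [hM]
  unfold push
  by_cases h : Nonempty (Γ k)
  · cases h' : f s.1 <;> simp [h, h']
  · cases h' : f s.1 with
    | none => simp [h]
    | some a => exact absurd ⟨a⟩ h

/-- Run one program after the other. -/
def seq (P Q : Prog Γ σ) : Prog Γ σ where
  Lab := P.Lab ⊕ Q.Lab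
  entry := .inl P.entry
  code := fun emb exit l =>
    match l with
    | .inl l => P.code (fun l => emb (.inl l)) (emb (.inr Q.entry)) l
    | .inr l => Q.code (fun l => emb (.inr l)) exit l

theorem Runs.seq [DecidableEq K] {P Q : Prog Γ σ} {s₁ s₂ s₃ : Store Γ σ} {t₁ t₂ : ℕ}
    (h₁ : P.Runs s₁ s₂ t₁) (h₂ : Q.Runs s₂ s₃ t₂) : (P.seq Q).Runs s₁ s₃ (t₁ + t₂) :=
  fun Λ M emb exit hM =>
    (h₁ Λ M (fun l => emb (.inl l)) _ fun l => hM (.inl l)).trans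
      (h₂ Λ M (fun l => emb (.inr l)) exit fun l => hM (.inr l))

/-- Choose a program by means of the register. -/
def switch {ι : Type} [Fintype ι] (c : σ → ι) (P : ι → Prog Γ σ) : Prog Γ σ where
  Lab := Option (Σ i, (P i).Lab)
  entry := none
  code := fun emb exit l =>
    match l with
    | none => .goto fun v => emb (some ⟨c v, (P (c v)).entry⟩)
    | some ⟨i, l⟩ => (P i).code (fun l => emb (some ⟨i, l⟩)) exit l

theorem Runs.switch [DecidableEq K] {ι : Type} [Fintype ι] {c : σ → ι} {P : ι → Prog Γ σ}
    {s s' : Store Γ σ} {t : ℕ} (h : (P (c s.1)).Runs s s' t) :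
    (Prog.switch c P).Runs s s' (1 + t) :=
  fun Λ M emb exit hM =>
    (StepsTo.single (by rw [show M (emb (Prog.switch c P).entry) = _ from hM none]; rfl)).trans
      (h Λ M (fun l => emb (some ⟨_, l⟩)) exit fun l => hM (some ⟨_, l⟩))

/-- Repeat a program as long as the register has a certain property. -/
def while_ (p : σ → Bool) (P : Prog Γ σ) : Prog Γ σ where
  Lab := Option P.Lab
  entry := none
  code := fun emb exit l =>
    match l with
    | none => .branch p (.goto fun _ => emb (some P.entry)) (.goto fun _ => exit)
    | some l => P.code (fun l => emb (some l)) (emb none) l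

theorem runs_while_false [DecidableEq K] {p : σ → Bool} {P : Prog Γ σ} {s : Store Γ σ}
    (h : p s.1 = false) : (while_ p P).Runs s s 1 :=
  fun Λ M emb exit hM => StepsTo.single (by
    rw [show M (emb (while_ p P).entry) = _ from hM none]
    simp [while_, h])

theorem runs_while_true [DecidableEq K] {p : σ → Bool} {P : Prog Γ σ} {s s' s'' : Store Γ σ}
    {t t' : ℕ} (h : p s.1 = true) (h₁ : P.Runs s s' t) (h₂ : (while_ p P).Runs s' s'' t') :
    (while_ p P).Runs s s'' (1 + t + t') :=
  fun Λ M emb exit hM =>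
    ((StepsTo.single (by
      rw [show M (emb (while_ p P).entry) = _ from hM none]
      simp [while_, h])).trans
      (h₁ Λ M (fun l => emb (some l)) (emb none) fun l => hM (some l))).trans
      (h₂ Λ M emb exit hM)

/-- Pop the letters of a stack one after the other and run a program for each of them. -/
def forEach (i : K) (reg : σ → Option (Γ i)) (setReg : Option (Γ i) → σ → σ) (P : Prog Γ σ) :
    Prog Γ σ :=
  (pop i fun v a => setReg a v).seq
    (while_ (fun v => (reg v).isSome) (P.seq (pop i fun v a => setReg a v)))

/-- The loop rule: `I l s` is an invariant indexed by the letters `l` still on stack `i`. A round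
costs a test, the body and a pop. The final 2 pays for the initial pop and the last, failing test.
The register ends empty because the last pop finds no letter. -/
theorem runs_forEach [DecidableEq K] {i : K} {reg : σ → Option (Γ i)}
    {setReg : Option (Γ i) → σ → σ} {P : Prog Γ σ} (hreg : ∀ a v, reg (setReg a v) = a)
    (I : List (Γ i) → Store Γ σ → Prop) (T : ℕ) (hI : ∀ l s, I l s → s.2 i = l)
    (hP : ∀ a l s, I (a :: l) s → ∃ s', P.Runs (setReg (some a) s.1, update s.2 i l) s' T ∧ I l s')
    (l : List (Γ i)) (s : Store Γ σ) (hs : I l s) :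
    ∃ s', I [] s' ∧
      (forEach i reg setReg P).Runs s (setReg none s'.1, s'.2) (l.length * (T + 2) + 2) := by
  -- The while loop is entered just after a pop, whereas the invariant describes the store just
  -- before it.
  suffices h : ∀ l s, I l s → ∃ s', I [] s' ∧
      (while_ (fun v => (reg v).isSome) (P.seq (pop i fun v a => setReg a v))).Runs
        (setReg l.head? s.1, update s.2 i l.tail) (setReg none s'.1, s'.2)
        (l.length * (T + 2) + 1) by
    obtain ⟨s', h₁, h₂⟩ := h l s hs
    refine ⟨s', h₁, ((runs_pop i _ s).seq ?_).mono (le_of_eq (Nat.add_comm 1 _))⟩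
    rw [hI l s hs]
    exact h₂
  intro l
  induction l with
  | nil =>
    intro s hs
    refine ⟨s, hs, ?_⟩
    have : update s.2 i (List.tail []) = s.2 := by
      rw [show List.tail [] = s.2 i from (hI _ _ hs).symm, update_eq_self]
    rw [this]
    exact (runs_while_false (by simp [hreg])).mono (by omega)
  | cons a l ih =>
    intro s hs
    obtain ⟨s₁, h₁, h₂⟩ := hP a l s hs
    obtain ⟨s', h₃, h₄⟩ := ih s₁ h₂
    refine ⟨s', h₃, (runs_while_true (by simp [hreg]) (h₁.seq (runs_pop i _ s₁)) ?_).mono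
      (t := 1 + (T + 1) + (l.length * (T + 2) + 1)) ?_⟩
    · rw [hI l s₁ h₂]
      exact h₄
    · simp only [List.length_cons]; ring_nf; omega

end Prog

/-- An embedding of the stacks and the register of a machine into those of a larger one. -/
structure StoreEmbedding (Γ : K → Type) (σ : Type) (Γ' : K' → Type) (σ' : Type) where
  /-- the place of a stack -/
  idx : K → K'
  idx_injective : Injective idx
  /-- the translation of the letters -/
  letter : ∀ k, Γ k ≃ Γ' (idx k)
  /-- the content of the small register -/
  get : σ' → σ
  /-- changes the content of the small register -/
  set : σ → σ' → σ'
  get_set : ∀ v w, get (set v w) = v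
  set_get : ∀ w, set (get w) w = w
  set_set : ∀ v v' w, set v (set v' w) = set v w

namespace StoreEmbedding

variable (E : StoreEmbedding Γ σ Γ' σ')

/-- The translation of a statement; halting is replaced by a jump to `exit`. -/
def stmt (lab : Λ → Λ') (exit : Λ') : TM2.Stmt Γ Λ σ → TM2.Stmt Γ' Λ' σ'
  | .push k f q => .push (E.idx k) (fun w => E.letter k (f (E.get w))) (stmt lab exit q)
  | .peek k f q =>
    .peek (E.idx k) (fun w a => E.set (f (E.get w) (a.map (E.letter k).symm)) w) (stmt lab exit q)
  | .pop k f q =>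
    .pop (E.idx k) (fun w a => E.set (f (E.get w) (a.map (E.letter k).symm)) w) (stmt lab exit q)
  | .load f q => .load (fun w => E.set (f (E.get w)) w) (stmt lab exit q)
  | .branch f q₁ q₂ => .branch (fun w => f (E.get w)) (stmt lab exit q₁) (stmt lab exit q₂)
  | .goto f => .goto fun w => lab (f (E.get w))
  | .halt => .goto fun _ => exit

/-- The large stacks `S'` contain the small ones and agree with `S₀` elsewhere. -/
structure Matches (S₀ : ∀ k, List (Γ' k)) (S : ∀ k, List (Γ k)) (S' : ∀ k, List (Γ' k)) :
    Prop where
  idx : ∀ k, S' (E.idx k) = (S k).map (E.letter k)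
  frame : ∀ k, k ∉ Set.range E.idx → S' k = S₀ k

/-- Corresponding configurations. -/
def MatchesCfg (lab : Λ → Λ') (exit : Λ') (w₀ : σ') (S₀ : ∀ k, List (Γ' k))
    (c : TM2.Cfg Γ Λ σ) (c' : TM2.Cfg Γ' Λ' σ') : Prop :=
  c'.l = some ((c.l.map lab).getD exit) ∧ c'.var = E.set c.var w₀ ∧ E.Matches S₀ c.stk c'.stk

variable {E}

theorem Matches.update [DecidableEq K] [DecidableEq K'] {S₀ S' : ∀ k, List (Γ' k)}
    {S : ∀ k, List (Γ k)} (h : E.Matches S₀ S S') (k : K) (l : List (Γ k))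
    (l' : List (Γ' (E.idx k))) (hl : l' = l.map (E.letter k)) :
    E.Matches S₀ (update S k l) (update S' (E.idx k) l') where
  idx := fun j => by
    by_cases hj : j = k
    · subst hj; simp [hl]
    · rw [update_of_ne (fun e => hj (E.idx_injective e)), update_of_ne hj, h.idx]
  frame := fun j hj => by
    rw [update_of_ne (fun e => hj ⟨k, e.symm⟩), h.frame j hj]

theorem Matches.eq {S₀ S' S'' : ∀ k, List (Γ' k)} {S : ∀ k, List (Γ k)} (h : E.Matches S₀ S S')
    (h' : E.Matches S₀ S S'') : S' = S'' := by
  funext k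
  by_cases hk : k ∈ Set.range E.idx
  · obtain ⟨j, rfl⟩ := hk
    rw [h.idx, h'.idx]
  · rw [h.frame k hk, h'.frame k hk]

/-- Simulation of one step, by induction on the statement: each instruction reads and writes only
the embedded stacks and the embedded part of the register. -/
theorem matches_stepAux [DecidableEq K] [DecidableEq K'] (lab : Λ → Λ') (exit : Λ') (w₀ : σ')
    (S₀ : ∀ k, List (Γ' k)) (q : TM2.Stmt Γ Λ σ) (v : σ) (S : ∀ k, List (Γ k))
    (S' : ∀ k, List (Γ' k)) (h : E.Matches S₀ S S') :
    E.MatchesCfg lab exit w₀ S₀ (TM2.stepAux q v S)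
      (TM2.stepAux (E.stmt lab exit q) (E.set v w₀) S') := by
  induction q generalizing v S S' with
  | push k f q ih =>
    exact ih _ _ _ (h.update k _ _ (by simp [E.get_set, h.idx]))
  | peek k f q ih =>
    have := ih (f v (S k).head?) S S' h
    simpa [stmt, E.get_set, h.idx, E.set_set, List.head?_map] using this
  | pop k f q ih =>
    have := ih (f v (S k).head?) _ _ (h.update k (S k).tail (S' (E.idx k)).tail
      (by rw [h.idx, List.map_tail]))
    simpa [stmt, E.get_set, h.idx, E.set_set, List.head?_map] using this
  | load f q ih =>
    have := ih (f v) S S' h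
    simpa [stmt, E.get_set, E.set_set] using this
  | branch f q₁ q₂ ih₁ ih₂ =>
    simp only [stmt, TM2.stepAux, E.get_set]
    cases f v
    · exact ih₂ _ _ _ h
    · exact ih₁ _ _ _ h
  | goto f => exact ⟨by simp [stmt, E.get_set], rfl, h⟩
  | halt => exact ⟨rfl, rfl, h⟩

/-- Steps correspond one to one. A halted small machine has no further step, so its counterpart
waiting at `exit` never has to move. -/
theorem matches_iterate [DecidableEq K] [DecidableEq K'] {lab : Λ → Λ'} {exit : Λ'} {w₀ : σ'}
    {S₀ : ∀ k, List (Γ' k)} {m : Λ → TM2.Stmt Γ Λ σ} {M : Λ' → TM2.Stmt Γ' Λ' σ'}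
    (hM : ∀ l, M (lab l) = E.stmt lab exit (m l)) (n : ℕ) (c c₁ : TM2.Cfg Γ Λ σ)
    (c' : TM2.Cfg Γ' Λ' σ') (h : E.MatchesCfg lab exit w₀ S₀ c c')
    (hn : (flip bind (TM2.step m))^[n] (some c) = some c₁) :
    ∃ c₁', E.MatchesCfg lab exit w₀ S₀ c₁ c₁' ∧ StepsTo M c' c₁' n := by
  induction n generalizing c c' with
  | zero =>
    obtain rfl : c = c₁ := by simpa using hn
    exact ⟨c', h, StepsTo.refl _ _ _⟩
  | succ n ih =>
    rw [iterate_succ_apply] at hn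
    obtain ⟨_ | l, v, S⟩ := c
    · have : ∀ n, (flip bind (TM2.step m))^[n] none = none := fun n => by
        induction n with
        | zero => rfl
        | succ n ih => rw [iterate_succ_apply]; exact ih
      rw [show flip bind (TM2.step m) (some ⟨none, v, S⟩) = none from rfl, this] at hn
      simp at hn
    · obtain ⟨l', w, S'⟩ := c'
      obtain ⟨rfl, rfl, hS⟩ := h
      obtain ⟨c₁', h₁, h₂⟩ := ih (TM2.stepAux (m l) v S) _
        (matches_stepAux lab exit w₀ S₀ (m l) v S S' hS) hn
      refine ⟨c₁', h₁, ?_⟩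
      rw [Nat.add_comm]
      refine (StepsTo.single ?_).trans h₂
      simp [hM]

end StoreEmbedding

/-- A machine as a part of a larger one. -/
def Prog.call (m : Λ → TM2.Stmt Γ Λ σ) [Fintype Λ] (main : Λ) (E : StoreEmbedding Γ σ Γ' σ') :
    Prog Γ' σ' where
  Lab := Λ
  entry := main
  code := fun emb exit l => E.stmt emb exit (m l)

theorem Prog.runs_call [DecidableEq K] [DecidableEq K'] [Fintype Λ] {m : Λ → TM2.Stmt Γ Λ σ}
    {main : Λ} {E : StoreEmbedding Γ σ Γ' σ'} {v v' : σ} {S S' : ∀ k, List (Γ k)} {t : ℕ}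
    (h : StepsTo m ⟨some main, v, S⟩ ⟨none, v', S'⟩ t) {w : σ'} {T T' : ∀ k, List (Γ' k)}
    (hw : E.get w = v) (hT : E.Matches T S T) (hT' : E.Matches T S' T') :
    (Prog.call m main E).Runs (w, T) (E.set v' w, T') t := by
  intro Λ' M emb exit hM
  obtain ⟨n, hn, h⟩ := h
  obtain ⟨⟨l, w', T''⟩, h₁, h₂⟩ := StoreEmbedding.matches_iterate (E := E) (w₀ := w) (S₀ := T)
    (lab := emb) (exit := exit) hM n _ _ ⟨some (emb main), w, T⟩
    ⟨rfl, by rw [← hw, E.set_get], hT⟩ h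
  obtain ⟨rfl, rfl, h₃⟩ := h₁
  obtain rfl := h₃.eq hT'
  exact h₂.mono hn

end Programs

end SmallCircuits

/-! ### Polynomial time: from machines to programs and back, and transport of words between stacks.
-/

namespace SmallCircuits

open Turing Function

/-! ### Polynomial bounds -/

/-- A function on `ℕ` that is bounded by a polynomial. -/
def PolyBounded (t : ℕ → ℕ) : Prop := ∃ p : Polynomial ℕ, ∀ n, t n ≤ p.eval n

namespace PolyBounded

theorem eval_mono (p : Polynomial ℕ) : Monotone fun n => p.eval n := fun m n h => by
  simp only [Polynomial.eval_eq_sum_range]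
  exact Finset.sum_le_sum fun i _ => Nat.mul_le_mul_left _ (Nat.pow_le_pow_left h i)

theorem of_eval (p : Polynomial ℕ) : PolyBounded fun n => p.eval n := ⟨p, fun _ => le_rfl⟩

theorem const (c : ℕ) : PolyBounded fun _ => c := ⟨.C c, fun n => by simp⟩

theorem id : PolyBounded fun n => n := ⟨.X, fun n => by simp⟩

theorem add {t u : ℕ → ℕ} (ht : PolyBounded t) (hu : PolyBounded u) :
    PolyBounded fun n => t n + u n := by
  obtain ⟨p, hp⟩ := ht
  obtain ⟨q, hq⟩ := hu
  exact ⟨p + q, fun n => by simpa using Nat.add_le_add (hp n) (hq n)⟩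

theorem mul {t u : ℕ → ℕ} (ht : PolyBounded t) (hu : PolyBounded u) :
    PolyBounded fun n => t n * u n := by
  obtain ⟨p, hp⟩ := ht
  obtain ⟨q, hq⟩ := hu
  exact ⟨p * q, fun n => by simpa using Nat.mul_le_mul (hp n) (hq n)⟩

theorem eval_comp (p : Polynomial ℕ) {t : ℕ → ℕ} (ht : PolyBounded t) :
    PolyBounded fun n => p.eval (t n) := by
  obtain ⟨q, hq⟩ := ht
  exact ⟨p.comp q, fun n => by simpa using eval_mono p (hq n)⟩

end PolyBounded

/-! ### Polynomial-time functions -/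

section PolyTime

variable {α β γ A B C : Type} {ea : α → List A} {eb : β → List B} {ec : γ → List C}

/-- The function `f` is computed in polynomial time by a stack machine. -/
def PolyTime (ea : α → List A) (eb : β → List B) (f : α → β) : Prop :=
  Nonempty (TM2ComputableInPolyTime ea eb f)

/-- A machine sees only encoded words, so the same machine computes any function that has the same
words as values. This permits a change of the type behind an encoding. -/
theorem PolyTime.congr_output {f : α → β} (h : PolyTime ea eb f) {eb' : γ → List B} {f' : α → γ}
    (he : ∀ a, eb' (f' a) = eb (f a)) : PolyTime ea eb' f' := by
  obtain ⟨h⟩ := h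
  exact ⟨⟨h.toTM2ComputableAux, h.time, fun a => by rw [he]; exact h.outputsFun a⟩⟩

theorem PolyTime.congr_input {f : α → β} (h : PolyTime ea eb f) {ea' : γ → List A} (g : γ → α)
    (he : ∀ c, ea' c = ea (g c)) : PolyTime ea' eb fun c => f (g c) := by
  obtain ⟨h⟩ := h
  exact ⟨⟨h.toTM2ComputableAux, h.time, fun c => by rw [he]; exact h.outputsFun (g c)⟩⟩

/-- The stacks that are all empty except for one of them. -/
abbrev single {K : Type} [DecidableEq K] {Γ : K → Type} (k : K) (l : List (Γ k)) :
    ∀ k, List (Γ k) := update (fun _ => []) k l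

/-- A program becomes a machine by giving it a halting exit label. It must leave the register as it
found it and all stacks empty except for the output, as the halting convention demands. -/
theorem PolyTime.of_prog {K : Type} [DecidableEq K] [Fintype K] {Γ : K → Type} {σ : Type}
    [Fintype σ] [Fintype A] (P : Prog Γ σ) (k₀ k₁ : K) (v₀ : σ) (e₀ : A ≃ Γ k₀) (e₁ : B ≃ Γ k₁)
    {f : α → β} {t : ℕ → ℕ} (ht : PolyBounded t)
    (h : ∀ a, P.Runs (v₀, single k₀ ((ea a).map e₀)) (v₀, single k₁ ((eb (f a)).map e₁))
      (t (ea a).length)) : PolyTime ea eb f := by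
  obtain ⟨p, hp⟩ := ht
  let _ : Fintype (Γ k₀) := Fintype.ofEquiv A e₀
  -- The label `none` is the exit; halting there is the extra step in the time bound `p + 1`.
  let M : Option P.Lab → TM2.Stmt Γ (Option P.Lab) σ := fun l =>
    match l with
    | some l => P.code some none l
    | none => .halt
  let tm : FinTM2 :=
    { K := K, k₀ := k₀, k₁ := k₁, Γ := Γ, Λ := Option P.Lab, main := some P.entry, σ := σ,
      initialState := v₀, m := M }
  refine ⟨⟨⟨tm, e₀.symm, e₁.symm⟩, p + 1, fun a => ?_⟩⟩
  have h₁ : StepsTo M ⟨some (some P.entry), v₀, single k₀ ((ea a).map e₀)⟩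
      ⟨none, v₀, single k₁ ((eb (f a)).map e₁)⟩ (t (ea a).length + 1) :=
    (h a _ M some none fun l => rfl).trans (StepsTo.single rfl)
  have hi : initList tm (List.map e₀.symm.invFun (ea a)) =
      ⟨some (some P.entry), v₀, single k₀ ((ea a).map e₀)⟩ := by
    unfold initList
    congr 1
    funext k
    rcases eq_or_ne k₀ k with hk | hk
    · subst hk; simp [single, tm]
    · simp [single, tm, hk.symm]
  have ho : haltList tm (List.map e₁.symm.invFun (eb (f a))) =
      ⟨none, v₀, single k₁ ((eb (f a)).map e₁)⟩ := by
    unfold haltList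
    congr 1
    funext k
    rcases eq_or_ne k₁ k with hk | hk
    · subst hk; simp [single, tm]
    · simp [single, tm, hk.symm]
  have h₂ : ∃ n ≤ (p + 1).eval (ea a).length, (flip bind tm.step)^[n]
      (some (initList tm (List.map e₀.symm.invFun (ea a)))) =
      some (haltList tm (List.map e₁.symm.invFun (eb (f a)))) := by
    obtain ⟨n, hn, h₁⟩ := h₁
    refine ⟨n, hn.trans ?_, ?_⟩
    · have := hp (ea a).length
      simp only [Polynomial.eval_add, Polynomial.eval_one]
      omega
    · rw [hi, ho]; exact h₁
  exact ⟨⟨h₂.choose, h₂.choose_spec.2⟩, h₂.choose_spec.1⟩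

theorem stepsTo_of_computable {f : α → β} (h : TM2ComputableInPolyTime ea eb f) (a : α) :
    StepsTo h.tm.m
      ⟨some h.tm.main, h.tm.initialState, single h.tm.k₀ ((ea a).map h.inputAlphabet.symm)⟩
      ⟨none, h.tm.initialState, single h.tm.k₁ ((eb (f a)).map h.outputAlphabet.symm)⟩
      (h.time.eval (ea a).length) := by
  obtain ⟨⟨n, h₁⟩, h₂⟩ := h.outputsFun a
  refine ⟨n, h₂, ?_⟩
  have hi : initList h.tm (List.map h.inputAlphabet.invFun (ea a)) =
      ⟨some h.tm.main, h.tm.initialState, single h.tm.k₀ ((ea a).map h.inputAlphabet.symm)⟩ := by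
    unfold initList
    congr 1
    funext k
    by_cases hk : k = h.tm.k₀
    · subst hk; simp [single]
    · simp [single, hk]
  have ho : haltList h.tm (List.map h.outputAlphabet.invFun (eb (f a))) =
      ⟨none, h.tm.initialState, single h.tm.k₁ ((eb (f a)).map h.outputAlphabet.symm)⟩ := by
    unfold haltList
    congr 1
    funext k
    by_cases hk : k = h.tm.k₁
    · subst hk; simp [single]
    · simp [single, hk]
  rw [hi, Option.map_some, ho] at h₁
  exact h₁

/-- The largest number of letters that a statement pushes. -/
def pushes {K : Type} {Γ : K → Type} {Λ σ : Type} : TM2.Stmt Γ Λ σ → ℕ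
  | .push _ _ q => pushes q + 1
  | .peek _ _ q => pushes q
  | .pop _ _ q => pushes q
  | .load _ q => pushes q
  | .branch _ q₁ q₂ => max (pushes q₁) (pushes q₂)
  | .goto _ => 0
  | .halt => 0

theorem length_stepAux_le {K : Type} [DecidableEq K] {Γ : K → Type} {Λ σ : Type}
    (q : TM2.Stmt Γ Λ σ) (v : σ) (S : ∀ k, List (Γ k)) (k : K) :
    ((TM2.stepAux q v S).stk k).length ≤ (S k).length + pushes q := by
  induction q generalizing v S with
  | push j f q ih =>
    refine (ih _ _).trans ?_
    by_cases h : k = j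
    · subst h; simp [pushes]; omega
    · rw [update_of_ne h]; simp [pushes]
  | peek j f q ih => exact ih _ _
  | pop j f q ih =>
    refine (ih _ _).trans ?_
    by_cases h : k = j
    · subst h; simp [pushes]
    · rw [update_of_ne h]; simp [pushes]
  | load f q ih => exact ih _ _
  | branch f q₁ q₂ ih₁ ih₂ =>
    simp only [TM2.stepAux, pushes]
    cases f v
    · exact (ih₂ v S).trans (by omega)
    · exact (ih₁ v S).trans (by omega)
  | goto f => simp [pushes]
  | halt => simp [pushes]

theorem StepsTo.length_le {K : Type} [DecidableEq K] {Γ : K → Type} {Λ σ : Type}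
    {M : Λ → TM2.Stmt Γ Λ σ} {b : ℕ} (hb : ∀ l, pushes (M l) ≤ b) {c c' : TM2.Cfg Γ Λ σ} {t : ℕ}
    (h : StepsTo M c c' t) (k : K) : (c'.stk k).length ≤ (c.stk k).length + b * t := by
  obtain ⟨n, hn, h⟩ := h
  suffices (c'.stk k).length ≤ (c.stk k).length + b * n from
    this.trans (Nat.add_le_add_left (Nat.mul_le_mul_left _ hn) _)
  clear hn t
  induction n generalizing c' with
  | zero =>
    obtain rfl : c = c' := by simpa using h
    simp
  | succ n ih =>
    rw [iterate_succ_apply'] at h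
    rcases h' : (flip bind (TM2.step M))^[n] (some c) with _ | c₁
    · rw [h'] at h; simp [flip] at h
    · rw [h'] at h
      have h₁ := ih h'
      obtain ⟨_ | l, v, S⟩ := c₁
      · simp [flip] at h
      · obtain rfl : TM2.stepAux (M l) v S = c' := by simpa [flip] using h
        refine (length_stepAux_le _ _ _ _).trans ?_
        have := hb l
        simp only [Nat.mul_succ] at h₁ ⊢
        omega

/-- The values of a polynomial-time function have polynomially bounded length. -/
theorem PolyTime.length_le {f : α → β} (h : PolyTime ea eb f) :
    ∃ p : Polynomial ℕ, ∀ a, (eb (f a)).length ≤ p.eval (ea a).length := by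
  obtain ⟨h⟩ := h
  let _ := h.tm.ΛFin
  let b := Finset.univ.sup fun l => pushes (h.tm.m l)
  refine ⟨.X + .C b * h.time, fun a => ?_⟩
  have h₁ := (stepsTo_of_computable h a).length_le (b := b)
    (fun l => Finset.le_sup (f := fun l => pushes (h.tm.m l)) (Finset.mem_univ l)) h.tm.k₁
  -- The output stack starts empty unless it is also the input stack.
  have h₂ : (single h.tm.k₀ ((ea a).map h.inputAlphabet.symm) h.tm.k₁).length ≤
      (ea a).length := by
    by_cases hk : h.tm.k₁ = h.tm.k₀
    · have : ∀ k, k = h.tm.k₀ →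
          (single h.tm.k₀ ((ea a).map h.inputAlphabet.symm) k).length = (ea a).length := by
        rintro _ rfl; simp [single]
      exact (this _ hk).le
    · simp [single, update_of_ne hk]
  simp [single] at h₁ h₂ ⊢
  omega

/-! ### Moving letters between stacks -/

/-- A part of the register that holds at most one letter. -/
structure LetterRegister (σ X : Type) where
  /-- the letter -/
  get : σ → Option X
  /-- changes the letter -/
  set : Option X → σ → σ
  get_set : ∀ a v, get (set a v) = a
  set_set : ∀ a b v, set a (set b v) = set a v

section Move

variable {K : Type} {Γ : K → Type} {σ X : Type}

/-- For each letter of the stack `i`, put it into the register and run a program. -/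
def Prog.forEachLetter (i : K) (e : Γ i ≃ X) (ρ : LetterRegister σ X) (P : Prog Γ σ) : Prog Γ σ :=
  Prog.forEach i (fun v => (ρ.get v).map e.symm) (fun a v => ρ.set (a.map e) v) P

/-- Move the letters of the stack `i` to other stacks. -/
noncomputable def Prog.move (i j₁ j₂ : K) (e : Γ i ≃ X) (ρ : LetterRegister σ X)
    (g₁ : X → Option (Γ j₁)) (g₂ : X → Option (Γ j₂)) : Prog Γ σ :=
  Prog.forEachLetter i e ρ
    ((Prog.push j₁ fun v => (ρ.get v).bind g₁).seq (Prog.push j₂ fun v => (ρ.get v).bind g₂))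

/-- Pushing reverses the order, whence the `reverse`. The invariant splits `l` into the letters `l₁`
already moved and the letters `l₂` still on stack `i`. -/
theorem Prog.runs_move [DecidableEq K] {i j₁ j₂ : K} (e : Γ i ≃ X) (ρ : LetterRegister σ X)
    (g₁ : X → Option (Γ j₁)) (g₂ : X → Option (Γ j₂)) (h₁ : j₁ ≠ i) (h₂ : j₂ ≠ i)
    (h₁₂ : j₁ ≠ j₂) (S : ∀ k, List (Γ k)) (hS : S i = []) (l : List X) (v : σ)
    {r₁ : List (Γ j₁)} {r₂ : List (Γ j₂)} (hr₁ : r₁ = (l.filterMap g₁).reverse ++ S j₁)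
    (hr₂ : r₂ = (l.filterMap g₂).reverse ++ S j₂) :
    (Prog.move i j₁ j₂ e ρ g₁ g₂).Runs (v, update S i (l.map e.symm))
      (ρ.set none v, update (update S j₁ r₁) j₂ r₂) (l.length * 4 + 2) := by
  subst hr₁ hr₂
  obtain ⟨s', hs', h⟩ := Prog.runs_forEach (i := i) (reg := fun v => (ρ.get v).map e.symm)
    (setReg := fun a v => ρ.set (a.map e) v)
    (P := (Prog.push j₁ fun v => (ρ.get v).bind g₁).seq
      (Prog.push j₂ fun v => (ρ.get v).bind g₂))
    (by intro a v; cases a <;> simp [ρ.get_set])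
    (fun r s => ρ.set none s.1 = ρ.set none v ∧ ∃ l₁ l₂ : List X, l = l₁ ++ l₂ ∧
      r = l₂.map e.symm ∧ s.2 = update (update (update S j₁ ((l₁.filterMap g₁).reverse ++ S j₁)) j₂
        ((l₁.filterMap g₂).reverse ++ S j₂)) i r) 2
    (by rintro r s ⟨-, l₁, l₂, -, rfl, h⟩; simp [h])
    (by
      rintro a r ⟨w, S'⟩ ⟨hw, l₁, l₂, rfl, hr, rfl⟩
      rcases l₂ with _ | ⟨b, l₂⟩
      · simp at hr
      obtain ⟨rfl, rfl⟩ : a = e.symm b ∧ r = l₂.map e.symm := by simpa using hr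
      refine ⟨_, (Prog.runs_push _ _ _).seq (Prog.runs_push _ _ _), ?_, l₁ ++ [b], l₂, by simp,
        rfl, ?_⟩
      · simp [ρ.set_set, ← hw]
      · funext k
        simp only [ρ.get_set, Option.map_some, Equiv.apply_symm_apply, Option.bind_some,
          List.filterMap_append, List.reverse_append, update_idem]
        by_cases hi : k = i
        · subst hi
          simp [update_of_ne h₁.symm, update_of_ne h₂.symm]
        · rw [update_of_ne hi]
          by_cases hk₂ : k = j₂
          · subst hk₂
            simp only [update_self, update_of_ne h₁₂.symm, update_of_ne h₂]
            cases h : g₂ b <;> simp [h]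
          · rw [update_of_ne hk₂, update_of_ne hk₂]
            by_cases hk₁ : k = j₁
            · subst hk₁
              simp only [update_self, update_of_ne h₁, update_of_ne h₁₂]
              cases h : g₁ b <;> simp [h]
            · simp [update_of_ne hk₁, update_of_ne hk₂, update_of_ne hi])
    (l.map e.symm) (v, update S i (l.map e.symm)) ⟨rfl, [], l, rfl, rfl, by simp⟩
  obtain ⟨hv, l₁, l₂, rfl, hl₂, hS'⟩ := hs'
  obtain rfl : l₂ = [] := by simpa using hl₂.symm
  have hS'' : s'.2 = update (update S j₁ (((l₁ ++ []).filterMap g₁).reverse ++ S j₁)) j₂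
        (((l₁ ++ []).filterMap g₂).reverse ++ S j₂) := by
    rw [hS']
    conv_rhs => rw [← update_eq_self i (update (update S j₁ _) j₂ _)]
    simp [update_of_ne h₁.symm, update_of_ne h₂.symm, hS]
  simp only [Option.map_none] at h
  rw [hv, hS''] at h
  simpa [forEachLetter, move] using h

/-- Move the letters of the stack `i` to the stack `j`; the stack `j'` is not changed. -/
theorem Prog.runs_move_single [DecidableEq K] {i j j' : K} (e : Γ i ≃ X)
    (ρ : LetterRegister σ X) (g : X → Γ j) (h : j ≠ i) (h' : j' ≠ i)
    (h'' : j ≠ j') (S : ∀ k, List (Γ k)) (hS : S i = []) (l : List X) (v : σ) {r : List (Γ j)}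
    (hr : r = (l.map g).reverse ++ S j) :
    (Prog.move i j j' e ρ (fun a => some (g a)) fun _ => none).Runs (v, update S i (l.map e.symm))
      (ρ.set none v, update S j r) (l.length * 4 + 2) := by
  subst hr
  have := Prog.runs_move e ρ (fun a => some (g a)) (fun _ => (none : Option (Γ j'))) h h' h'' S hS
    l v rfl rfl
  have h₀ : l.filterMap (fun _ => (none : Option (Γ j'))) = [] := by
    induction l <;> simp_all
  have h₁ : update (update S j ((l.map g).reverse ++ S j)) j' (S j') =
      update S j ((l.map g).reverse ++ S j) := by
    conv_rhs => rw [← update_eq_self j' (update S j _)]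
    rw [update_of_ne h''.symm]
  simpa [h₀, h₁, List.filterMap_eq_map'] using this

/-- Move the letters of the stack `i` to the empty stack `j`. -/
theorem Prog.runs_move_empty [DecidableEq K] {i j j' : K} (e : Γ i ≃ X)
    (ρ : LetterRegister σ X) (g : X → Γ j) (h : j ≠ i) (h' : j' ≠ i)
    (h'' : j ≠ j') (S : ∀ k, List (Γ k)) (hS : S i = []) (hS' : S j = []) (l : List X) (v : σ) :
    (Prog.move i j j' e ρ (fun a => some (g a)) fun _ => none).Runs (v, update S i (l.map e.symm))
      (ρ.set none v, update S j (l.reverse.map g)) (l.length * 4 + 2) := by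
  have := Prog.runs_move_single e ρ g h h' h'' S hS l v rfl
  rwa [hS', List.append_nil, ← List.map_reverse] at this

/-- Move the letters of the stack `i`, in reverse order, to the empty stack `j`. -/
theorem Prog.runs_move_reverse [DecidableEq K] {i j j' : K} (e : Γ i ≃ X)
    (ρ : LetterRegister σ X) (g : X → Γ j) (h : j ≠ i) (h' : j' ≠ i)
    (h'' : j ≠ j') (S : ∀ k, List (Γ k)) (hS : S i = []) (hS' : S j = []) (l : List X) (v : σ) :
    (Prog.move i j j' e ρ (fun a => some (g a)) fun _ => none).Runs
      (v, update S i (l.reverse.map e.symm))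
      (ρ.set none v, update S j (l.map g)) (l.length * 4 + 2) := by
  have := Prog.runs_move_empty e ρ g h h' h'' S hS hS' l.reverse v
  rwa [List.reverse_reverse, List.length_reverse] at this

end Move

/-- A halting machine has returned to its initial register and emptied its other stacks. The
surrounding register `w` is thus unchanged, and the machine can be called again, as iteration
requires. -/
theorem Prog.runs_call_computable {K' : Type} [DecidableEq K'] {Γ' : K' → Type} {σ' : Type}
    {f : α → β} (h : TM2ComputableInPolyTime ea eb f)
    (E : StoreEmbedding h.tm.Γ h.tm.σ Γ' σ') (T : ∀ k, List (Γ' k)) (hT : ∀ k, T (E.idx k) = [])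
    (a : α) (w : σ') (hw : E.get w = h.tm.initialState) :
    letI := h.tm.ΛFin
    (Prog.call h.tm.m h.tm.main E).Runs
      (w, update T (E.idx h.tm.k₀)
        ((ea a).map (h.inputAlphabet.symm.trans (E.letter h.tm.k₀))))
      (w, update T (E.idx h.tm.k₁)
        ((eb (f a)).map (h.outputAlphabet.symm.trans (E.letter h.tm.k₁))))
      (h.time.eval (ea a).length) := by
  let _ := h.tm.ΛFin
  have hM : ∀ (T' : ∀ k, List (Γ' k)) k l, (∀ j, j ∉ Set.range E.idx → T j = T' j) →
      E.Matches T' (single k l) (update T (E.idx k) (l.map (E.letter k))) := by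
    intro T' k l hT'
    have h₀ : E.Matches T' (fun _ => []) T := ⟨fun k => by simp [hT], hT'⟩
    exact h₀.update k _ _ rfl
  have := Prog.runs_call (stepsTo_of_computable h a) (w := w) (E := E) hw
    (hM _ h.tm.k₀ _ fun j hj => by rw [update_of_ne]; rintro rfl; exact hj ⟨_, rfl⟩)
    (hM _ h.tm.k₁ _ fun j hj => by rw [update_of_ne]; rintro rfl; exact hj ⟨_, rfl⟩)
  rw [← hw, E.set_get] at this
  simpa using this

end PolyTime

end SmallCircuits

/-! ### Closure of polynomial time under composition, action on one component of a pair, and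
iteration. -/

namespace SmallCircuits

open Turing Function

section Closure

variable {α β γ A B C : Type} {ea : α → List A} {eb : β → List B} {ec : γ → List C}

/-! ### Composition -/

/-- The composition of polynomial-time functions is a polynomial-time function. -/
theorem PolyTime.comp [Fintype A] [Fintype B] {g : β → γ} {f : α → β} (hg : PolyTime eb ec g)
    (hf : PolyTime ea eb f) : PolyTime ea ec (fun a => g (f a)) := by
  obtain ⟨p, hp⟩ := hf.length_le
  obtain ⟨hf⟩ := hf
  obtain ⟨hg⟩ := hg
  let _ := hf.tm.kFin
  let _ := hg.tm.kFin
  let _ := hf.tm.σFin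
  let _ := hg.tm.σFin
  let K := hf.tm.K ⊕ (hg.tm.K ⊕ Unit)
  let Γ : K → Type := Sum.elim hf.tm.Γ (Sum.elim hg.tm.Γ fun _ => B)
  let σ := (hf.tm.σ × hg.tm.σ) × Option B
  let E₁ : StoreEmbedding hf.tm.Γ hf.tm.σ Γ σ :=
    { idx := .inl, idx_injective := Sum.inl_injective, letter := fun k => Equiv.refl _,
      get := fun v => v.1.1, set := fun v w => ((v, w.1.2), w.2), get_set := fun _ _ => rfl,
      set_get := fun _ => rfl, set_set := fun _ _ _ => rfl }
  let E₂ : StoreEmbedding hg.tm.Γ hg.tm.σ Γ σ :=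
    { idx := fun k => .inr (.inl k),
      idx_injective := Sum.inr_injective.comp Sum.inl_injective, letter := fun k => Equiv.refl _,
      get := fun v => v.1.2, set := fun v w => ((w.1.1, v), w.2), get_set := fun _ _ => rfl,
      set_get := fun _ => rfl, set_set := fun _ _ _ => rfl }
  let ρ : LetterRegister σ B :=
    { get := fun v => v.2, set := fun a v => (v.1, a), get_set := fun _ _ => rfl,
      set_set := fun _ _ _ => rfl }
  let v₀ : σ := ((hf.tm.initialState, hg.tm.initialState), none)
  let tmp : K := .inr (.inr ())
  let _ := hf.tm.ΛFin
  let _ := hg.tm.ΛFin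
  have h₁ := fun a => Prog.runs_call_computable hf E₁ (fun _ => []) (fun _ => rfl) a v₀ rfl
  -- A single move would reverse the word, so the intermediate result passes through the stack
  -- `tmp`.
  have h₂ := fun l => Prog.runs_move_empty (Γ := Γ) (i := .inl hf.tm.k₁) (j := tmp)
    (j' := .inr (.inl hg.tm.k₀)) hf.outputAlphabet ρ (fun b => b) Sum.inr_ne_inl Sum.inr_ne_inl
    (Sum.inr_injective.ne Sum.inr_ne_inl) (fun _ => []) rfl rfl l v₀
  have h₃ := fun l => Prog.runs_move_reverse (Γ := Γ) (i := tmp) (j := .inr (.inl hg.tm.k₀))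
    (j' := .inl hf.tm.k₁) (Equiv.refl B) ρ hg.inputAlphabet.symm
    (Sum.inr_injective.ne Sum.inl_ne_inr) Sum.inl_ne_inr Sum.inr_ne_inl (fun _ => []) rfl rfl
    l v₀
  have h₄ := fun b => Prog.runs_call_computable hg E₂ (fun _ => []) (fun _ => rfl) b v₀ rfl
  have h := fun a => (((h₁ a).seq (h₂ (eb (f a)))).seq (h₃ (eb (f a)))).seq (h₄ (f a))
  refine PolyTime.of_prog (Γ := Γ) (σ := σ) _ (.inl hf.tm.k₀) (.inr (.inl hg.tm.k₁)) v₀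
    hf.inputAlphabet.symm hg.outputAlphabet.symm
    (t := fun n => hf.time.eval n + (p.eval n * 4 + 2) + (p.eval n * 4 + 2) +
      hg.time.eval (p.eval n)) ?_ fun a => (h a).mono ?_
  · have h₀ := PolyBounded.of_eval p
    have h₁ := ((h₀.mul (.const 4)).add (.const 2))
    exact (((PolyBounded.of_eval _).add h₁).add h₁).add (.eval_comp _ h₀)
  · have := hp a
    have := PolyBounded.eval_mono hg.time this
    simp only at this ⊢
    omega

/-! ### Pairs -/

/-- The encoding of pairs: letters of the two components are marked. -/
def pairEnc (ea : α → List A) (eb : β → List B) (x : α × β) : List (A ⊕ B) :=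
  (ea x.1).map .inl ++ (eb x.2).map .inr

/-- A polynomial-time function can be applied to the first component of a pair. -/
theorem PolyTime.first [Fintype A] [Fintype B] [Fintype C] {f : α → β} (hf : PolyTime ea eb f) :
    PolyTime (pairEnc ea ec) (pairEnc eb ec) (fun x : α × γ => (f x.1, x.2)) := by
  obtain ⟨p, hp⟩ := hf.length_le
  obtain ⟨hf⟩ := hf
  let _ := hf.tm.kFin
  let _ := hf.tm.σFin
  let _ := hf.tm.ΛFin
  let Γ : hf.tm.K ⊕ Fin 5 → Type := Sum.elim hf.tm.Γ ![A ⊕ C, A, C, B, B ⊕ C]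
  let σ := hf.tm.σ × Option (A ⊕ C) × Option A × Option B × Option C
  let E : StoreEmbedding hf.tm.Γ hf.tm.σ Γ σ :=
    { idx := .inl, idx_injective := Sum.inl_injective, letter := fun k => Equiv.refl _,
      get := fun v => v.1, set := fun v w => (v, w.2), get_set := fun _ _ => rfl,
      set_get := fun _ => rfl, set_set := fun _ _ _ => rfl }
  let ρAC : LetterRegister σ (A ⊕ C) :=
    { get := fun v => v.2.1, set := fun a v => (v.1, a, v.2.2), get_set := fun _ _ => rfl,
      set_set := fun _ _ _ => rfl }
  let ρA : LetterRegister σ A :=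
    { get := fun v => v.2.2.1, set := fun a v => (v.1, v.2.1, a, v.2.2.2),
      get_set := fun _ _ => rfl, set_set := fun _ _ _ => rfl }
  let ρB : LetterRegister σ B :=
    { get := fun v => v.2.2.2.1, set := fun a v => (v.1, v.2.1, v.2.2.1, a, v.2.2.2.2),
      get_set := fun _ _ => rfl, set_set := fun _ _ _ => rfl }
  let ρC : LetterRegister σ C :=
    { get := fun v => v.2.2.2.2, set := fun a v => (v.1, v.2.1, v.2.2.1, v.2.2.2.1, a),
      get_set := fun _ _ => rfl, set_set := fun _ _ _ => rfl }
  let v₀ : σ := (hf.tm.initialState, none, none, none, none)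
  let Z : ∀ k, List (Γ k) := fun _ => []
  have hl : ∀ (l : List A) (l' : List C),
      (l.map Sum.inl ++ l'.map Sum.inr).filterMap Sum.getLeft? = l := fun l l' => by
    induction l with
    | nil => induction l' <;> simp_all
    | cons a l ih => simpa using ih
  have hr : ∀ (l : List A) (l' : List C),
      (l.map Sum.inl ++ l'.map Sum.inr).filterMap Sum.getRight? = l' := fun l l' => by
    induction l with
    | nil => induction l' <;> simp_all
    | cons a l ih => exact ih
  have hA : ∀ x : α × γ, (ea x.1).reverse.map (Equiv.refl A).symm =
      ((pairEnc ea ec x).filterMap Sum.getLeft?).reverse ++ [] := fun x => by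
    simp [pairEnc, hl]
  have hC : ∀ x : α × γ, (ec x.2).reverse.map (Equiv.refl C).symm =
      ((pairEnc ea ec x).filterMap Sum.getRight?).reverse ++ [] := fun x => by
    simp [pairEnc, hr]
  have hB : ∀ x : α × γ, (pairEnc eb ec (f x.1, x.2)).map (Equiv.refl (B ⊕ C)) =
      ((eb (f x.1)).reverse.map Sum.inl).reverse ++ (ec x.2).map Sum.inr := fun x => by
    simp [pairEnc]
  have h₁ := fun x : α × γ => Prog.runs_move (Γ := Γ) (i := .inr 0) (j₁ := .inr 1) (j₂ := .inr 2)
    (Equiv.refl (A ⊕ C)) ρAC Sum.getLeft? Sum.getRight? (by simp) (by simp) (by simp) Z rfl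
    (pairEnc ea ec x) v₀
    (hA x) (hC x)
  have h₂ := fun x : α × γ => Prog.runs_move_reverse (Γ := Γ) (i := .inr 1) (j := .inl hf.tm.k₀)
    (j' := .inr 0) (Equiv.refl A) ρA hf.inputAlphabet.symm (by simp) (by simp) (by simp)
    (update Z (.inr 2) ((ec x.2).reverse.map (Equiv.refl C).symm)) (by simp [Z]) (by simp [Z])
    (ea x.1) v₀
  have h₃ := fun x : α × γ => Prog.runs_call_computable hf E
    (update Z (.inr 2) ((ec x.2).reverse.map (Equiv.refl C).symm)) (by simp [Z, E]) x.1 v₀ rfl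
  -- The second component goes to the output stack first, since the new first component must lie on
  -- top of it.
  have h₄ := fun x : α × γ => Prog.runs_move_reverse (Γ := Γ) (i := .inr 2) (j := .inr 4)
    (j' := .inr 0) (Equiv.refl C) ρC .inr (by simp) (by simp) (by simp)
    (update Z (.inl hf.tm.k₁) ((eb (f x.1)).map hf.outputAlphabet.symm)) (by simp [Z])
    (by simp [Z]) (ec x.2) v₀
  have h₅ := fun x : α × γ => Prog.runs_move_empty (Γ := Γ) (i := .inl hf.tm.k₁) (j := .inr 3)
    (j' := .inr 0) hf.outputAlphabet ρB (Equiv.refl B).symm (by simp) (by simp) (by simp)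
    (update Z (.inr 4) ((ec x.2).map .inr)) (by simp [Z]) (by simp [Z]) (eb (f x.1)) v₀
  have h₆ := fun x : α × γ => Prog.runs_move_single (Γ := Γ) (i := .inr 3) (j := .inr 4)
    (j' := .inr 0) (Equiv.refl B) ρB .inl (by simp) (by simp) (by simp)
    (update Z (.inr 4) ((ec x.2).map .inr)) (by simp [Z]) (eb (f x.1)).reverse v₀
    (hB x)
  have c₁ : (.inr 1 : hf.tm.K ⊕ Fin 5) ≠ .inr 2 := by simp
  have c₂ : (.inr 2 : hf.tm.K ⊕ Fin 5) ≠ .inl hf.tm.k₁ := by simp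
  have c₃ : (.inl hf.tm.k₁ : hf.tm.K ⊕ Fin 5) ≠ .inr 4 := by simp
  have h := fun x => (((((h₁ x).seq (update_comm c₁ _ _ Z ▸ h₂ x)).seq (h₃ x)).seq
    (update_comm c₂ _ _ Z ▸ h₄ x)).seq (update_comm c₃ _ _ Z ▸ h₅ x)).seq (update_idem _ _ Z ▸ h₆ x)
  refine PolyTime.of_prog (A := A ⊕ C) (B := B ⊕ C) (Γ := Γ) (σ := σ) _ (.inr 0) (.inr 4) v₀
    (Equiv.refl _) (Equiv.refl _)
    (t := fun n => (n * 4 + 2) + (n * 4 + 2) + hf.time.eval n + (n * 4 + 2) +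
      (p.eval n * 4 + 2) + (p.eval n * 4 + 2)) ?_ fun x => (h x).mono ?_
  · have h₀ := (PolyBounded.id.mul (.const 4)).add (.const 2)
    have h₁ := ((PolyBounded.of_eval p).mul (.const 4)).add (.const 2)
    exact ((((h₀.add h₀).add (.of_eval _)).add h₀).add h₁).add h₁
  · have hx : (pairEnc ea ec x).length = (ea x.1).length + (ec x.2).length := by
      simp [pairEnc]
    have hx' : (ea x.1).length ≤ (pairEnc ea ec x).length := by omega
    have hb := (hp x.1).trans (PolyBounded.eval_mono p hx')
    have ht := PolyBounded.eval_mono hf.time hx'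
    simp only at hb ht
    rw [List.length_reverse]
    omega

/-! ### Iteration -/

/-- The unary encoding of numbers. -/
def unaryEnc (n : ℕ) : List Unit := List.replicate n ()

theorem update_update_update {K : Type} [DecidableEq K] {Γ : K → Type} {i j : K} (h : j ≠ i)
    (a c : Γ i) (b : Γ j) (g : ∀ k, Γ k) :
    update (update (update g i a) j b) i c = update (update g i c) j b := by
  rw [update_comm h, update_idem]

/-- A polynomial-time function can be iterated as long as the results have polynomially bounded
length. -/
theorem PolyTime.iterate [Fintype A] {f : α → α} (hf : PolyTime ea ea f) (g : γ → ℕ × α)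
    (p : Polynomial ℕ) (hp : ∀ c, ∀ i ≤ (g c).1,
      (ea (f^[i] (g c).2)).length ≤ p.eval (pairEnc unaryEnc ea (g c)).length) :
    PolyTime (fun c => pairEnc unaryEnc ea (g c)) ea (fun c => f^[(g c).1] (g c).2) := by
  obtain ⟨hf⟩ := hf
  let _ := hf.tm.kFin
  let _ := hf.tm.σFin
  let _ := hf.tm.ΛFin
  let Γ : hf.tm.K ⊕ Fin 4 → Type := Sum.elim hf.tm.Γ ![Unit ⊕ A, Unit, A, A]
  let σ := hf.tm.σ × Option (Unit ⊕ A) × Option Unit × Option A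
  let E : StoreEmbedding hf.tm.Γ hf.tm.σ Γ σ :=
    { idx := .inl, idx_injective := Sum.inl_injective, letter := fun k => Equiv.refl _,
      get := fun v => v.1, set := fun v w => (v, w.2), get_set := fun _ _ => rfl,
      set_get := fun _ => rfl, set_set := fun _ _ _ => rfl }
  let ρUA : LetterRegister σ (Unit ⊕ A) :=
    { get := fun v => v.2.1, set := fun a v => (v.1, a, v.2.2), get_set := fun _ _ => rfl,
      set_set := fun _ _ _ => rfl }
  let ρU : LetterRegister σ Unit :=
    { get := fun v => v.2.2.1, set := fun a v => (v.1, v.2.1, a, v.2.2.2),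
      get_set := fun _ _ => rfl, set_set := fun _ _ _ => rfl }
  let ρA : LetterRegister σ A :=
    { get := fun v => v.2.2.2, set := fun a v => (v.1, v.2.1, v.2.2.1, a),
      get_set := fun _ _ => rfl, set_set := fun _ _ _ => rfl }
  let w (o : Option Unit) : σ := (hf.tm.initialState, none, o, none)
  let Z : ∀ k, List (Γ k) := fun _ => []
  have hl : ∀ (l : List Unit) (l' : List A),
      (l.map Sum.inl ++ l'.map Sum.inr).filterMap Sum.getLeft? = l := fun l l' => by
    induction l with
    | nil => induction l' <;> simp_all
    | cons a l ih => exact congrArg _ ih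
  have hr : ∀ (l : List Unit) (l' : List A),
      (l.map Sum.inl ++ l'.map Sum.inr).filterMap Sum.getRight? = l' := fun l l' => by
    induction l with
    | nil => induction l' <;> simp_all
    | cons a l ih => exact ih
  have hU : ∀ x : ℕ × α, unaryEnc x.1 =
      ((pairEnc unaryEnc ea x).filterMap Sum.getLeft?).reverse ++ [] := fun x => by
    rw [pairEnc, hl, List.append_nil, unaryEnc, List.reverse_replicate]
  have hA : ∀ x : ℕ × α, (ea x.2).reverse.map (Equiv.refl A).symm =
      ((pairEnc unaryEnc ea x).filterMap Sum.getRight?).reverse ++ [] := fun x => by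
    rw [pairEnc, hr, List.append_nil, Equiv.refl_symm, Equiv.coe_refl, List.map_id]
  have h₁ := fun x : ℕ × α => Prog.runs_move (Γ := Γ) (i := .inr 0) (j₁ := .inr 1)
    (j₂ := .inr 2) (Equiv.refl (Unit ⊕ A)) ρUA Sum.getLeft? Sum.getRight? (by simp) (by simp)
    (by simp) Z rfl (pairEnc unaryEnc ea x) (w none) (hU x) (hA x)
  have hback := fun (U : List Unit) (a : α) o => Prog.runs_move_reverse (Γ := Γ) (i := .inr 2)
    (j := .inl hf.tm.k₀) (j' := .inr 0) (Equiv.refl A) ρA hf.inputAlphabet.symm (by simp)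
    (by simp) (by simp) (update Z (.inr 1) U) rfl rfl (ea a) (w o)
  have hcall := fun (U : List Unit) (a : α) o => Prog.runs_call_computable hf E
    (update Z (.inr 1) U) (fun _ => rfl) a (w o) rfl
  have hout := fun (U : List Unit) (a : α) o => Prog.runs_move_empty (Γ := Γ)
    (i := .inl hf.tm.k₁) (j := .inr 2) (j' := .inr 0) hf.outputAlphabet ρA (Equiv.refl A).symm
    (by simp) (by simp) (by simp) (update Z (.inr 1) U) rfl rfl
    (ea a) (w o)
  -- One round: call the machine, then bring its result back to its input stack in the right order.
  -- The counter stack `U` is not touched.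
  have hbody := fun (U : List Unit) (a : α) o =>
    ((hcall U a o).seq (hout U (f a) o)).seq (hback U (f a) o)
  have hfin₁ := fun a : α => Prog.runs_move_empty (Γ := Γ)
    (i := .inl hf.tm.k₀) (j := .inr 2) (j' := .inr 0) hf.inputAlphabet ρA (Equiv.refl A).symm
    (by simp) (by simp) (by simp) Z rfl rfl (ea a) (w none)
  have hfin₂ := fun a : α => Prog.runs_move_reverse (Γ := Γ)
    (i := .inr 2) (j := .inr 3) (j' := .inr 0) (Equiv.refl A) ρA (Equiv.refl A)
    (by simp) (by simp) (by simp) Z rfl rfl (ea a) (w none)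
  have c₂ : (.inl hf.tm.k₀ : hf.tm.K ⊕ Fin 4) ≠ .inr 1 := by simp
  have hloop : ∀ (x : ℕ × α) (T : ℕ),
      (∀ i < x.1, hf.time.eval (ea (f^[i] x.2)).length +
        ((ea (f^[i + 1] x.2)).length * 4 + 2) + ((ea (f^[i + 1] x.2)).length * 4 + 2) ≤ T) →
      (Prog.forEachLetter (Γ := Γ) (.inr 1) (Equiv.refl Unit) ρU
        (((Prog.call hf.tm.m hf.tm.main E).seq (Prog.move (.inl hf.tm.k₁) (.inr 2) (.inr 0)
          hf.outputAlphabet ρA (fun a => some ((Equiv.refl A).symm a)) fun _ => none)).seq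
          (Prog.move (.inr 2) (.inl hf.tm.k₀) (.inr 0) (Equiv.refl A) ρA
            (fun a => some (hf.inputAlphabet.symm a)) fun _ => none))).Runs
        (w none, update (update Z (.inr 1) (unaryEnc x.1)) (.inl hf.tm.k₀)
          ((ea x.2).map hf.inputAlphabet.symm))
        (w none, update Z (.inl hf.tm.k₀) ((ea (f^[x.1] x.2)).map hf.inputAlphabet.symm))
        (x.1 * (T + 2) + 2) := by
    intro x T hT
    -- The invariant: the rounds done and the letters left on the counter stack add up to `x.1`.
    obtain ⟨s', ⟨o, hv, i, hi, hS⟩, h⟩ := Prog.runs_forEach (Γ := Γ) (i := .inr 1)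
      (reg := fun v => (ρU.get v).map (Equiv.refl Unit).symm)
      (setReg := fun a v => ρU.set (a.map (Equiv.refl Unit)) v)
      (P := ((Prog.call hf.tm.m hf.tm.main E).seq (Prog.move (.inl hf.tm.k₁) (.inr 2) (.inr 0)
          hf.outputAlphabet ρA (fun a => some ((Equiv.refl A).symm a)) fun _ => none)).seq
          (Prog.move (.inr 2) (.inl hf.tm.k₀) (.inr 0) (Equiv.refl A) ρA
            (fun a => some (hf.inputAlphabet.symm a)) fun _ => none))
      (by rintro (_ | a) v <;> rfl)
      (fun (l : List Unit) s => ∃ o, s.1 = w o ∧ ∃ i, i + l.length = x.1 ∧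
        s.2 = update (update Z (.inr 1) l) (.inl hf.tm.k₀)
          ((ea (f^[i] x.2)).map hf.inputAlphabet.symm)) T
      (by
        rintro l ⟨v, S⟩ ⟨o, rfl, i, hi, rfl⟩
        rfl)
      (by
        rintro a l ⟨v, S⟩ ⟨o, rfl, i, hi, rfl⟩
        replace hi : i + (@List.length Unit l + 1) = x.1 := hi
        have e := iterate_succ_apply' f i x.2
        have hr := (hbody l (f^[i] x.2) (some ())).mono (t' := T) (e ▸ hT i (by omega))
        rw [← e] at hr
        refine ⟨(w (some ()), _), (update_update_update c₂ _ _ _ Z).symm ▸ hr, some (), rfl,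
          i + 1, ?_, rfl⟩
        show i + 1 + @List.length Unit l = x.1
        omega)
      (unaryEnc x.1) (w none, update (update Z (.inr 1) (unaryEnc x.1)) (.inl hf.tm.k₀)
          ((ea x.2).map hf.inputAlphabet.symm))
      ⟨none, rfl, 0, by simp [unaryEnc], rfl⟩
    obtain ⟨v, S⟩ := s'
    obtain rfl : v = w o := hv
    obtain rfl : i = x.1 := hi
    have e : update (update Z (.inr 1) []) (.inl hf.tm.k₀)
        ((ea (f^[x.1] x.2)).map hf.inputAlphabet.symm) =
        update Z (.inl hf.tm.k₀) ((ea (f^[x.1] x.2)).map hf.inputAlphabet.symm) := by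
      rw [show update Z (.inr 1) [] = Z from update_eq_self _ Z]
    have hS' : S = _ := hS.trans e
    subst hS'
    have hlen : (unaryEnc x.1).length = x.1 := by simp [unaryEnc]
    exact h.mono (le_of_eq (congrArg (fun n => n * (T + 2) + 2) hlen))
  have h := fun (x : ℕ × α) T hT => ((((h₁ x).seq (
    hback (unaryEnc x.1) x.2 none)).seq (hloop x T hT)).seq (hfin₁ (f^[x.1] x.2))).seq
      (hfin₂ (f^[x.1] x.2))
  -- The hypothesis on the sizes of all iterates makes one bound `T`, polynomial in the original
  -- input length, valid for every round.
  let T (n : ℕ) : ℕ := hf.time.eval (p.eval n) + (p.eval n * 4 + 2) + (p.eval n * 4 + 2)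
  have hT : ∀ c, ∀ i < (g c).1, hf.time.eval (ea (f^[i] (g c).2)).length +
      ((ea (f^[i + 1] (g c).2)).length * 4 + 2) + ((ea (f^[i + 1] (g c).2)).length * 4 + 2) ≤
        T (pairEnc unaryEnc ea (g c)).length := fun x i hi => by
    have h₁ := PolyBounded.eval_mono hf.time (hp x i hi.le)
    have h₂ := hp x (i + 1) hi
    simp only [T] at h₁ ⊢
    omega
  refine PolyTime.of_prog (A := Unit ⊕ A) (B := A) (Γ := Γ) (σ := σ) _ (.inr 0) (.inr 3) (w none)
    (Equiv.refl _) (Equiv.refl _)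
    (t := fun n => (n * 4 + 2) + (n * 4 + 2) + (n * (T n + 2) + 2) + (p.eval n * 4 + 2) +
      (p.eval n * 4 + 2)) ?_ fun c => (h (g c) _ (hT c)).mono ?_
  · have h₁ := ((PolyBounded.of_eval p).mul (.const 4)).add (.const 2)
    have hT : PolyBounded T := ((PolyBounded.eval_comp _ (.of_eval _)).add h₁).add h₁
    have h₀ := (PolyBounded.id.mul (.const 4)).add (.const 2)
    exact (((h₀.add h₀).add ((PolyBounded.id.mul (hT.add (.const 2))).add (.const 2))).add
      h₁).add h₁
  · have hx : (pairEnc unaryEnc ea (g c)).length = (g c).1 + (ea (g c).2).length := by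
      simp [pairEnc, unaryEnc]
    have hb := hp c (g c).1 le_rfl
    have := Nat.mul_le_mul_right (T (pairEnc unaryEnc ea (g c)).length + 2)
      (show (g c).1 ≤ (pairEnc unaryEnc ea (g c)).length by omega)
    omega

end Closure

end SmallCircuits

/-! ### Finite transducers run in polynomial time. -/

namespace SmallCircuits

open Turing Function

/-! ### Transducers -/

section Transducer

variable {α β A B Q : Type}

/-- The output of a finite transducer: `δ` is the transition function, `o` the output in a
transition and `e` the output at the end. -/
def transduce (δ : Q → A → Q) (o : Q → A → List B) (e : Q → List B) : Q → List A → List B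
  | q, [] => e q
  | q, a :: l => o q a ++ transduce δ o e (δ q a) l

theorem length_transduce_le {δ : Q → A → Q} {o : Q → A → List B} {e : Q → List B} {c : ℕ}
    (ho : ∀ q a, (o q a).length ≤ c) (he : ∀ q, (e q).length ≤ c) (q : Q) (l : List A) :
    (transduce δ o e q l).length ≤ (l.length + 1) * c := by
  induction l generalizing q with
  | nil => simpa [transduce] using he q
  | cons a l ih =>
    have h₁ := ho q a
    have h₂ := ih (δ q a)
    simp only [transduce, List.length_append, List.length_cons]
    nlinarith

theorem Prog.Runs.congr {K : Type} [DecidableEq K] {Γ : K → Type} {σ : Type} {P : Prog Γ σ}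
    {s s₁ s' s₁' : Store Γ σ} {t : ℕ} (h : P.Runs s s' t) (hs : s = s₁) (hs' : s' = s₁') :
    P.Runs s₁ s₁' t := hs ▸ hs' ▸ h

/-- Push the letters of a list one after the other. -/
noncomputable def Prog.pushList {K : Type} {Γ : K → Type} {σ : Type} (k : K) :
    List (Γ k) → Prog Γ σ
  | [] => Prog.load id
  | a :: l => (Prog.push k fun _ => some a).seq (Prog.pushList k l)

theorem Prog.runs_pushList {K : Type} [DecidableEq K] {Γ : K → Type} {σ : Type} (k : K)
    (l : List (Γ k)) (s : Store Γ σ) :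
    (Prog.pushList k l).Runs s (s.1, update s.2 k (l.reverse ++ s.2 k)) (l.length + 1) := by
  induction l generalizing s with
  | nil => simpa [pushList] using Prog.runs_load id s
  | cons a l ih =>
    have := (Prog.runs_push k (fun _ => some a) s).seq (ih _)
    simp only [update_idem, update_self] at this
    refine Prog.Runs.mono (t := 1 + (l.length + 1)) ?_ (by simp; omega)
    simpa [pushList] using this

/-- A function whose value is the concatenation of the outputs of two finite transducers is
computable in polynomial time. -/
theorem PolyTime.of_transducer [Fintype A] [Fintype B] [Fintype Q] {ea : α → List A}
    {eb : β → List B} {f : α → β} (δ : Q → A → Q) (q₀ : Q) (o₁ o₂ : Q → A → List B)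
    (e₁ e₂ : Q → List B)
    (h : ∀ a, eb (f a) = transduce δ o₁ e₁ q₀ (ea a) ++ transduce δ o₂ e₂ q₀ (ea a)) :
    PolyTime ea eb f := by
  classical
  -- States and letters are finite in number, so the output per transition is bounded.
  obtain ⟨c, ho₁, ho₂, he₁, he₂⟩ : ∃ c, (∀ q a, (o₁ q a).length ≤ c) ∧
      (∀ q a, (o₂ q a).length ≤ c) ∧ (∀ q, (e₁ q).length ≤ c) ∧ ∀ q, (e₂ q).length ≤ c := by
    let F (x : Q × A) : ℕ := (o₁ x.1 x.2).length + (o₂ x.1 x.2).length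
    let G (q : Q) : ℕ := (e₁ q).length + (e₂ q).length
    have hF := fun q a => Finset.le_sup (f := F) (Finset.mem_univ (q, a))
    have hG := fun q => Finset.le_sup (f := G) (Finset.mem_univ q)
    refine ⟨Finset.univ.sup F + Finset.univ.sup G, fun q a => ?_, fun q a => ?_, fun q => ?_,
      fun q => ?_⟩
    · have := hF q a; simp only [F] at this ⊢; omega
    · have := hF q a; simp only [F] at this ⊢; omega
    · have := hG q; simp only [G] at this ⊢; omega
    · have := hG q; simp only [G] at this ⊢; omega
  -- Stack 0 holds the input, stacks 1 and 2 collect both outputs in a single pass, and stack 3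
  -- receives the result.
  let Γ : Fin 4 → Type := ![A, B, B, B]
  let σ := Q × Option A × Option B
  let ρA : LetterRegister σ A :=
    { get := fun v => v.2.1, set := fun a v => (v.1, a, v.2.2), get_set := fun _ _ => rfl,
      set_set := fun _ _ _ => rfl }
  let ρB : LetterRegister σ B :=
    { get := fun v => v.2.2, set := fun a v => (v.1, v.2.1, a), get_set := fun _ _ => rfl,
      set_set := fun _ _ _ => rfl }
  let st (r : List A) (x y z : List B) : ∀ k, List (Γ k) := fun k =>
    match k with
    | 0 => r
    | 1 => x
    | 2 => y
    | 3 => z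
  let emit (x y : List B) (q : Q) : Prog Γ σ :=
    ((Prog.pushList (Γ := Γ) 1 x).seq (Prog.pushList (Γ := Γ) 2 y)).seq
      (Prog.load fun v => (q, v.2))
  have hemit : ∀ (x y : List B) q (v : σ) r x' y', (emit x y q).Runs (v, st r x' y' [])
      ((q, v.2), st r (x.reverse ++ x') (y.reverse ++ y') []) (x.length + y.length + 3) := by
    intro x y q v r x' y'
    have h₁ := Prog.runs_pushList (Γ := Γ) 1 x (v, st r x' y' [])
    have h₂ := Prog.runs_pushList (Γ := Γ) 2 y (v, st r (x.reverse ++ x') y' [])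
    have h₃ := Prog.runs_load (Γ := Γ) (fun v => (q, v.2))
      (v, st r (x.reverse ++ x') (y.reverse ++ y') [])
    have e₁ : update (st r x' y' []) 1 (x.reverse ++ x') = st r (x.reverse ++ x') y' [] := by
      funext k; fin_cases k <;> rfl
    have e₂ : update (st r (x.reverse ++ x') y' []) 2 (y.reverse ++ y') =
        st r (x.reverse ++ x') (y.reverse ++ y') [] := by
      funext k; fin_cases k <;> rfl
    exact (((e₁ ▸ h₁).seq (e₂ ▸ h₂)).seq h₃).mono (by
      show x.length + 1 + (y.length + 1) + 1 ≤ _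
      omega)
  let body : Prog Γ σ := Prog.switch (fun v : σ => (v.1, v.2.1)) fun (x : Q × Option A) =>
    match x with
    | (_, none) => Prog.load id
    | (q, some a) => emit (o₁ q a) (o₂ q a) (δ q a)
  have hloop : ∀ l : List A, ∃ q oa x y,
      x.reverse ++ e₁ q = transduce δ o₁ e₁ q₀ l ∧ y.reverse ++ e₂ q = transduce δ o₂ e₂ q₀ l ∧
      (Prog.forEachLetter (Γ := Γ) 0 (Equiv.refl A) ρA body).Runs ((q₀, none, none), st l [] [] [])
        (ρA.set none (q, oa, none), st [] x y []) (l.length * (1 + (c + c + 3) + 2) + 2) := by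
    intro l
    obtain ⟨⟨v, S⟩, ⟨q, oa, x, y, hx, hy, hv, hS⟩, hr⟩ := Prog.runs_forEach (Γ := Γ) (i := 0)
      (reg := fun v => (ρA.get v).map (Equiv.refl A).symm)
      (setReg := fun a v => ρA.set (a.map (Equiv.refl A)) v) (P := body)
      (by rintro (_ | a) v <;> rfl)
      (fun (r : List A) s => ∃ q oa x y, x.reverse ++ transduce δ o₁ e₁ q r =
        transduce δ o₁ e₁ q₀ l ∧ y.reverse ++ transduce δ o₂ e₂ q r = transduce δ o₂ e₂ q₀ l ∧
        s.1 = (q, oa, none) ∧ s.2 = st r x y []) (1 + (c + c + 3))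
      (by
        rintro r ⟨v, S⟩ ⟨q, oa, x, y, hx, hy, rfl, rfl⟩
        rfl)
      (by
        rintro a r ⟨v, S⟩ ⟨q, oa, x, y, hx, hy, rfl, rfl⟩
        have e : update (st (a :: r) x y []) 0 r = st r x y [] := by
          funext k; fin_cases k <;> rfl
        have h₁ := (hemit (o₁ q a) (o₂ q a) (δ q a) (q, some a, none) r x y).mono
          (t' := c + c + 3) (by have := ho₁ q a; have := ho₂ q a; omega)
        refine ⟨((δ q a, some a, none), _), ?_, δ q a, some a, (o₁ q a).reverse ++ x,
          (o₂ q a).reverse ++ y, ?_, ?_, rfl, rfl⟩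
        · have : body.Runs ((q, some a, none), st r x y []) _ _ :=
            Prog.Runs.switch (P := fun (x : Q × Option A) =>
              match x with
              | (_, none) => Prog.load id
              | (q, some a) => emit (o₁ q a) (o₂ q a) (δ q a)) h₁
          rw [← e] at this
          exact this
        · rw [← hx]; simp [transduce]
        · rw [← hy]; simp [transduce])
      l ((q₀, none, none), st l [] [] [])
      ⟨q₀, none, [], [], rfl, rfl, rfl, rfl⟩
    obtain rfl : v = _ := hv
    obtain rfl : S = _ := hS
    exact ⟨q, oa, x, y, hx, hy, hr⟩
  -- Besides emitting the final outputs, this resets the state to `q₀`, as `PolyTime.of_prog`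
  -- requires.
  let fin : Prog Γ σ := Prog.switch (fun v : σ => v.1) fun q => emit (e₁ q) (e₂ q) q₀
  have hfin : ∀ q x y, fin.Runs ((q, none, none), st [] x y [])
      ((q₀, none, none), st [] ((x.reverse ++ e₁ q).reverse) ((y.reverse ++ e₂ q).reverse) [])
      (1 + (c + c + 3)) := by
    intro q x y
    have h₁ := (hemit (e₁ q) (e₂ q) q₀ (q, none, none) [] x y).mono
      (t' := c + c + 3) (by have := he₁ q; have := he₂ q; omega)
    have : fin.Runs ((q, none, none), st [] x y []) _ _ :=
      Prog.Runs.switch (P := fun q => emit (e₁ q) (e₂ q) q₀) h₁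
    simpa using this
  -- The second output is moved first because it has to lie below the first one.
  have hm₁ := fun x y : List B => Prog.runs_move_reverse (Γ := Γ) (i := 2) (j := 3) (j' := 0)
    (Equiv.refl B) ρB (Equiv.refl B) (by simp) (by simp) (by simp)
    (st [] x.reverse [] []) rfl rfl y (q₀, none, none)
  have hm₂ := fun x y : List B => Prog.runs_move_single (Γ := Γ) (i := 1) (j := 3) (j' := 0)
    (Equiv.refl B) ρB (fun b => b) (by simp) (by simp) (by simp)
    (st [] [] [] y) rfl x.reverse (q₀, none, none) (r := x ++ y) (by
      show x ++ y = (x.reverse.map (fun b => b)).reverse ++ y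
      simp)
  have hs : ∀ (x y z : List B), z = y → update (st [] x [] []) 2 z = st [] x y [] := by
    rintro x y _ rfl; funext k; fin_cases k <;> rfl
  have hs₁ : ∀ (x y z z' : List B), z = y → z' = x →
      update (st [] x [] []) 3 z = update (st [] [] [] y) 1 z' := by
    rintro x y _ _ rfl rfl; funext k; fin_cases k <;> rfl
  have hall : ∀ l : List A, ∃ t ≤ (l.length * (1 + (c + c + 3) + 2) + 2) + (1 + (c + c + 3)) +
      ((l.length + 1) * c * 4 + 2) + ((l.length + 1) * c * 4 + 2),
      ((((Prog.forEachLetter (Γ := Γ) 0 (Equiv.refl A) ρA body).seq fin).seq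
        (Prog.move 2 3 0 (Equiv.refl B) ρB (fun a => some ((Equiv.refl B) a)) fun _ => none)).seq
        (Prog.move 1 3 0 (Equiv.refl B) ρB (fun a => some a) fun _ => none)).Runs
          ((q₀, none, none), st l [] [] [])
          ((q₀, none, none), st [] [] [] (transduce δ o₁ e₁ q₀ l ++ transduce δ o₂ e₂ q₀ l)) t := by
    intro l
    obtain ⟨q, oa, x, y, hx, hy, hr⟩ := hloop l
    have h₁ := hfin q x y
    rw [hx, hy] at h₁
    have h₂ := (hm₁ (transduce δ o₁ e₁ q₀ l) (transduce δ o₂ e₂ q₀ l)).congr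
      (congrArg (Prod.mk (q₀, none, none)) (hs _ (transduce δ o₂ e₂ q₀ l).reverse _
        (List.map_id _)))
      (congrArg (Prod.mk (q₀, none, none)) (hs₁ _ (transduce δ o₂ e₂ q₀ l) _
        ((transduce δ o₁ e₁ q₀ l).reverse.map (Equiv.refl B).symm)
        (List.map_id _) (List.map_id _)))
    have h₃ := hm₂ (transduce δ o₁ e₁ q₀ l) (transduce δ o₂ e₂ q₀ l)
    have hs₂ : ∀ x y : List B, update (st [] [] [] x) 3 y = st [] [] [] y := by
      intro x y; funext k; fin_cases k <;> rfl
    refine ⟨_, ?_, ((hr.seq h₁).seq h₂).seq (h₃.congr rfl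
      (congrArg (Prod.mk (q₀, none, none)) (hs₂ _ _)))⟩
    have h₄ := length_transduce_le (δ := δ) ho₁ he₁ q₀ l
    have h₅ := length_transduce_le (δ := δ) ho₂ he₂ q₀ l
    simp only [List.length_reverse]
    omega
  refine PolyTime.of_prog (A := A) (B := B) (Γ := Γ) (σ := σ) (k₀ := 0) (k₁ := 3) (v₀ := (q₀, none, none))
    (e₀ := Equiv.refl _) (e₁ := Equiv.refl _) ?_ (fun a => ?_) (t := fun n =>
      (n * (1 + (c + c + 3) + 2) + 2) + (1 + (c + c + 3)) + ((n + 1) * c * 4 + 2) +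
        ((n + 1) * c * 4 + 2)) (P := ((((Prog.forEachLetter (Γ := Γ) 0 (Equiv.refl A) ρA body).seq
        fin).seq (Prog.move 2 3 0 (Equiv.refl B) ρB (fun a => some ((Equiv.refl B) a))
        fun _ => none)).seq
        (Prog.move 1 3 0 (Equiv.refl B) ρB (fun a => some a) fun _ => none)))
  · have h₁ : PolyBounded fun n => (n + 1) * c * 4 + 2 :=
      (((PolyBounded.id.add (.const 1)).mul (.const c)).mul (.const 4)).add (.const 2)
    exact ((((PolyBounded.id.mul (.const _)).add (.const 2)).add (.const _)).add h₁).add h₁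
  · obtain ⟨t, ht, hr⟩ := hall (ea a)
    rw [← h a] at hr
    have e : ∀ l l' : List A, l' = l → single (Γ := Γ) 0 l' = st l [] [] [] := by
      rintro l _ rfl; funext k; fin_cases k <;> rfl
    have e' : ∀ l l' : List B, l' = l → single (Γ := Γ) 3 l' = st [] [] [] l := by
      rintro l _ rfl; funext k; fin_cases k <;> rfl
    exact (hr.mono ht).congr
      (congrArg (Prod.mk (q₀, none, none)) (e (ea a) _ (List.map_id _)).symm)
      (congrArg (Prod.mk (q₀, none, none)) (e' (eb (f a)) _ (List.map_id _)).symm)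

end Transducer

end SmallCircuits

/-! ### A calculus of polynomial-time functions on unary numbers, bits, lists and pairs. -/

namespace SmallCircuits

open Function

/-! ### Polynomial-time functions between encoded types -/

/-- A type whose elements are encoded by words over a finite alphabet. -/
class WordEncodable (α : Type) where
  /-- the alphabet -/
  Letter : Type
  [fintypeLetter : Fintype Letter]
  /-- the word that encodes an element -/
  enc : α → List Letter

attribute [reducible, instance] WordEncodable.fintypeLetter

open WordEncodable

/-- Elements of ℕ are unary words in this calculus; binary numbers occur as lists of bits, by way of
`encodeNat`. -/
instance : WordEncodable ℕ := ⟨Unit, unaryEnc⟩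

instance : WordEncodable Bool := ⟨Bool, Computability.encodeBool⟩

instance {A : Type} [Fintype A] : WordEncodable (List A) := ⟨A, id⟩

instance {α β : Type} [WordEncodable α] [WordEncodable β] : WordEncodable (α × β) :=
  ⟨Letter α ⊕ Letter β, pairEnc enc enc⟩

section Basic

variable {α β γ δ : Type} [WordEncodable α] [WordEncodable β] [WordEncodable γ] [WordEncodable δ]

/-- The length of the encoding. -/
def size (a : α) : ℕ := (enc a).length

@[simp] theorem size_nat (n : ℕ) : size n = n := List.length_replicate

@[simp] theorem size_bool (b : Bool) : size b = 1 := rfl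

@[simp] theorem size_list {A : Type} [Fintype A] (l : List A) : size l = l.length := rfl

@[simp] theorem size_pair (x : α × β) : size x = size x.1 + size x.2 := by
  simp [size, enc, pairEnc]

/-- The function is computable in polynomial time, with numbers in unary. -/
@[fun_prop]
def PTime (f : α → β) : Prop := PolyTime (enc (α := α)) (enc (α := β)) f

namespace PTime

theorem of_transducer {Q : Type} [Fintype Q] {f : α → β} (δ : Q → Letter α → Q) (q₀ : Q)
    (o₁ o₂ : Q → Letter α → List (Letter β)) (e₁ e₂ : Q → List (Letter β))
    (h : ∀ a, enc (f a) = transduce δ o₁ e₁ q₀ (enc a) ++ transduce δ o₂ e₂ q₀ (enc a)) :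
    PTime f :=
  PolyTime.of_transducer δ q₀ o₁ o₂ e₁ e₂ h

theorem transduce_eq_flatMap {A B : Type} (o : A → List B) (e : List B) (l : List A) :
    transduce (fun _ _ => ()) (fun _ => o) (fun _ => e) () l = l.flatMap o ++ e := by
  induction l with
  | nil => simp [transduce]
  | cons a l ih => simp [transduce, ih]

/-- The case of one state: two letterwise substitutions of the same word, one after the other. Two
of them are needed to swap or duplicate components. -/
theorem of_flatMap₂ {f : α → β} (o₁ o₂ : Letter α → List (Letter β)) (e₁ e₂ : List (Letter β))
    (h : ∀ a, enc (f a) = ((enc a).flatMap o₁ ++ e₁) ++ ((enc a).flatMap o₂ ++ e₂)) : PTime f :=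
  of_transducer (fun _ _ => ()) () (fun _ => o₁) (fun _ => o₂) (fun _ => e₁) (fun _ => e₂)
    fun a => by rw [transduce_eq_flatMap, transduce_eq_flatMap, h]

theorem of_flatMap {f : α → β} (o : Letter α → List (Letter β)) (e : List (Letter β))
    (h : ∀ a, enc (f a) = (enc a).flatMap o ++ e) : PTime f :=
  of_flatMap₂ o (fun _ => []) e [] fun a => by simp [h]

@[fun_prop]
theorem id : PTime fun a : α => a :=
  of_flatMap (fun a => [a]) [] fun a => by simp [List.flatMap_singleton']

@[fun_prop]
theorem const (b : β) : PTime fun _ : α => b :=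
  of_flatMap (fun _ => []) (enc b) fun a => by simp

@[fun_prop]
theorem comp {g : β → γ} {f : α → β} (hg : PTime g) (hf : PTime f) : PTime fun a => g (f a) :=
  PolyTime.comp hg hf

theorem transduce_of_forall {A B Q : Type} {δ : Q → A → Q} (o : Q → A → List B) (e : Q → List B)
    {q : Q} {l : List A} (h : ∀ a ∈ l, δ q a = q) :
    transduce δ o e q l = l.flatMap (o q) ++ e q := by
  induction l with
  | nil => simp [transduce]
  | cons a l ih =>
    have h₁ := ih fun b hb => h b (List.mem_cons_of_mem _ hb)
    simp [transduce, h a, h₁]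

theorem flatMap_nil' {A B : Type} (l : List A) : l.flatMap (fun _ => ([] : List B)) = [] := by
  simp [List.flatMap_eq_nil_iff]

theorem flatMap_elim {A B C : Type} (f : A → List C) (g : B → List C) (l : List A) (l' : List B) :
    (l.map Sum.inl ++ l'.map Sum.inr).flatMap (Sum.elim f g) = l.flatMap f ++ l'.flatMap g := by
  simp [List.flatMap_map]

@[fun_prop]
theorem fst : PTime (Prod.fst : α × β → α) :=
  of_flatMap (Sum.elim (fun a => [a]) fun _ => []) [] fun x => by
    simp only [enc, pairEnc]; rw [flatMap_elim]; simp

@[fun_prop]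
theorem snd : PTime (Prod.snd : α × β → β) :=
  of_flatMap (Sum.elim (fun _ => []) fun a => [a]) [] fun x => by
    simp only [enc, pairEnc]; rw [flatMap_elim]; simp

theorem swap : PTime fun x : α × β => (x.2, x.1) :=
  of_flatMap₂ (Sum.elim (fun _ => []) fun a => [Sum.inl a])
    (Sum.elim (fun a => [Sum.inr a]) fun _ => []) [] [] fun x => by
      simp only [enc, pairEnc]
      rw [flatMap_elim, flatMap_elim]
      simp [flatMap_nil', ← List.map_eq_flatMap]

theorem diag : PTime fun a : α => (a, a) :=
  of_flatMap₂ (fun a => [Sum.inl a]) (fun a => [Sum.inr a]) [] [] fun a => by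
    simp only [enc, pairEnc, ← List.map_eq_flatMap, List.append_nil]

theorem first {f : α → β} (hf : PTime f) : PTime fun x : α × γ => (f x.1, x.2) :=
  PolyTime.first hf

-- Duplicate the argument and apply `f` and `g` in turn to the first component, with swaps in
-- between.
@[fun_prop]
theorem pair {f : α → β} {g : α → γ} (hf : PTime f) (hg : PTime g) :
    PTime fun a => (f a, g a) :=
  swap.comp ((first hg).comp (swap.comp ((first (γ := α) hf).comp diag)))

@[fun_prop]
theorem cond {c : α → Bool} {f g : α → β} (hc : PTime c) (hf : PTime f) (hg : PTime g) :
    PTime fun a => bif c a then f a else g a := by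
  have h : PTime fun x : Bool × β × β => bif x.1 then x.2.1 else x.2.2 := by
    -- The Boolean is encoded by one letter, which comes first. The state remembers it and thereby
    -- selects the component to be copied.
    refine of_transducer (Q := Option Bool)
      (fun q a => match a with | .inl b => some b | .inr _ => q) none
      (fun q a => match q, a with
        | some true, .inr (.inl b) => [b]
        | some false, .inr (.inr b) => [b]
        | _, _ => []) (fun _ _ => []) (fun _ => []) (fun _ => []) ?_
    rintro ⟨b, x, y⟩
    change enc (bif b then x else y) = transduce _ _ _ none
      (Sum.inl b :: (pairEnc enc enc (x, y)).map Sum.inr) ++ transduce _ _ _ none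
      (Sum.inl b :: (pairEnc enc enc (x, y)).map Sum.inr)
    simp only [transduce]
    rw [transduce_of_forall, transduce_of_forall]
    · cases b <;> simp [pairEnc, List.flatMap_map, flatMap_nil']
    · simp
    · simp
  exact h.comp (hc.pair (hf.pair hg))


@[fun_prop]
theorem not {f : α → Bool} (hf : PTime f) : PTime fun a => !f a := by
  have := cond hf (const false) (const true)
  refine (congrArg PTime (funext fun a => ?_)).mp this
  cases f a <;> rfl

@[fun_prop]
theorem and {f g : α → Bool} (hf : PTime f) (hg : PTime g) : PTime fun a => f a && g a := by
  have := cond hf hg (const false)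
  refine (congrArg PTime (funext fun a => ?_)).mp this
  cases f a <;> rfl

theorem of_eq {f g : α → β} (hf : PTime f) (h : ∀ a, f a = g a) : PTime g := funext h ▸ hf

theorem le_eval {f : α → ℕ} (hf : PTime f) : ∃ p : Polynomial ℕ, ∀ a, f a ≤ p.eval (size a) := by
  obtain ⟨p, hp⟩ := PolyTime.length_le hf
  exact ⟨p, fun a => (size_nat (f a)).symm.trans_le (hp a)⟩

/-- The parameter `a` is carried along as a component of the iterated state, which makes the step a
function of the state alone. -/
theorem iterate_of_size_le_eval {n : α → ℕ} {f : α → β} {step : α → β → β} (hn : PTime n)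
    (hf : PTime f) (hstep : PTime fun x : α × β => step x.1 x.2) (p : Polynomial ℕ)
    (hsize : ∀ a, ∀ i ≤ n a, size ((step a)^[i] (f a)) ≤ p.eval (size a)) :
    PTime fun a => (step a)^[n a] (f a) := by
  have hF : PTime fun x : α × β => (x.1, step x.1 x.2) := by fun_prop
  have hg : PTime fun a => (n a, a, f a) := by fun_prop
  have hit : ∀ a i, (fun x : α × β => (x.1, step x.1 x.2))^[i] (a, f a) =
      (a, (step a)^[i] (f a)) := fun a i => by
    induction i with
    | zero => rfl
    | succ i ih => rw [iterate_succ_apply', ih, iterate_succ_apply']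
  have h := PolyTime.iterate (γ := α) hF (fun a => (n a, a, f a)) (.X + p) (fun a i hi => by
    rw [hit, Polynomial.eval_add, Polynomial.eval_X]
    have h₁ : size (a, (step a)^[i] (f a)) = size a + size ((step a)^[i] (f a)) := size_pair _
    have h₂ := hsize a i hi
    have h₃ : size (n a, a, f a) = n a + (size a + size (f a)) := by simp
    have h₅ := PolyBounded.eval_mono p (show size a ≤ size (n a, a, f a) by omega)
    change size (a, (step a)^[i] (f a)) ≤ size (n a, a, f a) + p.eval (size (n a, a, f a))
    simp only at h₅
    omega)
  have h' : PTime fun a => (fun x : α × β => (x.1, step x.1 x.2))^[n a] (a, f a) :=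
    PolyTime.comp h (PolyTime.congr_output hg fun _ => rfl)
  exact (snd.comp h').of_eq fun a => by rw [hit]

/-- Bounded iteration. -/
theorem iterate {n : α → ℕ} {f : α → β} {step : α → β → β} (hn : PTime n) (hf : PTime f)
    (hstep : PTime fun x : α × β => step x.1 x.2) {b : α → ℕ} (hb : PTime b)
    (hsize : ∀ a, ∀ i ≤ n a, size ((step a)^[i] (f a)) ≤ b a) :
    PTime fun a => (step a)^[n a] (f a) := by
  obtain ⟨p, hp⟩ := hb.le_eval
  exact iterate_of_size_le_eval hn hf hstep p fun a i hi => (hsize a i hi).trans (hp a)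

/-! ### Arithmetic in unary -/

theorem unit_list_eq {l l' : List Unit} (h : l.length = l'.length) : l = l' :=
  List.ext_getElem h fun _ _ _ => rfl

theorem enc_nat_eq {n : ℕ} {l : List Unit} (h : l.length = n) : enc n = l :=
  unit_list_eq ((size_nat n).trans h.symm)

@[fun_prop]
theorem add {f g : α → ℕ} (hf : PTime f) (hg : PTime g) : PTime fun a => f a + g a := by
  have h : PTime fun x : ℕ × ℕ => x.1 + x.2 :=
    of_flatMap (fun _ => [()]) [] fun x => enc_nat_eq (by
      have : (enc x).length = x.1 + x.2 := (size_pair x).trans (by simp)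
      simp [this])
  exact h.comp (hf.pair hg)

theorem pred {f : α → ℕ} (hf : PTime f) : PTime fun a => f a - 1 := by
  have h : PTime fun n : ℕ => n - 1 := by
    refine of_transducer (Q := Bool) (fun _ _ => true) false (fun q a => bif q then [a] else [])
      (fun _ _ => []) (fun _ => []) (fun _ => []) fun n => enc_nat_eq ?_
    rcases n with _ | n
    · rfl
    · change (transduce _ _ _ false (() :: List.replicate n ()) ++
        transduce _ _ _ false (() :: List.replicate n ())).length = _
      simp only [transduce]
      rw [transduce_of_forall _ _ (by simp), transduce_of_forall _ _ (by simp)]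
      simp
  exact h.comp hf

theorem beq_zero {f : α → ℕ} (hf : PTime f) : PTime fun a => Nat.beq (f a) 0 := by
  have h : PTime fun n : ℕ => Nat.beq n 0 := by
    refine of_transducer (Q := Bool) (fun _ _ => true) false (fun q a => [])
      (fun _ _ => []) (fun q => [!q]) (fun _ => []) fun n => ?_
    rcases n with _ | n
    · rfl
    · change [false] = (transduce _ _ _ false (() :: List.replicate n ()) ++
        transduce _ _ _ false (() :: List.replicate n ()))
      simp only [transduce]
      rw [transduce_of_forall _ _ (by simp), transduce_of_forall _ _ (by simp)]
      exact (by simp [flatMap_nil'] : [false] =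
        (((List.replicate n ()).flatMap fun _ => ([] : List Bool)) ++ [false]) ++
          (((List.replicate n ()).flatMap fun _ => ([] : List Bool)) ++ []))
  exact h.comp hf

theorem iterate_pred (m n : ℕ) : (fun x => x - 1)^[n] m = m - n := by
  induction n with
  | zero => rfl
  | succ n ih => rw [iterate_succ_apply', ih]; omega

@[fun_prop]
theorem sub {f g : α → ℕ} (hf : PTime f) (hg : PTime g) : PTime fun a => f a - g a :=
  (iterate (step := fun _ n => n - 1) hg hf (pred snd) hf fun a i _ => by
    rw [iterate_pred, size_nat]; omega).of_eq fun a => iterate_pred _ _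

@[fun_prop]
theorem mul {f g : α → ℕ} (hf : PTime f) (hg : PTime g) : PTime fun a => f a * g a := by
  have h : ∀ a i, (fun m => m + f a)^[i] 0 = f a * i := fun a i => by
    induction i with
    | zero => rfl
    | succ i ih => rw [iterate_succ_apply', ih, Nat.mul_succ]
  obtain ⟨p, hp⟩ := hf.le_eval
  obtain ⟨q, hq⟩ := hg.le_eval
  exact (iterate_of_size_le_eval (step := fun a m => m + f a) hg (const 0)
    (snd.add (hf.comp fst)) (p * q) fun a i hi => by
      rw [h, size_nat, Polynomial.eval_mul]
      exact Nat.mul_le_mul (hp a) (hi.trans (hq a))).of_eq fun a => h a _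

@[fun_prop]
theorem pow {f : α → ℕ} (hf : PTime f) (c : ℕ) : PTime fun a => f a ^ c := by
  induction c with
  | zero => simpa using const 1
  | succ c ih => simpa only [pow_succ] using ih.mul hf

@[fun_prop]
theorem ble {f g : α → ℕ} (hf : PTime f) (hg : PTime g) : PTime fun a => Nat.ble (f a) (g a) :=
  (beq_zero (hf.sub hg)).of_eq fun a => by
    rw [Bool.eq_iff_iff, Nat.ble_eq, Nat.beq_eq, Nat.sub_eq_zero_iff_le]

@[fun_prop]
theorem beq {f g : α → ℕ} (hf : PTime f) (hg : PTime g) : PTime fun a => Nat.beq (f a) (g a) :=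
  ((hf.ble hg).and (hg.ble hf)).of_eq fun a => by
    rw [Bool.eq_iff_iff, Bool.and_eq_true, Nat.ble_eq, Nat.ble_eq, Nat.beq_eq]
    omega

@[fun_prop]
theorem min {f g : α → ℕ} (hf : PTime f) (hg : PTime g) : PTime fun a => Min.min (f a) (g a) :=
  (hf.sub (hf.sub hg)).of_eq fun a => by omega

/-! ### Lists of bits -/

@[fun_prop]
theorem cons {f : α → Bool} {g : α → List Bool} (hf : PTime f) (hg : PTime g) :
    PTime fun a => f a :: g a := by
  have h : PTime fun x : Bool × List Bool => x.1 :: x.2 :=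
    of_flatMap (Sum.elim (fun b => [b]) fun b => [b]) [] fun x => by
      simp only [enc, pairEnc]; rw [flatMap_elim]; simp [Computability.encodeBool]
  exact h.comp (hf.pair hg)

@[fun_prop]
theorem append {f g : α → List Bool} (hf : PTime f) (hg : PTime g) :
    PTime fun a => f a ++ g a := by
  have h : PTime fun x : List Bool × List Bool => x.1 ++ x.2 :=
    of_flatMap (Sum.elim (fun b => [b]) fun b => [b]) [] fun x => by
      simp only [enc, pairEnc]; rw [flatMap_elim]; simp
  exact h.comp (hf.pair hg)

@[fun_prop]
theorem length {f : α → List Bool} (hf : PTime f) : PTime fun a => (f a).length := by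
  have h : PTime fun l : List Bool => l.length :=
    of_flatMap (fun _ => [()]) [] fun l => enc_nat_eq (by simp [enc])
  exact h.comp hf

@[fun_prop]
theorem replicate {f : α → ℕ} (hf : PTime f) (b : Bool) : PTime fun a => List.replicate (f a) b := by
  have h : PTime fun n : ℕ => List.replicate n b :=
    of_flatMap (fun _ => [b]) [] fun n => by
      simp [enc, unaryEnc, ← List.map_eq_flatMap]
  exact h.comp hf

@[fun_prop]
theorem headD {f : α → List Bool} (hf : PTime f) : PTime fun a => (f a).headD false := by
  have h : PTime fun l : List Bool => l.headD false := by
    refine of_transducer (Q := Option Bool) (fun q b => some (q.getD b)) none (fun _ _ => [])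
      (fun _ _ => []) (fun q => [q.getD false]) (fun _ => []) fun l => ?_
    rcases l with _ | ⟨b, l⟩
    · rfl
    · change [b] = (transduce _ _ _ none (b :: l) ++ transduce _ _ _ none (b :: l))
      simp only [transduce]
      rw [transduce_of_forall _ _ (by simp), transduce_of_forall _ _ (by simp)]
      exact (by simp [flatMap_nil'] : [b] = ((l.flatMap fun _ => ([] : List Bool)) ++ [b]) ++
          ((l.flatMap fun _ => ([] : List Bool)) ++ []))
  exact h.comp hf

@[fun_prop]
theorem tail {f : α → List Bool} (hf : PTime f) : PTime fun a => (f a).tail := by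
  have h : PTime fun l : List Bool => l.tail := by
    refine of_transducer (Q := Bool) (fun _ _ => true) false (fun q a => bif q then [a] else [])
      (fun _ _ => []) (fun _ => []) (fun _ => []) fun l => ?_
    rcases l with _ | ⟨b, l⟩
    · rfl
    · change l = (transduce _ _ _ false (b :: l) ++ transduce _ _ _ false (b :: l))
      simp only [transduce]
      rw [transduce_of_forall _ _ (by simp), transduce_of_forall _ _ (by simp)]
      exact (by simp [flatMap_nil', List.flatMap_singleton'] : l = ((l.flatMap fun a => [a]) ++ []) ++
          ((l.flatMap fun _ => ([] : List Bool)) ++ []))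
  exact h.comp hf

@[fun_prop]
theorem isEmpty {f : α → List Bool} (hf : PTime f) : PTime fun a => (f a).isEmpty :=
  (beq_zero hf.length).of_eq fun a => by cases f a <;> rfl

theorem iterate_tail {A : Type} (l : List A) (n : ℕ) : List.tail^[n] l = l.drop n := by
  induction n with
  | zero => rfl
  | succ n ih => rw [iterate_succ_apply', ih, List.tail_drop]

@[fun_prop]
theorem drop {f : α → List Bool} {n : α → ℕ} (hn : PTime n) (hf : PTime f) :
    PTime fun a => (f a).drop (n a) :=
  (iterate (step := fun _ l => List.tail l) hn hf (tail snd) hf.length fun a i _ => by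
    rw [iterate_tail]; simp).of_eq fun a => iterate_tail _ _

theorem iterate_foldl {σ : Type} (step : σ → Bool → σ) (l : List Bool) (s : σ) (i : ℕ)
    (hi : i ≤ l.length) :
    (fun x : List Bool × σ => (x.1.tail, step x.2 (x.1.headD false)))^[i] (l, s) =
      (l.drop i, (l.take i).foldl step s) := by
  induction i with
  | zero => simp
  | succ i ih =>
    rw [iterate_succ_apply', ih (by omega)]
    have h : l.drop i = l[i] :: l.drop (i + 1) := List.drop_eq_getElem_cons (by omega)
    simp only [h, List.tail_cons, List.headD_cons]
    rw [← List.take_concat_get' _ _ (by omega), List.foldl_append]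
    rfl

/-- A fold is an iteration on pairs of the remaining list and the accumulator. The size bound is
needed for the folds over all initial segments. -/
theorem foldl {l : α → List Bool} {s : α → β} {step : α → β → Bool → β} (hl : PTime l)
    (hs : PTime s) (hstep : PTime fun x : α × β × Bool => step x.1 x.2.1 x.2.2) {b : α → ℕ}
    (hb : PTime b) (hsize : ∀ a i, size (((l a).take i).foldl (step a) (s a)) ≤ b a) :
    PTime fun a => (l a).foldl (step a) (s a) := by
  have h := iterate (step := fun a (x : List Bool × β) => (x.1.tail, step a x.2 (x.1.headD false)))
    hl.length (hl.pair hs) ((tail (fst.comp snd)).pair (hstep.comp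
      (fst.pair ((snd.comp snd).pair (headD (fst.comp snd)))))) (hl.length.add hb)
    fun a i hi => by
      rw [iterate_foldl _ _ _ _ hi, size_pair]
      have := hsize a i
      simp only [size_list, List.length_drop]
      omega
  exact (snd.comp h).of_eq fun a => by rw [iterate_foldl _ _ _ _ le_rfl, List.take_length]

@[fun_prop]
theorem reverse {f : α → List Bool} (hf : PTime f) : PTime fun a => (f a).reverse :=
  (foldl (step := fun _ l b => b :: l) hf (const []) (by fun_prop) hf.length fun a i => by
    simp).of_eq fun a => by simp

@[fun_prop]
theorem take {f : α → List Bool} {n : α → ℕ} (hn : PTime n) (hf : PTime f) :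
    PTime fun a => (f a).take (n a) :=
  (reverse (drop (hf.length.sub hn) hf.reverse)).of_eq fun a => by
    rw [List.drop_reverse, List.reverse_reverse]
    rcases le_total (n a) (f a).length with h | h
    · rw [Nat.sub_sub_self h]
    · rw [List.take_of_length_le h, List.take_of_length_le (by omega)]

@[fun_prop]
theorem getD {f : α → List Bool} {n : α → ℕ} (hf : PTime f) (hn : PTime n) :
    PTime fun a => (f a).getD (n a) false :=
  (headD (drop hn hf)).of_eq fun a => by
    rw [List.getD_eq_getElem?_getD, ← List.head?_drop, List.headD_eq_head?_getD]

end PTime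

end Basic

end SmallCircuits

/-! ### Binary expansions, pairing of words, and symbols of the language. -/

namespace SmallCircuits

open Function Computability

/-! ### Binary numbers -/

/-- The number with the given binary digits, the least significant one first. -/
def bitsVal (l : List Bool) : ℕ := l.foldr (fun b n => 2 * n + b.toNat) 0

@[simp] theorem bitsVal_nil : bitsVal [] = 0 := rfl

@[simp] theorem bitsVal_cons (b : Bool) (l : List Bool) :
    bitsVal (b :: l) = 2 * bitsVal l + b.toNat := rfl

@[simp] theorem encodeNat_zero : encodeNat 0 = [] := rfl

/-- The recursion on the least significant digit. The case distinction keeps zero encoded by the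
empty word, without leading zeros. -/
theorem encodeNat_bit (b : Bool) (n : ℕ) :
    encodeNat (2 * n + b.toNat) = if n = 0 ∧ b = false then [] else b :: encodeNat n := by
  have h : ∀ x : Num, encodeNum (Num.bit b x) =
      if x = 0 ∧ b = false then [] else b :: encodeNum x := by
    rintro (_ | p) <;> cases b <;> simp [Num.bit, Num.bit0, Num.bit1, encodeNum,
      encodePosNum] <;> rfl
  have h₁ : ((2 * n + b.toNat : ℕ) : Num) = Num.bit b n := by
    cases b
    · push_cast
      simp [Num.bit, Num.bit0_of_bit0, two_mul]
    · push_cast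
      simp [Num.bit, Num.bit1_of_bit1, two_mul]
  unfold encodeNat
  rw [h₁, h]
  simp

theorem bitsVal_encodeNat (n : ℕ) : bitsVal (encodeNat n) = n := by
  induction n using Nat.strong_induction_on with
  | _ n ih =>
    rcases Nat.eq_zero_or_pos n with rfl | hn
    · rfl
    · obtain ⟨b, hb⟩ : ∃ b : Bool, n = 2 * (n / 2) + b.toNat :=
        ⟨decide (n % 2 = 1), by
          rcases Nat.mod_two_eq_zero_or_one n with h | h <;> simp [h] <;> omega⟩
      conv_lhs => rw [hb]
      rw [encodeNat_bit, if_neg]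
      · rw [bitsVal_cons, ih _ (by omega), ← hb]
      · rintro ⟨h₁, rfl⟩; simp at hb; omega

/-- Delete the leading zeros, which are at the end of the list. -/
def trimBits (l : List Bool) : List Bool :=
  l.foldr (fun b r => bif !b && r.isEmpty then [] else b :: r) []

theorem encodeNat_eq_nil {n : ℕ} : encodeNat n = [] ↔ n = 0 :=
  ⟨fun h => by rw [← bitsVal_encodeNat n, h]; rfl, fun h => by rw [h]; rfl⟩

/-- Trimming gives the canonical expansion; thus a list of bits computed in any way becomes a binary
output. -/
theorem trimBits_eq (l : List Bool) : trimBits l = encodeNat (bitsVal l) := by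
  induction l with
  | nil => rfl
  | cons b l ih =>
    rw [bitsVal_cons, encodeNat_bit]
    change (bif !b && (trimBits l).isEmpty then [] else b :: trimBits l) = _
    rw [ih]
    by_cases h : bitsVal l = 0
    · cases b <;> simp [h]
    · have : (encodeNat (bitsVal l)).isEmpty = false := by
        simpa [encodeNat_eq_nil] using h
      cases b <;> simp [h, this]

theorem getD_eq_testBit (l : List Bool) (i : ℕ) : l.getD i false = (bitsVal l).testBit i := by
  induction l generalizing i with
  | nil => simp
  | cons b l ih =>
    have h₀ : b.toNat < 2 := Bool.toNat_lt b
    rcases i with _ | i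
    · cases b <;> simp [Nat.testBit_zero, Nat.add_mod]
    · rw [bitsVal_cons, Nat.testBit_succ, List.getD_cons_succ, ih]
      congr 1
      omega

theorem encodeNat_getD (n i : ℕ) : (encodeNat n).getD i false = n.testBit i := by
  rw [getD_eq_testBit, bitsVal_encodeNat]

theorem length_trimBits_le (l : List Bool) : (trimBits l).length ≤ l.length := by
  induction l with
  | nil => simp [trimBits]
  | cons b l ih =>
    change (bif !b && (trimBits l).isEmpty then [] else b :: trimBits l).length ≤ _
    cases !b && (trimBits l).isEmpty <;> simp [ih]

theorem length_encodeNat_le {n k : ℕ} (h : n < 2 ^ k) : (encodeNat n).length ≤ k := by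
  induction k generalizing n with
  | zero => simp at h; simp [h]
  | succ k ih =>
    obtain ⟨b, hb⟩ : ∃ b : Bool, n = 2 * (n / 2) + b.toNat :=
        ⟨decide (n % 2 = 1), by
          rcases Nat.mod_two_eq_zero_or_one n with h | h <;> simp [h] <;> omega⟩
    rw [hb, encodeNat_bit]
    split
    · simp
    · have := ih (n := n / 2) (by rw [pow_succ] at h; omega)
      simpa using this

/-- The list of the first `m` binary digits. -/
theorem bitsVal_ofFn_testBit (n m : ℕ) (h : n < 2 ^ m) :
    bitsVal (List.ofFn fun i : Fin m => n.testBit i) = n := by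
  refine Nat.eq_of_testBit_eq fun i => ?_
  rw [← getD_eq_testBit, List.getD_eq_getElem?_getD, List.getElem?_ofFn]
  split
  · rfl
  · exact (Nat.testBit_lt_two_pow (h.trans_le (Nat.pow_le_pow_right (by norm_num)
      (by omega)))).symm

theorem encodeNat_two_pow_sub_one (m : ℕ) : encodeNat (2 ^ m - 1) = List.replicate m true := by
  induction m with
  | zero => rfl
  | succ m ih =>
    have h : 2 ^ (m + 1) - 1 = 2 * (2 ^ m - 1) + true.toNat := by
      have := Nat.one_le_two_pow (n := m)
      simp only [pow_succ, Bool.toNat_true]; omega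
    rw [h, encodeNat_bit, if_neg (by simp), ih, List.replicate_succ]

namespace PTime

variable {α β : Type} [WordEncodable α] [WordEncodable β]

@[fun_prop]
theorem trimBits {f : α → List Bool} (hf : PTime f) : PTime fun a => trimBits (f a) :=
  (foldl (step := fun _ r b => bif !b && r.isEmpty then [] else b :: r) hf.reverse (const [])
    (by fun_prop) hf.length fun a i => by
      rw [List.take_reverse, List.foldl_reverse, size_list]
      refine (length_trimBits_le _).trans ?_
      simp).of_eq fun a => by rw [List.foldl_reverse]; rfl

end PTime

/-! ### Pairs of words -/

/-- A pair of words as a word. -/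
def pairCode (u v : List Bool) : List Bool := u.flatMap (fun b => [true, b]) ++ false :: v

/-- The decoding of pairs of words. -/
def unpair : List Bool → List Bool × List Bool
  | [] => ([], [])
  | [true] => ([], [])
  | false :: v => ([], v)
  | true :: b :: w => (b :: (unpair w).1, (unpair w).2)

@[simp] theorem unpair_pairCode (u v : List Bool) : unpair (pairCode u v) = (u, v) := by
  induction u with
  | nil => simp [pairCode, unpair]
  | cons b u ih =>
    have : pairCode (b :: u) v = true :: b :: pairCode u v := rfl
    rw [this, unpair, ih]

@[simp] theorem length_pairCode (u v : List Bool) :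
    (pairCode u v).length = 2 * u.length + v.length + 1 := by
  simp [pairCode, Nat.mul_comm]; omega

theorem ptime_unpair : PTime unpair := by
  -- In state `some false` a marker is read, in `some true` a letter of the first word, and in
  -- `none`, after the separator, the second word.
  let δ : Option Bool → Bool → Option Bool := fun q b =>
    match q with
    | none => none
    | some false => if b then some true else none
    | some true => some false
  let o₁ : Option Bool → Bool → List (Bool ⊕ Bool) := fun q b => if q = some true then [.inl b] else []
  let o₂ : Option Bool → Bool → List (Bool ⊕ Bool) := fun q b => if q = none then [.inr b] else []
  refine PTime.of_transducer (β := List Bool × List Bool) δ (some false) o₁ o₂ (fun _ => [])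
    (fun _ => []) fun w => ?_
  have hd : ∀ v, transduce δ o₁ (fun _ => []) none v = [] ∧
      transduce δ o₂ (fun _ => []) none v = v.map .inr := fun v => by
    rw [PTime.transduce_of_forall, PTime.transduce_of_forall] <;>
      simp [o₁, o₂, δ, ← List.map_eq_flatMap, PTime.flatMap_nil']
  have h₁ : ∀ w, (unpair w).1.map Sum.inl = transduce δ o₁ (fun _ => []) (some false) w ∧
      (unpair w).2.map Sum.inr = transduce δ o₂ (fun _ => []) (some false) w := fun w => by
    induction w using unpair.induct with
    | case1 => simp [unpair, transduce]
    | case2 => simp [unpair, transduce, o₁, o₂]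
    | case3 v => simp [unpair, transduce, δ, o₁, o₂, hd]
    | case4 b w ih => simp [unpair, transduce, δ, o₁, o₂, ih]
  exact congrArg₂ (· ++ ·) (h₁ w).1 (h₁ w).2

@[fun_prop]
theorem PTime.unpair {α : Type} [WordEncodable α] {f : α → List Bool} (hf : PTime f) :
    PTime fun a => unpair (f a) := ptime_unpair.comp hf

/-! ### Symbols for functions on numbers -/

theorem encodeTuple_cons {n : ℕ} (v : Fin (n + 1) → ℕ) :
    encodeTuple v = (encodeNat (v 0)).map some ++ [none] ++ encodeTuple (Fin.tail v) := by
  simp only [encodeTuple, List.ofFn_succ, List.flatMap_cons]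
  rfl

theorem PTime.encodeTuple {α : Type} [WordEncodable α] {n : ℕ} {t : α → Fin n → ℕ}
    (h : ∀ i, PTime fun a => encodeNat (t a i)) : PTime fun a => encodeTuple (t a) := by
  induction n with
  | zero => exact (const []).of_eq fun a => by simp [SmallCircuits.encodeTuple]
  | succ n ih =>
    have hcat : PTime fun x : List Bool × List (Option Bool) => x.1.map some ++ [none] ++ x.2 := by
      refine of_flatMap₂ (Sum.elim (fun b => [some b]) fun _ => [])
        (Sum.elim (fun _ => []) fun b => [b]) [none] [] fun x => ?_
      simp only [WordEncodable.enc, pairEnc]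
      rw [flatMap_elim, flatMap_elim]
      exact (by simp [flatMap_nil', ← List.map_eq_flatMap] :
        x.1.map some ++ [none] ++ x.2 = ((x.1.flatMap fun b => [some b]) ++
          (x.2.flatMap fun _ => []) ++ [none]) ++ ((x.1.flatMap fun _ => []) ++
          (x.2.flatMap fun b => [b]) ++ []))
    exact (hcat.comp ((h 0).pair (ih (t := fun a => Fin.tail (t a)) fun i => h i.succ))).of_eq
      fun a => (encodeTuple_cons _).symm

/-- Symbols name functions that are computable in polynomial time. -/
theorem PTime.symbol {α : Type} [WordEncodable α] {n : ℕ} (G : PVSymbol n) {t : α → Fin n → ℕ}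
    (h : ∀ i, PTime fun a => encodeNat (t a i)) : PTime fun a => encodeNat (G.toFun (t a)) :=
  (PolyTime.comp (g := G.toFun) ⟨G.machine⟩
    ((PTime.encodeTuple h).congr_output (eb' := SmallCircuits.encodeTuple) fun _ => rfl)).congr_output
    fun _ => rfl

/-- The encoding of a 1-tuple is the binary expansion with an end marker; deleting the marker comes
before `F`. -/
theorem exists_symbol₁ {f : ℕ → ℕ} {F : List Bool → List Bool} (hF : PTime F)
    (h : ∀ a, F (encodeNat a) = encodeNat (f a)) :
    ∃ G : PVSymbol 1, ∀ v, G.toFun v = f (v 0) := by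
  have hp : PTime fun l : List (Option Bool) => l.flatMap Option.toList :=
    PTime.of_flatMap (β := List Bool) Option.toList [] fun l => (List.append_nil _).symm
  have h₁ := (hF.comp hp).congr_input (ea' := encodeTuple (n := 1)) encodeTuple fun _ => rfl
  refine ⟨⟨fun v => f (v 0), (h₁.congr_output (eb' := encodeNat) fun v => ?_).some⟩, fun _ => rfl⟩
  change _ = F _
  rw [encodeTuple_cons]
  simp [encodeTuple, List.flatMap_map, ← h]

theorem exists_symbol₂ {f : ℕ → ℕ → ℕ} {F : List Bool × List Bool → List Bool} (hF : PTime F)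
    (h : ∀ a b, F (encodeNat a, encodeNat b) = encodeNat (f a b)) :
    ∃ G : PVSymbol 2, ∀ v, G.toFun v = f (v 0) (v 1) := by
  -- The state tells whether the end marker of the first argument has been passed.
  let δ : Bool → Option Bool → Bool := fun q a => q || a.isNone
  let o₁ : Bool → Option Bool → List (Bool ⊕ Bool) := fun q a =>
    if q then [] else a.toList.map .inl
  let o₂ : Bool → Option Bool → List (Bool ⊕ Bool) := fun q a =>
    if q then a.toList.map .inr else []
  have hp : PolyTime encodeTuple WordEncodable.enc
      fun v : Fin 2 → ℕ => (encodeNat (v 0), encodeNat (v 1)) := by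
    refine PolyTime.of_transducer δ false o₁ o₂ (fun _ => []) (fun _ => []) fun v => ?_
    have key : ∀ (o : Bool → Option Bool → List (Bool ⊕ Bool)) (l : List Bool) r,
        transduce δ o (fun _ => []) false (l.map some ++ none :: r) =
        l.flatMap (fun b => o false (some b)) ++ (o false none ++
          transduce δ o (fun _ => []) true r) := fun o l r => by
      induction l with
      | nil => simp [transduce, δ]
      | cons b l ih => simp [transduce, δ, ih]
    have e : encodeTuple v = (encodeNat (v 0)).map some ++ none ::
        ((encodeNat (v 1)).map some ++ [none]) := by
      rw [encodeTuple_cons, encodeTuple_cons]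
      simp [encodeTuple, Fin.tail]
    rw [e, key, key, PTime.transduce_of_forall _ _ (by simp [δ]), PTime.transduce_of_forall _ _ (by simp [δ])]
    simp [o₁, o₂, List.flatMap_map, PTime.flatMap_nil', ← List.map_eq_flatMap]
    rfl
  have h₁ := PolyTime.comp hF hp
  refine ⟨⟨fun v => f (v 0) (v 1), (h₁.congr_output (eb' := encodeNat) fun v => ?_).some⟩,
    fun _ => rfl⟩
  exact (h _ _).symm

end SmallCircuits

/-! ### Subexponential growth, restrictions of circuits, and coding of circuits by numbers. -/

namespace SmallCircuits

open Filter

/-! ### Subexponential functions -/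

/-- The function `g` grows slower than every exponential function. -/
def SubExp (g : ℕ → ℕ) : Prop := ∀ q : ℕ, ∀ᶠ k in atTop, g k ^ q ≤ 2 ^ k

namespace SubExp

variable {f g : ℕ → ℕ}

theorem mono (hg : SubExp g) (h : ∀ᶠ k in atTop, f k ≤ g k) : SubExp f := fun q => by
  filter_upwards [hg q, h] with k h₁ h₂ using (Nat.pow_le_pow_left h₂ q).trans h₁

theorem const (c : ℕ) : SubExp fun _ => c := fun q =>
  (tendsto_pow_atTop_atTop_of_one_lt (r := 2) (by norm_num)).eventually_ge_atTop (c ^ q)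

theorem id : SubExp fun k => k := fun q => by
  have h := (tendsto_pow_const_div_const_pow_of_one_lt q (r := (2 : ℝ)) (by norm_num)).eventually_le_const
    (show (0 : ℝ) < 1 by norm_num)
  filter_upwards [h] with k hk
  rw [div_le_one (by positivity)] at hk
  exact_mod_cast hk

/-- The exponent `2q` for each factor gives the square of the claim. -/
theorem mul (hf : SubExp f) (hg : SubExp g) : SubExp fun k => f k * g k := fun q => by
  filter_upwards [hf (q * 2), hg (q * 2)] with k h₁ h₂
  rw [← Nat.pow_le_pow_iff_left (n := 2) (by norm_num), ← pow_mul, mul_pow, pow_two (2 ^ k)]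
  exact Nat.mul_le_mul h₁ h₂

theorem add (hf : SubExp f) (hg : SubExp g) : SubExp fun k => f k + g k := by
  have h : SubExp fun k => max (f k) (g k) := fun q => by
    filter_upwards [hf q, hg q] with k h₁ h₂
    rcases max_cases (f k) (g k) with h | h <;> simpa [h.1]
  exact ((const 2).mul h).mono (.of_forall fun k => by
    have := le_max_left (f k) (g k); have := le_max_right (f k) (g k); omega)

/-- For an integer q > 1/ε one has g(k)^q ≤ 2^k ≤ (2^(εk))^q eventually; take q-th roots. -/
theorem eventually_le_sizeBound (hg : SubExp g) {ε : ℝ} (hε : 0 < ε) :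
    ∀ᶠ k in atTop, g k ≤ sizeBound ε k := by
  obtain ⟨q, hq⟩ := exists_nat_gt (1 / ε)
  have hq₀ : (0 : ℝ) < q := (by positivity : (0 : ℝ) < 1 / ε).trans hq
  filter_upwards [hg q] with k hk
  refine Nat.le_floor ?_
  have h₁ : ((g k : ℝ)) ^ q ≤ ((2 : ℝ) ^ (ε * k)) ^ q := by
    refine le_trans (b := (2 : ℝ) ^ (k : ℝ)) (by rw [Real.rpow_natCast]; exact_mod_cast hk) ?_
    rw [← Real.rpow_natCast ((2 : ℝ) ^ (ε * k)) q, ← Real.rpow_mul (by norm_num)]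
    refine Real.rpow_le_rpow_of_exponent_le (by norm_num) ?_
    have h₂ : 1 ≤ ε * q := by rw [div_lt_iff₀ hε] at hq; linarith
    nlinarith [(Nat.cast_nonneg k : (0 : ℝ) ≤ k)]
  exact le_of_pow_le_pow_left₀ (by exact_mod_cast hq₀.ne') (by positivity) h₁

end SubExp

theorem sizeBound_le {ε : ℝ} (hε : ε < 1) (k : ℕ) : sizeBound ε k ≤ 2 ^ k := by
  refine Nat.floor_le_of_le ?_
  push_cast
  rw [← Real.rpow_natCast]
  exact Real.rpow_le_rpow_of_exponent_le (by norm_num)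
    (by nlinarith [(Nat.cast_nonneg k : (0 : ℝ) ≤ k)])

/-! ### Restrictions of circuits -/

/-- The gate that results from a gate when the inputs are replaced by inputs and constants. -/
def Gate.subst {n k i : ℕ} (ρ : Fin n → Fin k ⊕ Bool) : Gate n i → Gate k i
  | .const b => .const b
  | .input j => Sum.elim .input .const (ρ j)
  | .not a => .not a
  | .and a b => .and a b
  | .or a b => .or a b

theorem Gate.eval_subst {n k i : ℕ} (ρ : Fin n → Fin k ⊕ Bool) (x : Fin k → Bool)
    (v : Fin i → Bool) (g : Gate n i) :
    (g.subst ρ).eval x v = g.eval (fun j => Sum.elim x id (ρ j)) v := by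
  rcases g with _ | j | _ | _ | _ <;> try rfl
  simp only [Gate.subst, Gate.eval]
  rcases ρ j with _ | _ <;> rfl

/-- The circuit that results from a circuit when the inputs are replaced by inputs and
constants. -/
def Circuit.subst {n k : ℕ} (ρ : Fin n → Fin k ⊕ Bool) : {s : ℕ} → Circuit n s → Circuit k s
  | _, .nil => .nil
  | _, .snoc C g => .snoc (C.subst ρ) (g.subst ρ)

theorem Circuit.vals_subst {n k s : ℕ} (ρ : Fin n → Fin k ⊕ Bool) (x : Fin k → Bool)
    (C : Circuit n s) : (C.subst ρ).vals x = C.vals fun j => Sum.elim x id (ρ j) := by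
  induction C with
  | nil => rfl
  | snoc C g ih => simp only [subst, vals, ih, Gate.eval_subst]

theorem Circuit.eval_subst {n k s : ℕ} (ρ : Fin n → Fin k ⊕ Bool) (x : Fin k → Bool)
    (C : Circuit n s) : (C.subst ρ).eval x = C.eval fun j => Sum.elim x id (ρ j) := by
  rcases C with _ | ⟨C, g⟩
  · rfl
  · simp only [subst, eval, vals_subst, Gate.eval_subst]

/-! ### Truth tables -/

theorem sum_testBit (y n : ℕ) :
    ∑ j ∈ Finset.range n, (if y.testBit j = true then 2 ^ j else 0) = y % 2 ^ n := by
  induction n with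
  | zero => simp [Nat.mod_one]
  | succ n ih =>
    rw [Finset.sum_range_succ, ih, Nat.mod_pow_succ, Nat.testBit_eq_decide_div_mod_eq]
    rcases Nat.mod_two_eq_zero_or_one (y / 2 ^ n) with h | h <;> simp [h]

theorem truthTable_eq {k s y : ℕ} {C : Circuit k s}
    (h : ∀ j < 2 ^ k, C.eval (fun i : Fin k => j.testBit i) = y.testBit j) :
    truthTable C = y % 2 ^ 2 ^ k := by
  rw [← sum_testBit]
  exact Finset.sum_congr rfl fun j hj => by rw [h j (Finset.mem_range.1 hj)]

/-! ### Codes of circuits -/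

theorem Circuit.eval_eq_vals {k s : ℕ} (C : Circuit k (s + 1)) (v : Fin k → Bool) :
    C.eval v = C.vals v (Fin.last s) := by
  cases C with
  | snoc C g => simp [eval, vals]

theorem bitField_congr {x y pos len N : ℕ} (h : x % 2 ^ N = y % 2 ^ N) (hN : pos + len ≤ N) :
    bitField x pos len = bitField y pos len := by
  have key : ∀ z, bitField z pos len = bitField (z % 2 ^ N) pos len := fun z => by
    refine Nat.eq_of_testBit_eq fun i => ?_
    simp only [bitField, Nat.testBit_mod_two_pow, Nat.testBit_div_two_pow]
    rcases lt_or_ge i len with hi | hi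
    · simp [hi, show i + pos < N by omega]
    · simp [hi.not_gt]
  rw [key x, key y, h]

theorem decodeCircuit_congr {k L x y s : ℕ} (h : x % 2 ^ (10 * L * s) = y % 2 ^ (10 * L * s)) :
    decodeCircuit k L x s = decodeCircuit k L y s := by
  induction s with
  | zero => rfl
  | succ s ih =>
    have hs : 10 * L * (s + 1) = 10 * L * s + 10 * L := by ring
    have ih' := ih (by
      have := congrArg (· % 2 ^ (10 * L * s)) h
      simpa [Nat.mod_mod_of_dvd _ (pow_dvd_pow 2 (by omega : 10 * L * s ≤ 10 * L * (s + 1)))]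
        using this)
    simp only [decodeCircuit, ih']
    rw [bitField_congr h (by omega), bitField_congr h (by omega), bitField_congr h (by omega)]

theorem bitField_eq_zero {x pos len : ℕ} (h : x < 2 ^ pos) : bitField x pos len = 0 := by
  simp [bitField, Nat.div_eq_of_lt h]

/-- Zero blocks decode to idle nodes, which repeat the previous value. At least one real node is
needed for the last value to be passed on. -/
theorem eval_decodeCircuit_of_lt {k L x s n : ℕ} (h : x < 2 ^ (10 * L * (s + 1)))
    (v : Fin k → Bool) : (decodeCircuit k L x (s + 1 + n)).eval v =
      (decodeCircuit k L x (s + 1)).eval v := by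
  induction n with
  | zero => rfl
  | succ n ih =>
    have h₀ : x < 2 ^ (10 * L * (s + 1 + n)) :=
      h.trans_le (Nat.pow_le_pow_right (by norm_num) (Nat.mul_le_mul_left _ (by omega)))
    rw [← ih, ← add_assoc, decodeCircuit, bitField_eq_zero h₀]
    have h₁ : ∀ a b, decodeGate k (s + 1 + n) 0 a b = idleGate k (s + 1 + n) := by
      simp [decodeGate]
    rw [h₁, Circuit.eval]
    generalize decodeCircuit k L x (s + 1 + n) = C
    have h₂ : s + 1 + n = s + n + 1 := by omega
    revert C
    rw [h₂]
    intro C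
    rw [Circuit.eval_eq_vals]
    simp [idleGate, Gate.eval]

/-- The three numbers that code a gate when a node with the value `0` is put in front. -/
def Gate.code {k i : ℕ} : Gate k i → ℕ × ℕ × ℕ
  | .const false => (3, 0, 0)
  | .const true => (5, 0, 0)
  | .input j => (1, j, 0)
  | .not a => (2, a + 1, 0)
  | .and a b => (3, a + 1, b + 1)
  | .or a b => (4, a + 1, b + 1)

/-- No operation code denotes the constant `false`. The extra node 0 supplies it, as the conjunction
of node 0 with itself, at the price of shifting all operands by one. -/
theorem Gate.eval_code {k i : ℕ} (g : Gate k i) (x : Fin k → Bool) (v : Fin i → Bool) :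
    (decodeGate k (i + 1) g.code.1 g.code.2.1 g.code.2.2).eval x (Fin.cons false v) =
      g.eval x v := by
  have h : ∀ a : Fin i, (⟨a + 1, by omega⟩ : Fin (i + 1)) = a.succ := fun _ => rfl
  rcases g with (_ | _) | _ | _ | _ | _ <;>
    simp [code, decodeGate, eval, h]

theorem Gate.code_lt {k i L : ℕ} (g : Gate k i) (hL : 2 ≤ L) (hk : k ≤ 2 ^ (4 * L))
    (hi : i < 2 ^ (4 * L)) :
    g.code.1 < 2 ^ (2 * L) ∧ g.code.2.1 < 2 ^ (4 * L) ∧ g.code.2.2 < 2 ^ (4 * L) := by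
  -- The operation codes are at most 5, so four bits suffice; this is the use of `2 ≤ L`.
  have h₁ : 2 ^ 4 ≤ 2 ^ (2 * L) := Nat.pow_le_pow_right (by norm_num) (by omega)
  have h₂ : 0 < 2 ^ (4 * L) := by positivity
  rcases g with (_ | _) | ⟨j⟩ | ⟨a⟩ | ⟨a, b⟩ | ⟨a, b⟩ <;> simp only [code] <;>
    refine ⟨?_, ?_, ?_⟩ <;> omega

/-- A gate as a block of `10 * L` bits. -/
def Gate.block {k i : ℕ} (L : ℕ) (g : Gate k i) : ℕ :=
  g.code.1 + 2 ^ (2 * L) * (g.code.2.1 + 2 ^ (4 * L) * g.code.2.2)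

/-- A circuit, after a node with the value `0`, as a number. -/
def Circuit.code {k : ℕ} (L : ℕ) : {s : ℕ} → Circuit k s → ℕ
  | _, .nil => 0
  | s + 1, .snoc C g => C.code L + 2 ^ (10 * L * (s + 1)) * g.block L

theorem Gate.block_lt {k i L : ℕ} (g : Gate k i) (hL : 2 ≤ L) (hk : k ≤ 2 ^ (4 * L))
    (hi : i < 2 ^ (4 * L)) : g.block L < 2 ^ (10 * L) := by
  obtain ⟨h₁, h₂, h₃⟩ := g.code_lt hL hk hi
  have e : 2 ^ (10 * L) = 2 ^ (2 * L) * (2 ^ (4 * L) * 2 ^ (4 * L)) := by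
    rw [← pow_add, ← pow_add]; congr 1; ring
  rw [e, block]
  have h₄ : g.code.2.1 + 2 ^ (4 * L) * g.code.2.2 < 2 ^ (4 * L) * 2 ^ (4 * L) := by
    nlinarith
  nlinarith

theorem Circuit.code_lt {k s L : ℕ} (C : Circuit k s) (hL : 2 ≤ L) (hk : k ≤ 2 ^ (4 * L))
    (hs : s ≤ 2 ^ (4 * L)) : C.code L < 2 ^ (10 * L * (s + 1)) := by
  induction C with
  | nil => simp [code]
  | @snoc s C g ih =>
    have h₁ := ih (by omega)
    have h₂ := g.block_lt hL hk (by omega)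
    have e : 2 ^ (10 * L * (s + 1 + 1)) = 2 ^ (10 * L * (s + 1)) * 2 ^ (10 * L) := by
      rw [← pow_add]; congr 1
    rw [e, code]
    nlinarith

theorem bitField_add_mul {x b pos off len : ℕ} (hx : x < 2 ^ pos) :
    bitField (x + 2 ^ pos * b) (pos + off) len = bitField b off len := by
  rw [bitField, pow_add, ← Nat.div_div_eq_div_mul, Nat.add_mul_div_left _ _ (by positivity),
    Nat.div_eq_of_lt hx, zero_add, bitField]

/-- The lowest block is zero and decodes to the idle node without predecessor, which has the value
0. Each further gate occupies the next block and leaves the lower ones untouched, so the induction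
goes through. -/
theorem Circuit.vals_decodeCircuit_code {k s L : ℕ} (C : Circuit k s) (hL : 2 ≤ L)
    (hk : k ≤ 2 ^ (4 * L)) (hs : s ≤ 2 ^ (4 * L)) (v : Fin k → Bool) :
    (decodeCircuit k L (C.code L) (s + 1)).vals v =
      (Fin.cons false (C.vals v) : Fin (s + 1) → Bool) := by
  induction C with
  | nil =>
    funext i
    obtain rfl : i = 0 := Fin.ext (by omega)
    simp [decodeCircuit, code, vals, bitField, decodeGate, idleGate, Gate.eval, Fin.snoc]
  | @snoc s C g ih =>
    have hx := C.code_lt hL hk (by omega)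
    obtain ⟨h₁, h₂, h₃⟩ := g.code_lt hL hk (by omega)
    have e₁ : bitField (g.block L) 0 (2 * L) = g.code.1 := by
      simp [bitField, Gate.block, Nat.mod_eq_of_lt h₁]
    have e₂ : bitField (g.block L) (2 * L) (4 * L) = g.code.2.1 := by
      have := bitField_add_mul (b := g.code.2.1 + 2 ^ (4 * L) * g.code.2.2) (off := 0)
        (len := 4 * L) h₁
      rw [add_zero] at this
      rw [Gate.block, this]
      simp [bitField, Nat.mod_eq_of_lt h₂]
    have e₃ : bitField (g.block L) (6 * L) (4 * L) = g.code.2.2 := by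
      rw [show 6 * L = 2 * L + 4 * L by ring, Gate.block, bitField_add_mul h₁]
      have := bitField_add_mul (b := g.code.2.2) (off := 0) (len := 4 * L) h₂
      rw [add_zero] at this
      rw [this]
      simp [bitField, Nat.mod_eq_of_lt h₃]
    have e₀ : decodeCircuit k L ((C.snoc g).code L) (s + 1) =
        decodeCircuit k L (C.code L) (s + 1) :=
      decodeCircuit_congr (by simp [code])
    have e₁' := bitField_add_mul (b := g.block L) (off := 0) (len := 2 * L) hx
    rw [add_zero] at e₁'
    rw [decodeCircuit, e₀, code, e₁', bitField_add_mul hx, bitField_add_mul hx, e₁, e₂, e₃, vals,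
      ih (by omega), Gate.eval_code, vals, Fin.cons_snoc_eq_snoc_cons]

theorem Circuit.eval_decodeCircuit_code {k s n L : ℕ} (C : Circuit k s) (hL : 2 ≤ L)
    (hk : k ≤ 2 ^ (4 * L)) (hs : s ≤ 2 ^ (4 * L)) (hn : s + 1 ≤ n) (v : Fin k → Bool) :
    (decodeCircuit k L (C.code L) n).eval v = C.eval v := by
  obtain ⟨n, rfl⟩ := Nat.exists_eq_add_of_le hn
  rw [eval_decodeCircuit_of_lt (C.code_lt hL hk hs), eval_eq_vals,
    C.vals_decodeCircuit_code hL hk hs]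
  rcases C with _ | ⟨C, g⟩
  · rfl
  · rw [eval_eq_vals, ← Fin.succ_last, Fin.cons_succ]

end SmallCircuits

/-! ### The use of (H): feasible strings are truth tables of subexponential circuits, whose codes
are feasible. -/

namespace SmallCircuits

open Filter Computability

/-! ### Truncated numbers -/

/-- The number with the given binary digits, truncated at `B`. -/
def truncVal (l : List Bool) (B : ℕ) : ℕ := l.foldr (fun b n => min (2 * n + b.toNat) B) 0

/-- Truncating after every digit gives the same result as truncating at the end, but keeps all
intermediate unary numbers below or equal to `B`. -/
theorem truncVal_eq (l : List Bool) (B : ℕ) : truncVal l B = min (bitsVal l) B := by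
  induction l with
  | nil => simp [truncVal]
  | cons b l ih =>
    change min (2 * truncVal l B + b.toNat) B = _
    rw [ih, bitsVal_cons]
    omega

/-- The number `2 ^ n`, truncated at `B`. -/
def truncPow (n B : ℕ) : ℕ := (fun x => min (2 * x) B)^[n] (min 1 B)

theorem truncPow_eq (n B : ℕ) : truncPow n B = min (2 ^ n) B := by
  induction n with
  | zero => rfl
  | succ n ih =>
    rw [truncPow, Function.iterate_succ_apply', ← truncPow, ih, pow_succ]
    omega

namespace PTime

variable {α : Type} [WordEncodable α]

@[fun_prop]
theorem truncVal {l : α → List Bool} {B : α → ℕ} (hl : PTime l) (hB : PTime B) :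
    PTime fun a => truncVal (l a) (B a) :=
  (foldl (step := fun a n b => Min.min (2 * n + bif b then 1 else 0) (B a)) hl.reverse (const 0)
    (by fun_prop) hB fun a i => by
      rw [List.take_reverse, List.foldl_reverse, size_nat]
      cases List.drop _ (l a)
      · simp
      · exact min_le_right _ _).of_eq fun a => by
    rw [List.foldl_reverse, SmallCircuits.truncVal]
    rfl

@[fun_prop]
theorem truncPow {n B : α → ℕ} (hn : PTime n) (hB : PTime B) :
    PTime fun a => truncPow (n a) (B a) :=
  iterate (step := fun a x => Min.min (2 * x) (B a)) hn (PTime.min (const 1) hB) (by fun_prop) hB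
    fun a i _ => by
      rw [size_nat]
      change SmallCircuits.truncPow i (B a) ≤ _
      rw [truncPow_eq]
      exact min_le_right _ _

end PTime

/-! ### Languages of binary digits -/

/-- The words that consist of a number `j`, an advice word `a` and padding, such that the `j`-th
binary digit of `F (m, a)` is `1`, where `m` is `2` to the length of `j`. All numbers are truncated
at the `q`-th power of the length of the word. -/
def bitLanguage (F : ℕ × List Bool → ℕ) (q : ℕ) : Set (List Bool) :=
  {w | (encodeNat (F (truncPow (unpair w).1.length (w.length ^ q),
    (unpair (unpair w).2).1))).getD (truncVal (unpair w).1 (w.length ^ q)) false = true}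

/-- The truncation at a fixed power of the word length makes the unary argument of `F` and the bit
position polynomially small, for every word. -/
theorem bitLanguage_inP {F : ℕ × List Bool → ℕ} (hF : PTime fun x => encodeNat (F x)) (q : ℕ) :
    InP (bitLanguage F q) := by
  classical
  have h₁ : PTime fun w : List Bool => (truncPow (unpair w).1.length (w.length ^ q),
    (unpair (unpair w).2).1) := by fun_prop
  have h₂ : PTime fun w : List Bool => (encodeNat (F (truncPow (unpair w).1.length (w.length ^ q),
      (unpair (unpair w).2).1))).getD (truncVal (unpair w).1 (w.length ^ q)) false :=
    (hF.comp h₁).getD (by fun_prop)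
  refine h₂.congr_output (eb' := encodeBool) fun w => ?_
  unfold bitLanguage
  rw [Set.mem_ofPred_eq, Bool.decide_eq_true]
  rfl

/-- Enough padding makes the truncations ineffective. -/
theorem mem_bitLanguage {F : ℕ × List Bool → ℕ} {q k i : ℕ} {a pad : List Bool}
    (hi : i < 2 ^ k)
    (hN : 2 ^ k ≤ (pairCode (List.ofFn fun j : Fin k => i.testBit j) (pairCode a pad)).length ^ q) :
    pairCode (List.ofFn fun j : Fin k => i.testBit j) (pairCode a pad) ∈ bitLanguage F q ↔
      (F (2 ^ k, a)).testBit i = true := by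
  rw [bitLanguage, Set.mem_ofPred_eq, truncPow_eq, truncVal_eq, unpair_pairCode, unpair_pairCode,
    bitsVal_ofFn_testBit _ _ hi, List.length_ofFn, min_eq_left hN, min_eq_left (hi.le.trans hN),
    encodeNat_getD]

/-- Hardwiring: `T` is a template for words whose letters are variables or fixed bits. Substituting
constants and variables for inputs does not change the number of nodes. -/
theorem HasCircuitsOfSize.restrict {d : ℕ} {S : Set (List Bool)} (h : HasCircuitsOfSize d S) :
    ∃ c : ℕ, ∀ {k : ℕ} (T : List (Fin k ⊕ Bool)), T ≠ [] → ∃ s ≤ c * T.length ^ d,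
      ∃ C : Circuit k s, ∀ x, C.eval x = true ↔ T.map (Sum.elim x id) ∈ S := by
  obtain ⟨c, hc⟩ := h
  refine ⟨c, fun T hT => ?_⟩
  obtain ⟨s, hs, C, hC⟩ := hc T.length (List.length_pos_iff.2 hT)
  refine ⟨s, hs, C.subst T.get, fun x => ?_⟩
  rw [Circuit.eval_subst, hC]
  have : (List.ofFn fun j => Sum.elim x id (T.get j)) = T.map (Sum.elim x id) := by
    conv_rhs => rw [← List.ofFn_get T, List.map_ofFn]
    rfl
  rw [this]

/-! ### Short circuits for feasible strings -/

/-- The function `f` on numbers is computed, from `1 ^ m` for `m = 2 ^ k`, in polynomial time with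
advice of subexponential length. -/
def Feasible (f : ℕ → ℕ) : Prop :=
  ∃ F : ℕ × List Bool → ℕ, (PTime fun x => encodeNat (F x)) ∧
    ∃ a : ℕ → List Bool, SubExp (fun k => (a k).length) ∧ ∀ k, f k = F (2 ^ k, a k)

/-- The words have length N = 2^(⌊k/q⌋+1): long enough that N^q ≥ 2^k, which makes reading a bit of
`f k` a polynomial-time task, yet short enough that circuits of size c·N^d are small. The exponent
`d` is the same for every `q`, so `q` can be chosen after it. -/
theorem exists_circuit_of_feasible {d : ℕ} (hd : ∀ S, InP S → HasCircuitsOfSize d S)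
    {f : ℕ → ℕ} (hf : Feasible f) (p : ℕ) :
    ∀ᶠ k in atTop, ∃ s, s ^ p ≤ 2 ^ k ∧ ∃ C : Circuit k s, truthTable C = f k % 2 ^ 2 ^ k := by
  obtain ⟨F, hF, a, ha, hfF⟩ := hf
  -- Then N^(dp) is at most 2^(k/2) up to a constant factor, which the other half of 2^k absorbs.
  set q := 2 * d * p + 1 with hq
  obtain ⟨c, hc⟩ := (hd _ (bitLanguage_inP hF q)).restrict
  have hbase : SubExp fun k => 2 * k + (2 * (a k).length + 1) + 1 :=
    (((SubExp.const 2).mul .id).add ((((SubExp.const 2).mul ha).add (.const 1)))).add (.const 1)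
  filter_upwards [hbase q, SubExp.const (c * 2 ^ d) (2 * p)] with k hk hck
  -- The left side is the length without padding. Its q-th power is at most 2^k, and `k / q` is
  -- rounded down, whence the `+ 1`.
  have hlt : 2 * k + (2 * (a k).length + 1) + 1 < 2 ^ (k / q + 1) := by
    refine lt_of_pow_lt_pow_left₀ q (by positivity) (hk.trans_lt ?_)
    rw [← pow_mul]
    exact Nat.pow_lt_pow_right (by norm_num) (by
      have := Nat.div_add_mod k q; have := Nat.mod_lt k (by omega : 0 < q); nlinarith)
  obtain ⟨r, hr⟩ := Nat.exists_eq_add_of_le hlt.le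
  set w := pairCode (a k) (List.replicate r false) with hw
  -- This is `pairCode` with variables for the letters of its first word; the marker bits, advice
  -- and padding are fixed.
  set T : List (Fin k ⊕ Bool) := (List.finRange k).flatMap (fun i => [.inr true, .inl i]) ++
    .inr false :: w.map .inr with hT
  have hTmap : ∀ x, T.map (Sum.elim x id) = pairCode (List.ofFn x) w := fun x => by
    simp [hT, pairCode, List.map_flatMap, List.ofFn_eq_map, List.flatMap_map, Function.comp_def]
  have hTlen : T.length = 2 ^ (k / q + 1) := by
    rw [← List.length_map (Sum.elim (fun _ => false) id), hTmap, hw, length_pairCode,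
      length_pairCode, List.length_ofFn, List.length_replicate, hr]
    omega
  obtain ⟨s, hs, C, hC⟩ := hc T (by simp [hT])
  refine ⟨s, ?_, C, ?_⟩
  -- Squares are compared to avoid half-integral exponents.
  · rw [← Nat.pow_le_pow_iff_left (n := 2) (by norm_num), ← pow_mul]
    calc s ^ (p * 2) ≤ (c * (2 ^ (k / q + 1)) ^ d) ^ (p * 2) :=
          Nat.pow_le_pow_left (hTlen ▸ hs) _
      _ = (c * 2 ^ d) ^ (2 * p) * 2 ^ (k / q * (2 * d * p)) := by
          rw [pow_succ, mul_pow, ← pow_mul]; ring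
      _ ≤ 2 ^ k * 2 ^ k := Nat.mul_le_mul hck (Nat.pow_le_pow_right (by norm_num) (by
          have := Nat.div_mul_le_self k q
          nlinarith [Nat.zero_le (k / q)]))
      _ = (2 ^ k) ^ 2 := (pow_two _).symm
  · refine truthTable_eq fun i hi => ?_
    rw [Bool.eq_iff_iff, hC, hTmap, hw, mem_bitLanguage hi, hfF]
    rw [← hw, ← hTmap, List.length_map, hTlen, ← pow_mul]
    exact Nat.pow_le_pow_right (by norm_num) (by
      have := Nat.div_add_mod k q; have := Nat.mod_lt k (by omega : 0 < q); nlinarith)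

/-- The least size of a circuit for `f k` lies below all the bounds obtained for the various
exponents, so no diagonal choice of the exponent is needed. -/
theorem exists_subExp_circuit {d : ℕ} (hd : ∀ S, InP S → HasCircuitsOfSize d S)
    {f : ℕ → ℕ} (hf : Feasible f) : ∃ t : ℕ → ℕ, SubExp t ∧
    ∀ᶠ k in atTop, ∃ C : Circuit k (t k), truthTable C = f k % 2 ^ 2 ^ k := by
  let P : ℕ → Set ℕ := fun k => {s | ∃ C : Circuit k s, truthTable C = f k % 2 ^ 2 ^ k}
  refine ⟨fun k => sInf (P k), fun q => ?_, ?_⟩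
  · filter_upwards [exists_circuit_of_feasible hd hf q] with k ⟨s, hs, hC⟩
    exact (Nat.pow_le_pow_left (Nat.sInf_le (show s ∈ P k from hC)) q).trans hs
  -- Exponent 0 is used only for the existence of some circuit, without which the infimum would be
  -- meaningless.
  · filter_upwards [exists_circuit_of_feasible hd hf 0] with k ⟨s, _, hC⟩
    exact Nat.sInf_mem (s := P k) ⟨s, hC⟩

/-- A subexponential circuit has a code of subexponentially many bits, so the code is itself
admissible advice. The advice may be nonuniform, and therefore nothing has to be computed to find
the circuit. -/
theorem exists_feasible_code {d : ℕ} (hd : ∀ S, InP S → HasCircuitsOfSize d S) {ε : ℝ}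
    (hε₀ : 0 < ε) (hε₁ : ε < 1) {f : ℕ → ℕ} (hf : Feasible f) :
    ∃ x : ℕ → ℕ, Feasible x ∧ ∀ᶠ k in atTop,
      x k < 2 ^ codeLength ε k ∧ ttFun ε k (x k) = f k % 2 ^ 2 ^ k := by
  obtain ⟨t, ht, hC⟩ := exists_subExp_circuit hd hf
  set L : ℕ → ℕ := fun k => Nat.clog 2 (sizeBound ε k) with hL
  have hx : ∀ᶠ k in atTop, ∃ x < 2 ^ (10 * L k * (t k + 1)),
      x < 2 ^ codeLength ε k ∧ ttFun ε k x = f k % 2 ^ 2 ^ k := by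
    -- Room for the extra node 0, input indices that fit into the operand fields, and `2 ≤ L k`,
    -- which follows from a size bound of at least 3.
    filter_upwards [hC, (ht.add (.const 1)).eventually_le_sizeBound hε₀,
      SubExp.id.eventually_le_sizeBound hε₀, (SubExp.const 3).eventually_le_sizeBound hε₀]
      with k ⟨C, hC⟩ h₁ h₂ h₃
    have hs : sizeBound ε k ≤ 2 ^ (4 * L k) :=
      (Nat.le_pow_clog (by norm_num) _).trans (Nat.pow_le_pow_right (by norm_num) (Nat.le_mul_of_pos_left _ (by norm_num)))
    have hL₂ : 2 ≤ L k := (Nat.lt_clog_iff_pow_lt (by norm_num)).2 (by norm_num; omega)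
    have hlt := C.code_lt hL₂ (h₂.trans hs) (by omega)
    refine ⟨C.code (L k), hlt, hlt.trans_le (Nat.pow_le_pow_right (by norm_num) ?_), ?_⟩
    · rw [codeLength, mul_assoc, mul_assoc, mul_comm (L k)]
      exact Nat.mul_le_mul_left _ (Nat.mul_le_mul_right _ h₁)
    · rw [← hC]
      unfold ttFun truthTable
      refine Finset.sum_congr rfl fun j _ => ?_
      rw [C.eval_decodeCircuit_code hL₂ (h₂.trans hs) (by omega) h₁]
  obtain ⟨x, hx⟩ : ∃ x : ℕ → ℕ, ∀ᶠ k in atTop, x k < 2 ^ (10 * L k * (t k + 1)) ∧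
      x k < 2 ^ codeLength ε k ∧ ttFun ε k (x k) = f k % 2 ^ 2 ^ k := by
    classical
    refine ⟨fun k => if h : ∃ x < 2 ^ (10 * L k * (t k + 1)),
      x < 2 ^ codeLength ε k ∧ ttFun ε k x = f k % 2 ^ 2 ^ k then h.choose else 0, ?_⟩
    filter_upwards [hx] with k hk
    rw [dif_pos hk]
    exact hk.choose_spec
  -- The function merely reads its advice as a binary number.
  refine ⟨x, ⟨fun y => bitsVal y.2, ?_, fun k => encodeNat (x k), ?_, fun k =>
    (bitsVal_encodeNat _).symm⟩, hx.mono fun k h => h.2⟩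
  · exact (PTime.snd.trimBits).of_eq fun y => trimBits_eq _
  · refine SubExp.mono (((SubExp.const 10).mul .id).mul (ht.add (.const 1))) ?_
    filter_upwards [hx] with k hk
    refine (length_encodeNat_le hk.1).trans (Nat.mul_le_mul_right _ (Nat.mul_le_mul_left _ ?_))
    exact (Nat.clog_le_iff_le_pow (by norm_num)).2 (sizeBound_le hε₁ k)

end SmallCircuits

/-! ### The model: feasible elements of an ultrapower of ℕ. -/

namespace SmallCircuits

open Filter Computability FirstOrder Language

/-! ### The model -/

/-- The advice words of the arguments are merged by `pairCode`, one argument at a time, which keeps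
the length subexponential. Then `G` is composed with the functions that read their own part. -/
theorem Feasible.symbol {n : ℕ} (G : PVSymbol n) {f : Fin n → ℕ → ℕ} (hf : ∀ i, Feasible (f i)) :
    Feasible fun k => G.toFun fun i => f i k := by
  suffices h : ∃ F : Fin n → ℕ × List Bool → ℕ, (∀ i, PTime fun x => encodeNat (F i x)) ∧
      ∃ a : ℕ → List Bool, SubExp (fun k => (a k).length) ∧ ∀ i k, f i k = F i (2 ^ k, a k) by
    obtain ⟨F, hF, a, ha, h⟩ := h
    exact ⟨fun x => G.toFun fun i => F i x, PTime.symbol G hF, a, ha, fun k => by simp only [h]⟩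
  clear G
  induction n with
  | zero => exact ⟨Fin.elim0, fun i => i.elim0, fun _ => [], by simpa using SubExp.const 0,
      fun i => i.elim0⟩
  | succ n ih =>
    obtain ⟨F₀, hF₀, a₀, ha₀, h₀⟩ := hf 0
    obtain ⟨F, hF, a, ha, h⟩ := ih fun i => hf i.succ
    have hp₁ : PTime fun x : ℕ × List Bool => (x.1, (unpair x.2).1) := by fun_prop
    have hp₂ : PTime fun x : ℕ × List Bool => (x.1, (unpair x.2).2) := by fun_prop
    refine ⟨Fin.cons (fun x => F₀ (x.1, (unpair x.2).1)) fun i x => F i (x.1, (unpair x.2).2),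
      Fin.cases (hF₀.comp hp₁) fun i => (hF i).comp hp₂, fun k => pairCode (a₀ k) (a k), ?_,
      Fin.cases (fun k => ?_) fun i k => ?_⟩
    · simpa using (((SubExp.const 2).mul ha₀).add ha).add (.const 1)
    · simp [h₀]
    · simp [h]

/-- The elements of the ultrapower of `ℕ` that are represented by feasible functions. -/
noncomputable def feasibleSubstructure : LPV.Substructure ((hyperfilter ℕ : Filter ℕ).Product fun _ => ℕ) where
  carrier := {u | ∃ f : ℕ → ℕ, Feasible f ∧ u = (f : (hyperfilter ℕ : Filter ℕ).Product fun _ => ℕ)}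
  fun_mem {n} G x hx := by
    choose f hf hfx using hx
    refine ⟨_, Feasible.symbol G hf, ?_⟩
    rw [funext hfx]
    exact Ultraproduct.funMap_cast (L := LPV) (u := hyperfilter ℕ) (M := fun _ => ℕ) G f

instance : TPV.IsUniversal := ⟨fun _ h => h.1⟩

/-- By Łoś's theorem; universality of the theory then hands it down to `feasibleSubstructure`. -/
instance : ((hyperfilter ℕ : Filter ℕ).Product fun _ => ℕ) ⊨ TPV :=
  (Theory.model_iff _).2 fun φ hφ =>
    (Ultraproduct.sentence_realize φ).2 (.of_forall fun _ => hφ.2)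

theorem feasible_ones : Feasible ones :=
  ⟨fun x => 2 ^ x.1 - 1, (PTime.fst.replicate true).of_eq fun x =>
    (encodeNat_two_pow_sub_one _).symm, fun _ => [], by simpa using SubExp.const 0, fun _ => rfl⟩

/-- The elements that are represented by feasible functions. -/
noncomputable def Feasible.toModel {f : ℕ → ℕ} (hf : Feasible f) : feasibleSubstructure :=
  ⟨(f : (hyperfilter ℕ : Filter ℕ).Product fun _ => ℕ), f, hf, rfl⟩

theorem exists_toModel (u : feasibleSubstructure) : ∃ f, ∃ hf : Feasible f, u = hf.toModel := by
  obtain ⟨_, f, hf, rfl⟩ := u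
  exact ⟨f, hf, rfl⟩

theorem Feasible.funMap_toModel {n : ℕ} (G : PVSymbol n) {f : Fin n → ℕ → ℕ}
    (hf : ∀ i, Feasible (f i)) :
    Structure.funMap (L := LPV) G (fun i => (hf i).toModel) = (Feasible.symbol G hf).toModel :=
  Subtype.ext (Ultraproduct.funMap_cast (L := LPV) (u := hyperfilter ℕ) (M := fun _ => ℕ) G f)

theorem Feasible.toModel_eq {f g : ℕ → ℕ} (hf : Feasible f) (hg : Feasible g) :
    hf.toModel = hg.toModel ↔ ∀ᶠ k in hyperfilter ℕ, f k = g k :=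
  Subtype.ext_iff.trans Quotient.eq''

section Terms

variable {M : Type*} [LPV.Structure M] {β : Type*}

theorem realize_func₀ (G : PVSymbol 0) (v : β → M) :
    Term.realize v (Term.func (L := LPV) G ![]) = Structure.funMap (L := LPV) G ![] :=
  congrArg (Structure.funMap (L := LPV) G) (Subsingleton.elim _ _)

theorem realize_func₁ (G : PVSymbol 1) (v : β → M) (t : LPV.Term β) :
    Term.realize v (Term.func (L := LPV) G ![t]) = Structure.funMap (L := LPV) G ![t.realize v] :=
  congrArg (Structure.funMap (L := LPV) G) (funext fun i => by fin_cases i; rfl)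

theorem realize_func₂ (G : PVSymbol 2) (v : β → M) (t u : LPV.Term β) :
    Term.realize v (Term.func (L := LPV) G ![t, u]) =
      Structure.funMap (L := LPV) G ![t.realize v, u.realize v] :=
  congrArg (Structure.funMap (L := LPV) G) (funext fun i => by fin_cases i <;> rfl)

theorem Vocabulary.realize_dWPHP {ε : ℝ} {k₀ : ℕ} (V : Vocabulary ε k₀) :
    V.dWPHP.Realize M ↔ ∀ c : M,
      Structure.funMap (L := LPV) V.dom ![c] = Structure.funMap (L := LPV) V.one ![] →
      ∃ y : M, Structure.funMap (L := LPV) V.le ![y, c] = Structure.funMap (L := LPV) V.one ![] ∧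
        ∀ x : M, Structure.funMap (L := LPV) V.le ![x, Structure.funMap (L := LPV) V.len ![c] ] =
          Structure.funMap (L := LPV) V.one ![] → Structure.funMap (L := LPV) V.tt ![c, x] ≠ y := by
  simp only [Vocabulary.dWPHP, Sentence.Realize, Formula.Realize, BoundedFormula.realize_all,
    BoundedFormula.realize_imp, BoundedFormula.realize_ex, BoundedFormula.realize_inf,
    BoundedFormula.realize_not, BoundedFormula.realize_bdEqual, realize_func₀, realize_func₁,
    realize_func₂]
  rfl

end Terms

/-- The instance that fails is the class of `ones`: for each feasible `y` of that length,
`exists_feasible_code` gives a preimage in the model. Atomic statements are checked coordinatewise,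
almost everywhere. -/
theorem not_realize_dWPHP {d : ℕ} (hd : ∀ S, InP S → HasCircuitsOfSize d S) {ε : ℝ}
    (hε₀ : 0 < ε) (hε₁ : ε < 1) {k₀ : ℕ} (V : Vocabulary ε k₀) :
    ¬ V.dWPHP.Realize feasibleSubstructure := by
  have g₀ (G : PVSymbol 0) : Feasible fun _ => G.toFun ![] := by
    convert Feasible.symbol G (f := ![]) fun i => i.elim0
  have g₁ (G : PVSymbol 1) {f : ℕ → ℕ} (hf : Feasible f) : Feasible fun k => G.toFun ![f k] := by
    convert Feasible.symbol G (f := ![f]) fun i => by fin_cases i; exact hf with k i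
    fin_cases i; rfl
  have g₂ (G : PVSymbol 2) {f g : ℕ → ℕ} (hf : Feasible f) (hg : Feasible g) :
      Feasible fun k => G.toFun ![f k, g k] := by
    convert Feasible.symbol G (f := ![f, g]) fun i => by fin_cases i; exacts [hf, hg] with k i
    fin_cases i <;> rfl
  have f₀ (G : PVSymbol 0) : Structure.funMap (L := LPV) (M := feasibleSubstructure) G ![] =
      (g₀ G).toModel := by
    convert Feasible.funMap_toModel G (f := ![]) fun i => i.elim0
  have f₁ (G : PVSymbol 1) {f : ℕ → ℕ} (hf : Feasible f) :
      Structure.funMap (L := LPV) G ![hf.toModel] = (g₁ G hf).toModel := by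
    convert Feasible.funMap_toModel G (f := ![f]) fun i => by fin_cases i; exact hf with i k i
    · fin_cases i; rfl
    · fin_cases i; rfl
  have f₂ (G : PVSymbol 2) {f g : ℕ → ℕ} (hf : Feasible f) (hg : Feasible g) :
      Structure.funMap (L := LPV) G ![hf.toModel, hg.toModel] = (g₂ G hf hg).toModel := by
    convert Feasible.funMap_toModel G (f := ![f, g])
      fun i => by fin_cases i; exacts [hf, hg] with i k i
    · fin_cases i <;> rfl
    · fin_cases i <;> rfl
  intro h
  obtain ⟨y, hy, h⟩ := V.realize_dWPHP.1 h feasible_ones.toModel (by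
    rw [f₁, f₀, Feasible.toModel_eq]
    -- The ultrafilter is nonprincipal, so finitely many small `k` do not matter.
    refine (eventually_ge_atTop k₀).filter_mono Nat.hyperfilter_le_atTop |>.mono fun k hk => ?_
    rw [V.one_spec, V.dom_spec, if_pos ⟨k, hk, rfl⟩])
  obtain ⟨f, hf, rfl⟩ := exists_toModel y
  obtain ⟨x, hx, hxf⟩ := exists_feasible_code hd hε₀ hε₁ hf
  have hxf' := hxf.filter_mono Nat.hyperfilter_le_atTop
  rw [f₂, f₀, Feasible.toModel_eq] at hy
  refine h hx.toModel ?_ ?_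
  · rw [f₁, f₂, f₀, Feasible.toModel_eq]
    refine hxf'.mono fun k hk => ?_
    rw [V.le_spec, V.one_spec, V.len_spec, if_pos (by omega)]
  · rw [f₂, Feasible.toModel_eq]
    filter_upwards [hxf', hy] with k hk hy
    -- The reduction modulo 2^(2^k) is harmless because `hy` says that `f k` is at most `ones k`.
    rw [V.tt_spec _ _ hk.1, hk.2, Nat.mod_eq_of_lt]
    rw [V.le_spec, V.one_spec] at hy
    have : f k ≤ ones k := by
      by_contra hc
      simp [hc] at hy
    have := Nat.one_le_two_pow (n := 2 ^ k)
    rw [ones] at *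
    omega

theorem not_models_dWPHP (hH : HypothesisH) {ε : ℝ} (hε₀ : 0 < ε) (hε₁ : ε < 1) {k₀ : ℕ}
    (V : Vocabulary ε k₀) : ¬ Theory.ModelsBoundedFormula TPV V.dWPHP := by
  obtain ⟨d, _, hd⟩ := hH
  have : Nonempty feasibleSubstructure := ⟨feasible_ones.toModel⟩
  exact fun h => not_realize_dWPHP hd hε₀ hε₁ V (h.realize_sentence feasibleSubstructure)

end SmallCircuits

/-! ### Polynomial-time search, comparison of binary numbers, and evaluation of circuits. -/

namespace SmallCircuits

open Function Computability

/-! ### Bounded search and its applications -/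

/-- The least `j` with `P j`, for an upwards closed `P`, truncated at `n`. -/
def search (P : ℕ → Bool) (n : ℕ) : ℕ := (fun j => bif P j then j else j + 1)^[n] 0

theorem search_eq {P : ℕ → Bool} {c : ℕ} (h : ∀ j, P j = true ↔ c ≤ j) (n : ℕ) :
    search P n = min n c := by
  induction n with
  | zero => simp [search]
  | succ n ih =>
    rw [search, iterate_succ_apply', ← search, ih]
    rcases hP : P (min n c)
    · have : ¬ c ≤ min n c := fun hc => by simp [(h _).2 hc] at hP
      simp only [cond_false]; omega
    · have := (h _).1 hP
      simp only [cond_true]; omega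

theorem search_le (P : ℕ → Bool) (n : ℕ) : search P n ≤ n := by
  induction n with
  | zero => simp [search]
  | succ n ih =>
    rw [search, iterate_succ_apply', ← search]
    cases P (search P n) <;> simp only [cond_false, cond_true] <;> omega

namespace PTime

variable {α : Type} [WordEncodable α]

/-- The counter never exceeds the number of rounds, so the iteration is bounded. With numbers in
unary, this gives logarithms, quotients and roots. -/
theorem search {P : α → ℕ → Bool} {n : α → ℕ} (hn : PTime n)
    (hP : PTime fun x : α × ℕ => P x.1 x.2) : PTime fun a => search (P a) (n a) :=
  iterate (step := fun a j => bif P a j then j else j + 1) hn (const 0) (by fun_prop) hn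
    fun a i hi => (size_nat _).trans_le ((search_le (P a) i).trans hi)

@[fun_prop]
theorem clog {f : α → ℕ} (hf : PTime f) : PTime fun a => Nat.clog 2 (f a) :=
  (search (P := fun a j => Nat.ble (f a) (SmallCircuits.truncPow j (f a))) hf (by fun_prop)).of_eq
    fun a => by
      rw [search_eq (c := Nat.clog 2 (f a)) fun j => ?_, min_eq_right]
      · exact (Nat.clog_le_iff_le_pow (by norm_num)).2 Nat.lt_two_pow_self.le
      · rw [Nat.ble_eq, truncPow_eq, le_min_iff, Nat.clog_le_iff_le_pow (by norm_num)]
        simp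

theorem div {f g : α → ℕ} (hf : PTime f) (hg : PTime g) (h : ∀ a, 0 < g a) :
    PTime fun a => f a / g a :=
  (search (P := fun a j => Nat.ble (f a + 1) ((j + 1) * g a)) hf (by fun_prop)).of_eq fun a => by
    rw [search_eq (c := f a / g a) fun j => ?_, min_eq_right (Nat.div_le_self _ _)]
    rw [Nat.ble_eq, Nat.add_one_le_iff, ← Nat.div_lt_iff_lt_mul (h a), Nat.lt_add_one_iff]

@[fun_prop]
theorem testBit {f g : α → ℕ} (hf : PTime f) (hg : PTime g) :
    PTime fun a => (f a).testBit (g a) := by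
  -- The power has to be truncated to be short in unary; the divisor `f a + 1` already gives the
  -- quotient 0, as any larger power would.
  have h₁ : PTime fun a => f a / SmallCircuits.truncPow (g a) (f a + 1) :=
    div hf (by fun_prop) fun a => by rw [truncPow_eq]; exact lt_min (by positivity) (by omega)
  have h₂ : PTime fun n : ℕ => n / 2 := div id (const 2) (by simp)
  have h₃ : PTime fun n : ℕ => !Nat.beq (2 * (n / 2)) n := by fun_prop
  refine (h₃.comp h₁).of_eq fun a => ?_
  have e : f a / SmallCircuits.truncPow (g a) (f a + 1) = f a / 2 ^ g a := by
    rw [truncPow_eq]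
    rcases le_total (2 ^ g a) (f a + 1) with h | h
    · rw [min_eq_left h]
    · rw [min_eq_right h, Nat.div_eq_of_lt (by omega)]
      rcases h.eq_or_lt with h | h
      · rw [← h, Nat.div_eq_of_lt (by omega)]
      · rw [Nat.div_eq_of_lt (by omega)]
  rw [e, Nat.testBit_eq_decide_div_mod_eq, Bool.eq_iff_iff, Bool.not_eq_true', Bool.eq_false_iff,
    Ne, Nat.beq_eq, decide_eq_true_iff]
  omega

end PTime

/-! ### Comparison of binary numbers -/

/-- One step of the comparison of two binary numbers, from the least significant digit on. -/
def compareStep (x : List Bool × List Bool × Bool) : List Bool × List Bool × Bool :=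
  (x.1.tail, x.2.1.tail, bif x.1.headD false then (bif x.2.1.headD false then x.2.2 else false)
    else (bif x.2.1.headD false then true else x.2.2))

/-- More significant digits come later and override the flag `r`, which survives only ties. An
exhausted list supplies zeros. -/
theorem iterate_compareStep (n : ℕ) (u v : List Bool) (r : Bool) (hu : u.length ≤ n)
    (hv : v.length ≤ n) : (compareStep^[n] (u, v, r)).2.2 = true ↔
      bitsVal u < bitsVal v ∨ bitsVal u = bitsVal v ∧ r = true := by
  induction n generalizing u v r with
  | zero =>
    rw [List.length_eq_zero_iff.1 (Nat.le_zero.1 hu), List.length_eq_zero_iff.1 (Nat.le_zero.1 hv)]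
    simp
  | succ n ih =>
    have h : ∀ l : List Bool, bitsVal l = 2 * bitsVal l.tail + (l.headD false).toNat := by
      rintro (_ | ⟨b, l⟩) <;> simp
    rw [iterate_succ_apply, compareStep, ih _ _ _ (by simp; omega) (by simp; omega), h u, h v]
    cases u.headD false <;> cases v.headD false <;> cases r <;> simp <;> omega

/-- Whether one binary number is at most another. -/
def leBits (u v : List Bool) : Bool := (compareStep^[u.length + v.length] (u, v, true)).2.2

theorem leBits_iff (u v : List Bool) : leBits u v = true ↔ bitsVal u ≤ bitsVal v := by
  rw [leBits, iterate_compareStep _ _ _ _ (by omega) (by omega)]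
  simp [le_iff_lt_or_eq]

theorem ptime_leBits : PTime fun x : List Bool × List Bool => leBits x.1 x.2 := by
  have h : PTime fun x : List Bool × List Bool => compareStep^[x.1.length + x.2.length]
      (x.1, x.2, true) := by
    refine PTime.iterate (step := fun _ => compareStep) (by fun_prop) ?_ ?_
      (b := fun x => x.1.length + x.2.length + 1) (by fun_prop) fun x i hi => ?_
    · exact PTime.fst.pair (PTime.snd.pair (.const true))
    · unfold compareStep; fun_prop
    · clear hi
      induction i with
      | zero => simp; omega
      | succ i ih =>
        rw [iterate_succ_apply']
        refine le_trans ?_ ih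
        simp only [compareStep, size_pair, size_list, size_bool, List.length_tail]
        omega
  unfold leBits
  fun_prop

/-! ### Evaluation of circuits -/

/-- The value of a node with the operation code `op` and the operands `a` and `b`, when the input
is the number `j` and `v` is the list of the values of the earlier nodes. -/
def gateValue (k j : ℕ) (v : List Bool) (op a b : ℕ) : Bool :=
  bif Nat.beq op 1 && Nat.ble (a + 1) k then j.testBit a else
  bif Nat.beq op 2 && Nat.ble (a + 1) v.length then !v.getD a false else
  bif Nat.beq op 3 && (Nat.ble (a + 1) v.length && Nat.ble (b + 1) v.length) then
    v.getD a false && v.getD b false else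
  bif Nat.beq op 4 && (Nat.ble (a + 1) v.length && Nat.ble (b + 1) v.length) then
    !(!v.getD a false && !v.getD b false) else
  bif Nat.beq op 5 then true else v.getD (v.length - 1) false

theorem getD_ofFn {i : ℕ} (w : Fin i → Bool) (a : ℕ) (h : a < i) :
    (List.ofFn w).getD a false = w ⟨a, h⟩ := by
  simp [List.getD_eq_getElem?_getD, h]

theorem eval_idleGate {k i : ℕ} (x : Fin k → Bool) (w : Fin i → Bool) :
    (idleGate k i).eval x w = (List.ofFn w).getD (i - 1) false := by
  cases i with
  | zero => simp [idleGate, Gate.eval]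
  | succ i =>
    rw [getD_ofFn _ _ (by omega)]
    simp [idleGate, Gate.eval, Fin.last]

theorem gateValue_eq {k i : ℕ} (j op a b : ℕ) (w : Fin i → Bool) :
    gateValue k j (List.ofFn w) op a b =
      (decodeGate k i op a b).eval (fun l : Fin k => j.testBit l) w := by
  have hb : ∀ x y, Nat.beq x y = decide (x = y) := fun x y => by
    rw [Bool.eq_iff_iff, Nat.beq_eq, decide_eq_true_iff]
  have hl : ∀ x y, Nat.ble (x + 1) y = decide (x < y) := fun x y => by
    rw [Bool.eq_iff_iff, Nat.ble_eq, decide_eq_true_iff, Nat.add_one_le_iff]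
  unfold gateValue decodeGate
  simp only [hb, hl, List.length_ofFn, ← Bool.decide_and, Bool.cond_decide]
  rcases eq_or_ne op 1 with rfl | h₁
  · by_cases h : a < k
    · simp [h, Gate.eval]
    · simp [h, eval_idleGate]
  rcases eq_or_ne op 2 with rfl | h₂
  · by_cases h : a < i
    · simp [h, Gate.eval]
    · simp [h, eval_idleGate]
  rcases eq_or_ne op 3 with rfl | h₃
  · by_cases h : a < i ∧ b < i
    · simp [h.1, h.2, Gate.eval]
    · simp [h, eval_idleGate]
  rcases eq_or_ne op 4 with rfl | h₄
  · by_cases h : a < i ∧ b < i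
    · simp [h.1, h.2, Gate.eval]
    · simp [h, eval_idleGate]
  rcases eq_or_ne op 5 with rfl | h₅
  · simp [Gate.eval]
  · simp [h₁, h₂, h₃, h₄, h₅, eval_idleGate]

/-- A field of a word of bits, as a number, truncated at `B`. -/
def listField (x : List Bool) (pos len B : ℕ) : ℕ := truncVal ((x.drop pos).take len) B

theorem bitsVal_take_drop (x : List Bool) (pos len : ℕ) :
    bitsVal ((x.drop pos).take len) = bitField (bitsVal x) pos len := by
  refine Nat.eq_of_testBit_eq fun i => ?_
  rw [← getD_eq_testBit, bitField, Nat.testBit_mod_two_pow, Nat.testBit_div_two_pow,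
    ← getD_eq_testBit]
  simp only [List.getD_eq_getElem?_getD, List.getElem?_take, List.getElem?_drop]
  by_cases h : i < len <;> simp [h, add_comm]

/-- Operation codes from 6 on are unused, and operands from `k + i` on are out of range both as
inputs and as nodes. So the fields of a block can be truncated to short unary numbers. -/
theorem decodeGate_min (k i op a b : ℕ) :
    decodeGate k i (min op 6) (min a (k + i)) (min b (k + i)) = decodeGate k i op a b := by
  have h₁ : decodeGate k i (min op 6) = decodeGate k i op := by
    funext a b
    rcases le_total op 6 with h | h
    · rw [min_eq_left h]
    · rw [min_eq_right h]
      simp [decodeGate, show op ≠ 1 by omega, show op ≠ 2 by omega, show op ≠ 3 by omega,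
        show op ≠ 4 by omega, show op ≠ 5 by omega]
  have h₂ : decodeGate k i op (min a (k + i)) = decodeGate k i op a := by
    funext b
    rcases le_total a (k + i) with h | h
    · rw [min_eq_left h]
    · rw [min_eq_right h]
      simp [decodeGate, show ¬ a < k by omega, show ¬ a < i by omega]
  have h₃ : decodeGate k i op a (min b (k + i)) = decodeGate k i op a b := by
    rcases le_total b (k + i) with h | h
    · rw [min_eq_left h]
    · rw [min_eq_right h]
      simp [decodeGate, show ¬ b < i by omega]
  rw [h₁, h₂, h₃]

/-- The values of the first `n` nodes of the circuit coded by `x`, on the input `j`. -/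
def nodeValues (k L : ℕ) (x : List Bool) (j n : ℕ) : List Bool :=
  (fun v : List Bool => v ++ [gateValue k j v (listField x (10 * L * v.length) (2 * L) 6)
    (listField x (10 * L * v.length + 2 * L) (4 * L) (k + v.length))
    (listField x (10 * L * v.length + 6 * L) (4 * L) (k + v.length))])^[n] []

theorem nodeValues_eq (k L : ℕ) (x : List Bool) (j n : ℕ) : nodeValues k L x j n =
    List.ofFn ((decodeCircuit k L (bitsVal x) n).vals fun i : Fin k => j.testBit i) := by
  induction n with
  | zero => simp [nodeValues]
  | succ n ih =>
    rw [nodeValues, iterate_succ_apply', ← nodeValues, ih, List.ofFn_succ_last]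
    simp only [gateValue_eq, listField, truncVal_eq, bitsVal_take_drop, List.length_ofFn,
      decodeGate_min, decodeCircuit, Circuit.vals, Fin.snoc_castSucc, Fin.snoc_last]

/-- The first `m` bits of the truth table of the circuit with `s` nodes that is coded by `x`. -/
def tableBits (k L s : ℕ) (x : List Bool) (m : ℕ) : List Bool :=
  (fun t : List Bool => t ++ [(nodeValues k L x t.length s).getD (s - 1) false])^[m] []

theorem getD_nodeValues (k L s : ℕ) (x : List Bool) (j : ℕ) :
    (nodeValues k L x j s).getD (s - 1) false =
      (decodeCircuit k L (bitsVal x) s).eval fun i : Fin k => j.testBit i := by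
  rw [nodeValues_eq]
  cases s with
  | zero => rfl
  | succ s =>
    rw [Circuit.eval_eq_vals, getD_ofFn _ _ (by omega)]
    rfl

theorem bitsVal_append (u v : List Bool) : bitsVal (u ++ v) = bitsVal u + 2 ^ u.length * bitsVal v := by
  induction u with
  | nil => simp
  | cons b u ih => simp only [List.cons_append, bitsVal_cons, ih, List.length_cons, pow_succ]; ring

theorem tableBits_spec (k L s : ℕ) (x : List Bool) (m : ℕ) :
    (tableBits k L s x m).length = m ∧ bitsVal (tableBits k L s x m) =
      ∑ j ∈ Finset.range m, if (decodeCircuit k L (bitsVal x) s).eval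
        (fun i : Fin k => j.testBit i) = true then 2 ^ j else 0 := by
  induction m with
  | zero => simp [tableBits]
  | succ m ih =>
    rw [tableBits, iterate_succ_apply', ← tableBits, getD_nodeValues, bitsVal_append, ih.1, ih.2,
      Finset.sum_range_succ]
    refine ⟨by simp [ih.1], ?_⟩
    cases (decodeCircuit k L (bitsVal x) s).eval fun i : Fin k => m.testBit i <;> simp

namespace PTime

variable {α : Type} [WordEncodable α]

@[fun_prop]
theorem listField {x : α → List Bool} {pos len B : α → ℕ} (hx : PTime x) (hpos : PTime pos)
    (hlen : PTime len) (hB : PTime B) :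
    PTime fun a => listField (x a) (pos a) (len a) (B a) := by
  unfold SmallCircuits.listField
  fun_prop

@[fun_prop]
theorem gateValue {k j op a b : α → ℕ} {v : α → List Bool} (hk : PTime k) (hj : PTime j)
    (hv : PTime v) (hop : PTime op) (ha : PTime a) (hb : PTime b) :
    PTime fun x => gateValue (k x) (j x) (v x) (op x) (a x) (b x) := by
  unfold SmallCircuits.gateValue
  fun_prop

@[fun_prop]
theorem nodeValues {k L j n : α → ℕ} {x : α → List Bool} (hk : PTime k) (hL : PTime L)
    (hx : PTime x) (hj : PTime j) (hn : PTime n) :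
    PTime fun a => nodeValues (k a) (L a) (x a) (j a) (n a) :=
  iterate (step := fun a (v : List Bool) => v ++ [SmallCircuits.gateValue (k a) (j a) v
    (SmallCircuits.listField (x a) (10 * L a * v.length) (2 * L a) 6)
    (SmallCircuits.listField (x a) (10 * L a * v.length + 2 * L a) (4 * L a) (k a + v.length))
    (SmallCircuits.listField (x a) (10 * L a * v.length + 6 * L a) (4 * L a) (k a + v.length))])
    hn (const []) (by fun_prop) hn fun a i hi => by
      refine le_trans (le_of_eq ?_) hi
      rw [size_list]
      exact (congrArg List.length (nodeValues_eq (k a) (L a) (x a) (j a) i)).trans List.length_ofFn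

@[fun_prop]
theorem tableBits {k L s m : α → ℕ} {x : α → List Bool} (hk : PTime k) (hL : PTime L)
    (hs : PTime s) (hx : PTime x) (hm : PTime m) :
    PTime fun a => tableBits (k a) (L a) (s a) (x a) (m a) :=
  iterate (step := fun a (t : List Bool) => t ++
    [(SmallCircuits.nodeValues (k a) (L a) (x a) t.length (s a)).getD (s a - 1) false])
    hm (const []) (by fun_prop) hm fun a i hi =>
      (tableBits_spec (k a) (L a) (s a) (x a) i).1.trans_le hi

end PTime

end SmallCircuits

/-! ### Existence of the vocabulary for rational exponents. -/

namespace SmallCircuits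

open Function Computability

/-! ### Symbols for the vocabulary -/

theorem exists_symbol_const (c : ℕ) : ∃ G : PVSymbol 0, ∀ v, G.toFun v = c := by
  have h : PTime fun _ : List (Option Bool) => encodeNat c := .const _
  exact ⟨⟨fun _ => c, ((h.congr_input (ea' := encodeTuple (n := 0)) encodeTuple
    fun _ => rfl).congr_output (eb' := encodeNat) (f' := fun _ => c) fun _ => rfl).some⟩, fun _ => rfl⟩

theorem exists_symbol_le : ∃ G : PVSymbol 2, ∀ v, G.toFun v = if v 0 ≤ v 1 then 1 else 0 := by
  have h : PTime fun x : List Bool × List Bool => bif leBits x.1 x.2 then [true] else [] :=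
    ptime_leBits.cond (.const _) (.const _)
  refine exists_symbol₂ (f := fun a b => if a ≤ b then 1 else 0) h fun a b => ?_
  have := leBits_iff (encodeNat a) (encodeNat b)
  rw [bitsVal_encodeNat, bitsVal_encodeNat] at this
  by_cases hab : a ≤ b
  · simp [hab, this.2 hab]; rfl
  · simp [hab, Bool.eq_false_iff.2 (mt this.1 hab)]

/-- Whether `w` consists of `2 ^ k` ones for some `k ≥ k₀`. -/
def isOnes (k₀ : ℕ) (w : List Bool) : Bool :=
  w.foldl (fun r b => r && b) true && (Nat.beq (truncPow (Nat.clog 2 w.length) (w.length + 1))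
    w.length && Nat.ble k₀ (Nat.clog 2 w.length))

theorem ptime_isOnes (k₀ : ℕ) : PTime (isOnes k₀) := by
  have h : PTime fun w : List Bool => w.foldl (fun r b => r && b) true :=
    PTime.foldl (step := fun _ r b => r && b) .id (.const true) (by fun_prop) (.const 1)
      fun _ _ => le_rfl
  unfold isOnes
  fun_prop

theorem foldl_and (w : List Bool) (r : Bool) : w.foldl (fun r b => r && b) r = true ↔
    r = true ∧ ∀ b ∈ w, b = true := by
  induction w generalizing r with
  | nil => simp
  | cons b w ih => simp [ih, and_assoc]

theorem clog_two_pow (k : ℕ) : Nat.clog 2 (2 ^ k) = k := Nat.clog_pow 2 k (by norm_num)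

/-- A length is a power of two iff it equals 2 to its rounded-up logarithm; truncation at the length
plus one still detects an excess. -/
theorem isOnes_iff (k₀ : ℕ) (w : List Bool) :
    isOnes k₀ w = true ↔ ∃ k, k₀ ≤ k ∧ w = List.replicate (2 ^ k) true := by
  simp only [isOnes, Bool.and_eq_true, foldl_and, Nat.beq_eq, Nat.ble_eq, truncPow_eq, true_and]
  constructor
  · rintro ⟨h₁, h₂, h₃⟩
    refine ⟨_, h₃, List.eq_replicate_iff.2 ⟨by omega, h₁⟩⟩
  · rintro ⟨k, hk, rfl⟩
    simp [hk]

theorem exists_symbol_ones (k₀ : ℕ) : open Classical in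
    ∃ G : PVSymbol 1, ∀ v, G.toFun v = if ∃ k, k₀ ≤ k ∧ v 0 = ones k then 1 else 0 := by
  classical
  have h : PTime fun w => bif isOnes k₀ w then [true] else [] :=
    (ptime_isOnes k₀).cond (.const _) (.const _)
  refine exists_symbol₁ (f := fun z => if ∃ k, k₀ ≤ k ∧ z = ones k then 1 else 0) h fun z => ?_
  have := isOnes_iff k₀ (encodeNat z)
  have e : ∀ k, encodeNat z = List.replicate (2 ^ k) true ↔ z = ones k := fun k => by
    rw [← encodeNat_two_pow_sub_one, ← ones]
    exact ⟨fun h => by rw [← bitsVal_encodeNat z, h, bitsVal_encodeNat], fun h => by rw [h]⟩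
  simp only [e] at this
  by_cases hz : ∃ k, k₀ ≤ k ∧ z = ones k
  · simp only [hz, this.2 hz]; rfl
  · simp only [hz, Bool.eq_false_iff.2 (mt this.1 hz)]; rfl

/-- The integer part of the root `m ^ (p / q)`, truncated at `m`. -/
def ratPow (p q m : ℕ) : ℕ := search (fun s => !Nat.ble ((s + 1) ^ q) (m ^ p)) m

@[fun_prop]
theorem PTime.ratPow {α : Type} [WordEncodable α] {f : α → ℕ} (hf : PTime f) (p q : ℕ) :
    PTime fun a => ratPow p q (f a) :=
  search hf (by fun_prop)

/-- For ε = p/q, the condition t ≤ 2^(εk) is the integer inequality t^q ≤ (2^k)^p, which is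
decidable in polynomial time. The truncation of the search at 2^k is harmless because ε < 1. -/
theorem ratPow_two_pow {ε : ℝ} {p q : ℕ} (hq : 0 < q) (hε : ε = p / q) (hε₁ : ε < 1) (k : ℕ) :
    ratPow p q (2 ^ k) = sizeBound ε k := by
  have h : ∀ t, t ^ q ≤ (2 ^ k) ^ p ↔ t ≤ sizeBound ε k := fun t => by
    rw [sizeBound, Nat.le_floor_iff (by positivity),
      ← pow_le_pow_iff_left₀ (a := (t : ℝ)) (Nat.cast_nonneg t) (by positivity) hq.ne',
      ← Real.rpow_natCast ((2 : ℝ) ^ (ε * k)) q, ← Real.rpow_mul (by norm_num),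
      show ε * k * q = ((k * p : ℕ) : ℝ) by rw [hε]; push_cast; field_simp, Real.rpow_natCast,
      ← pow_mul]
    exact_mod_cast Iff.rfl
  rw [ratPow, search_eq (c := sizeBound ε k) fun s => ?_, min_eq_right (sizeBound_le hε₁ k)]
  rw [Bool.not_eq_true', Bool.eq_false_iff, Ne, Nat.ble_eq, h]
  omega

/-- A vocabulary exists for every rational exponent. -/
theorem nonempty_vocabulary {ε : ℝ} (hε₀ : 0 < ε) (hε₁ : ε < 1) (k₀ : ℕ)
    (h : ∃ r : ℚ, (r : ℝ) = ε) : Nonempty (Vocabulary ε k₀) := by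
  obtain ⟨r, hr⟩ := h
  have hr₀ : 0 < r := by rw [← hr] at hε₀; exact_mod_cast hε₀
  have hpq : ε = r.num.toNat / r.den := by
    rw [← hr, Rat.cast_def]
    congr 1
    exact_mod_cast (Int.toNat_of_nonneg (Rat.num_nonneg.2 hr₀.le)).symm
  set p := r.num.toNat
  set q := r.den
  have hs : ∀ k, ratPow p q (2 ^ k) = sizeBound ε k := ratPow_two_pow r.den_pos hpq hε₁
  -- The expansion of `1 ^ m` has length `m`, so the word length supplies `m` in unary, and from it
  -- `k`, `s` and the block length.
  have hlen : PTime fun w : List Bool => List.replicate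
      (10 * ratPow p q w.length * Nat.clog 2 (ratPow p q w.length)) true := by fun_prop
  have htt : PTime fun x : List Bool × List Bool => trimBits (tableBits (Nat.clog 2 x.1.length)
      (Nat.clog 2 (ratPow p q x.1.length)) (ratPow p q x.1.length) x.2 x.1.length) := by fun_prop
  obtain ⟨one, hone⟩ := exists_symbol_const 1
  obtain ⟨le, hle⟩ := exists_symbol_le
  obtain ⟨dom, hdom⟩ := exists_symbol_ones k₀
  obtain ⟨len, hlen⟩ := exists_symbol₁ hlen fun a => (encodeNat_two_pow_sub_one _).symm
  obtain ⟨tt, htt⟩ := exists_symbol₂ htt fun a b => trimBits_eq _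
  have hones : ∀ k, (encodeNat (ones k)).length = 2 ^ k := fun k => by
    rw [ones, encodeNat_two_pow_sub_one, List.length_replicate]
  refine ⟨⟨one, hone, le, fun a b => hle _, dom, fun z => hdom _, len, fun k => ?_, tt,
    fun k x _ => ?_⟩⟩
  · rw [hlen]
    simp only [Matrix.cons_val_zero, hones, hs]
    rfl
  · rw [htt]
    simp only [Matrix.cons_val_zero, Matrix.cons_val_one, hones, hs, clog_two_pow,
      (tableBits_spec _ _ _ _ _).2, bitsVal_encodeNat]
    rfl

end SmallCircuits

theorem theorem1 (hH : SmallCircuits.HypothesisH) (ε : ℝ) (hε₀ : 0 < ε) (hε₁ : ε < 1)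
    (k₀ : ℕ) (hk₀ : 1 ≤ k₀) :
    ((∃ q : ℚ, (q : ℝ) = ε) → Nonempty (SmallCircuits.Vocabulary ε k₀)) ∧
    ∀ V : SmallCircuits.Vocabulary ε k₀,
      ¬ FirstOrder.Language.Theory.ModelsBoundedFormula SmallCircuits.TPV V.dWPHP :=
  ⟨SmallCircuits.nonempty_vocabulary hε₀ hε₁ k₀, SmallCircuits.not_models_dWPHP hH hε₀ hε₁⟩
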